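/- **Lemma 4.1.** Let $M$ be a smooth $n$-manifold and let $g(t)$, $t\in(0,T]$, be a smooth solution of the Ricci flow $\partial_t g_{ij}=-2R_{ij}$ on $M$ (smooth jointly in $(x,t)$; at $t=T$ time derivatives are one-sided). Curvature conventions: in coordinates $R_{ijkl}=g_{lm}(\partial_j\Gamma^m_{ik}-\partial_i\Gamma^m_{jk}+\Gamma^e_{ik}\Gamma^m_{je}-\Gamma^e_{jk}\Gamma^m_{ie})$ (so $R_{ijij}>0$ on the round sphere), $R_{ij}=g^{kl}R_{ikjl}$, $R=g^{ij}R_{ij}$. Put $$P_{ijk}=\nabla_iR_{jk}-\nabla_jR_{ik},\qquad M_{ij}=\Delta R_{ij}+2R_{ikjl}R^{kl}-R_i^kR_{kj}-\tfrac12\nabla_i\nabla_jR+\tfrac1{2t}R_{ij}.$$ For $N\in\mathbb N$ let $\bar g=\bar g_N$ be the symmetric 2-tensor on $\bar M=M\times(0,T]$ with $$\bar g_{00}=R-\tfrac{N}{2t},\qquad \bar g_{ij}=g_{ij},\qquad \bar g_{0i}=0,$$ where $0$ denotes the coordinate $t$ and $i,j$ denote coordinates $x^1,\dots,x^n$ on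 $M$. Near a given point it is a nondegenerate metric once $N$ is large. Let $\bar\nabla$, $\bar R_{abcd}$ and $\bar\Delta=\bar g^{ab}\bar\nabla_a\bar\nabla_b$ be its Levi-Civita connection, curvature tensor and Laplacian (acting on functions and on tensors), and $\bar\nabla_0=\bar\nabla_{\partial/\partial t}$. A 2-form $\bar U$ on $\bar M$ is written with upper indices, as $$\bar U=\sum_{i,j}\bar U^{ij}\,\partial_i\wedge\partial_j+\sum_i\bar U^{0i}\,\partial_0\wedge\partial_i,\qquad X\wedge Y=\tfrac12(X\otimes Y-Y\otimes X),\quad \bar U^{ij}=-\bar U^{ji};$$ that is, $\bar U^{ij}$ is the $ij$ component of the antisymmetric tensor $\bar U$ and $\bar U^{0i}$ is twice its $0i$ component. The components of $\bar\nabla_a\bar U$ and $(\bar\nabla_0-\bar\Delta)\bar U$ are denoted in the same way: $\bar\nabla_k\bar U^{ij}$ means $(\bar\nabla_k\bar U)^{ij}$, and so on. Let $\overline{\mathrm{Rm}}(\bar U,\bar U)$ be the full contraction of the curvature tensor of $\bar g$ with $\bar U\otimes\bar U$, i.e. $$\overline{\mathrm{Rm}}(\bar U,\bar U)=\bar R_{ijkl}\bar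 U^{ij}\bar U^{kl}+2\bar R_{ij0k}\bar U^{ij}\bar U^{0k}+\bar R_{0i0j}\bar U^{0i}\bar U^{0j}.$$ Fix a point $(x_0,t_0)\in\bar M$, a chart of $M$ around $x_0$, and $K\in\mathbb{R}$. Then there are constants $C$ and $N_0$ (depending on the flow, the point, the chart and $K$) such that the following holds for all $N\ge N_0$. Let $\bar U$ be a 2-form on $\bar M$, defined in the chart and twice continuously differentiable near $(x_0,t_0)$, whose tensor components in the coordinates $(t,x^1,\dots,x^n)$, as well as their first $t$-derivatives, are bounded by $K$ in absolute value at $(x_0,t_0)$, and suppose that at $(x_0,t_0)$, for all $i,j,k$, $$\bar\nabla_k\bar U^{ij}=\tfrac1{4t}\big(\delta^i_k\bar U^{0j}-\delta^j_k\bar U^{0i}\big),\qquad \bar\nabla_i\bar U^{0j}=0,\qquad (\bar\nabla_0-\bar\Delta)\bar U^{ij}=0,\qquad (\bar\nabla_0-\bar\Delta)\bar U^{0i}=\tfrac1{2t}\bar U^{0i}.$$ Then at $(x_0,t_0)$ the function $\overline{\mathrm{Rm}}(\bar U,\bar U)$ satisfies $$\begin{aligned}\Big|(\bar\nabla_0-\bar\Delta)\big(\overline{\mathrm{Rm}}(\bar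 U,\bar U)\big)-\Big(&2R_{ikjl}M^{kl}\bar U^{0i}\bar U^{0j}-2P_{ikl}P_j{}^{lk}\bar U^{0i}\bar U^{0j}+8R_{ilkm}P^l{}_j{}^m\bar U^{ij}\bar U^{0k}\\&+4R_{imkn}R_j{}^m{}_l{}^n\bar U^{ij}\bar U^{kl}+g^{ik}g^{jl}Q_{ij}Q_{kl}\Big)\Big|\le\frac CN,\end{aligned}$$ where $Q_{ij}=P_{ijm}\bar U^{0m}+R_{ijmn}\bar U^{mn}$. -/

import Mathlib

open scoped Manifold ContDiff

namespace HyperbolicThermostat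

noncomputable section

/-! ### Tensor calculus in coordinates

A metric is given by its matrix of components `G : (ι → ℝ) → Matrix ι ι ℝ` on a set
`S` of coordinate vectors. Derivatives are taken within `S`; at interior points of `S` these are
the usual partial derivatives, and at a final time they are one-sided. -/

section Coordinates

variable {ι : Type} [Fintype ι] [DecidableEq ι]

/-- The partial derivative `∂f/∂x^a` within `S`. -/
def pd (S : Set (ι → ℝ)) (a : ι) (f : (ι → ℝ) → ℝ) (x : ι → ℝ) : ℝ :=
  fderivWithin ℝ f S x (Pi.single a 1)

/-- The Christoffel symbol `Γ^a_{bc}` of the Levi-Civita connection. -/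
def christoffel (G : (ι → ℝ) → Matrix ι ι ℝ) (S : Set (ι → ℝ)) (a b c : ι) (x : ι → ℝ) : ℝ :=
  (1 / 2) * ∑ d, (G x)⁻¹ a d *
    (pd S b (fun y => G y c d) x + pd S c (fun y => G y b d) x - pd S d (fun y => G y b c) x)

/-- The curvature tensor `R_{abcd}`, with the sign for which `R_{abab} > 0` on a round sphere:
`R_{abcd} = g_{df} (∂_b Γ^f_{ac} - ∂_a Γ^f_{bc} + Γ^e_{ac} Γ^f_{be} - Γ^e_{bc} Γ^f_{ae})`. -/
def riem (G : (ι → ℝ) → Matrix ι ι ℝ) (S : Set (ι → ℝ)) (a b c d : ι) (x : ι → ℝ) : ℝ :=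
  ∑ f, G x d f *
    (pd S b (christoffel G S f a c) x - pd S a (christoffel G S f b c) x +
      ∑ e, (christoffel G S e a c x * christoffel G S f b e x -
        christoffel G S e b c x * christoffel G S f a e x))

/-- The Ricci tensor `R_{ij} = g^{kl} R_{ikjl}`. -/
def ricci (G : (ι → ℝ) → Matrix ι ι ℝ) (S : Set (ι → ℝ)) (i j : ι) (x : ι → ℝ) : ℝ :=
  ∑ k, ∑ l, (G x)⁻¹ k l * riem G S i k j l x

/-- The scalar curvature `R = g^{ij} R_{ij}`. -/
def scal (G : (ι → ℝ) → Matrix ι ι ℝ) (S : Set (ι → ℝ)) (x : ι → ℝ) : ℝ :=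
  ∑ i, ∑ j, (G x)⁻¹ i j * ricci G S i j x

/-- The Hessian `∇_a ∇_b f` of a function. -/
def hessian (G : (ι → ℝ) → Matrix ι ι ℝ) (S : Set (ι → ℝ)) (f : (ι → ℝ) → ℝ)
    (a b : ι) (x : ι → ℝ) : ℝ :=
  pd S a (pd S b f) x - ∑ e, christoffel G S e a b x * pd S e f x

/-- The Laplacian `g^{ab} ∇_a ∇_b f` of a function. -/
def laplacian (G : (ι → ℝ) → Matrix ι ι ℝ) (S : Set (ι → ℝ)) (f : (ι → ℝ) → ℝ)
    (x : ι → ℝ) : ℝ :=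
  ∑ a, ∑ b, (G x)⁻¹ a b * hessian G S f a b x

/-- `∇_c A_{ab}` for a covariant 2-tensor `A`. -/
def nablaCo₂ (G : (ι → ℝ) → Matrix ι ι ℝ) (S : Set (ι → ℝ)) (A : ι → ι → (ι → ℝ) → ℝ)
    (c a b : ι) (x : ι → ℝ) : ℝ :=
  pd S c (A a b) x -
    ∑ e, (christoffel G S e c a x * A e b x + christoffel G S e c b x * A a e x)

/-- `∇_d B_{cab}` for a covariant 3-tensor `B`. -/
def nablaCo₃ (G : (ι → ℝ) → Matrix ι ι ℝ) (S : Set (ι → ℝ)) (B : ι → ι → ι → (ι → ℝ) → ℝ)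
    (d c a b : ι) (x : ι → ℝ) : ℝ :=
  pd S d (B c a b) x -
    ∑ e, (christoffel G S e d c x * B e a b x + christoffel G S e d a x * B c e b x +
      christoffel G S e d b x * B c a e x)

/-- `∇_c U^{ab}` for a contravariant 2-tensor `U`. -/
def nablaContra (G : (ι → ℝ) → Matrix ι ι ℝ) (S : Set (ι → ℝ)) (U : (ι → ℝ) → Matrix ι ι ℝ)
    (c a b : ι) (x : ι → ℝ) : ℝ :=
  pd S c (fun y => U y a b) x +
    ∑ e, (christoffel G S a c e x * U x e b + christoffel G S b c e x * U x a e)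

/-- `∇_d ∇_c U^{ab}` (second covariant derivative) for a contravariant 2-tensor `U`. -/
def nablaContraTwice (G : (ι → ℝ) → Matrix ι ι ℝ) (S : Set (ι → ℝ))
    (U : (ι → ℝ) → Matrix ι ι ℝ) (d c a b : ι) (x : ι → ℝ) : ℝ :=
  pd S d (nablaContra G S U c a b) x -
    (∑ e, christoffel G S e d c x * nablaContra G S U e a b x) +
    ∑ e, (christoffel G S a d e x * nablaContra G S U c e b x +
      christoffel G S b d e x * nablaContra G S U c a e x)

/-- The rough Laplacian `(ΔU)^{ab} = g^{cd} ∇_c ∇_d U^{ab}`. -/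
def laplacianContra (G : (ι → ℝ) → Matrix ι ι ℝ) (S : Set (ι → ℝ))
    (U : (ι → ℝ) → Matrix ι ι ℝ) (a b : ι) (x : ι → ℝ) : ℝ :=
  ∑ c, ∑ d, (G x)⁻¹ c d * nablaContraTwice G S U c d a b x

/-- `Rm(U, U) = R_{abcd} U^{ab} U^{cd}`, the full contraction of tensors. -/
def curvForm (G : (ι → ℝ) → Matrix ι ι ℝ) (S : Set (ι → ℝ)) (U : (ι → ℝ) → Matrix ι ι ℝ)
    (x : ι → ℝ) : ℝ :=
  ∑ a, ∑ b, ∑ c, ∑ d, riem G S a b c d x * U x a b * U x c d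

/-- `P_{ijk} = ∇_i R_{jk} - ∇_j R_{ik}`. -/
def tensorP (G : (ι → ℝ) → Matrix ι ι ℝ) (S : Set (ι → ℝ)) (i j k : ι) (x : ι → ℝ) : ℝ :=
  nablaCo₂ G S (ricci G S) i j k x - nablaCo₂ G S (ricci G S) j i k x

/-- `M_{ij} = ΔR_{ij} + 2 R_{ikjl} R^{kl} - R_i^k R_{kj} - (1/2) ∇_i ∇_j R + (1/2t) R_{ij}`. -/
def tensorM (G : (ι → ℝ) → Matrix ι ι ℝ) (S : Set (ι → ℝ)) (t : ℝ) (i j : ι)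
    (x : ι → ℝ) : ℝ :=
  (∑ p, ∑ q, (G x)⁻¹ p q * nablaCo₃ G S (nablaCo₂ G S (ricci G S)) p q i j x)
    + 2 * (∑ k, ∑ l, ∑ p, ∑ q,
        riem G S i k j l x * ((G x)⁻¹ k p * (G x)⁻¹ l q * ricci G S p q x))
    - (∑ k, ∑ p, (G x)⁻¹ k p * ricci G S i p x * ricci G S k j x)
    - (1 / 2) * hessian G S (scal G S) i j x
    + 1 / (2 * t) * ricci G S i j x

/-- The reaction terms, for a vector `W^i` and a bivector `V^{ij}` at the point `x`:
`2 R_{ikjl} M^{kl} W^i W^j - 2 P_{ikl} P_j^{lk} W^i W^j + 8 R_{ilkm} P^l_j^m V^{ij} W^k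
  + 4 R_{imkn} R_j^m_l^n V^{ij} V^{kl} + |P_{ijm} W^m + R_{ijmn} V^{mn}|^2`. -/
def reaction (G : (ι → ℝ) → Matrix ι ι ℝ) (S : Set (ι → ℝ)) (t : ℝ) (W : ι → ℝ)
    (V : ι → ι → ℝ) (x : ι → ℝ) : ℝ :=
  let h : Matrix ι ι ℝ := (G x)⁻¹
  let Rm : ι → ι → ι → ι → ℝ := fun i j k l => riem G S i j k l x
  let P : ι → ι → ι → ℝ := fun i j k => tensorP G S i j k x
  let Q : ι → ι → ℝ := fun i j => (∑ m, P i j m * W m) + ∑ m, ∑ n, Rm i j m n * V m n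
  2 * (∑ i, ∑ j, ∑ k, ∑ l,
      Rm i k j l * (∑ p, ∑ q, h k p * h l q * tensorM G S t p q x) * W i * W j)
    - 2 * (∑ i, ∑ j, ∑ k, ∑ l, P i k l * (∑ p, ∑ q, h l p * h k q * P j p q) * W i * W j)
    + 8 * (∑ i, ∑ j, ∑ k, ∑ l, ∑ m,
        Rm i l k m * (∑ p, ∑ q, h l p * h m q * P p j q) * V i j * W k)
    + 4 * (∑ i, ∑ j, ∑ k, ∑ l, ∑ m, ∑ n,
        Rm i m k n * (∑ p, ∑ q, h m p * h n q * Rm j p l q) * V i j * V k l)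
    + ∑ i, ∑ j, ∑ k, ∑ l, h i k * h j l * Q i j * Q k l

end Coordinates

/-! ### Ricci flows on manifolds, in charts -/

section Flow

variable {n : ℕ} {M : Type*} [TopologicalSpace M] [ChartedSpace (EuclideanSpace ℝ (Fin n)) M]

/-- The coordinate region of a chart `e`. -/
def chartRegion (e : OpenPartialHomeomorph M (EuclideanSpace ℝ (Fin n))) : Set (Fin n → ℝ) :=
  {y | WithLp.toLp 2 y ∈ e.target}

/-- The coordinate region of `(domain of e) × (0, T]` in space-time; coordinate `0` is the time and
the coordinates `1, …, n` are those of the chart `e`. -/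
def spacetimeRegion (e : OpenPartialHomeomorph M (EuclideanSpace ℝ (Fin n))) (T : ℝ) :
    Set (Fin (n + 1) → ℝ) :=
  {z | z 0 ∈ Set.Ioc 0 T ∧ Fin.tail z ∈ chartRegion e}

/-- The coordinate vector field `∂/∂x^i` of the chart `e`, at the point with coordinates `y`. -/
def coordVec (e : OpenPartialHomeomorph M (EuclideanSpace ℝ (Fin n))) (y : Fin n → ℝ)
    (i : Fin n) : TangentSpace (𝓡 n) (e.symm (WithLp.toLp 2 y)) :=
  mfderiv (𝓡 n) (𝓡 n) e.symm (WithLp.toLp 2 y) (EuclideanSpace.single i (1 : ℝ))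

variable [IsManifold (𝓡 n) ∞ M]

/-- The components `g_{ij}` of a smooth Riemannian metric in the chart `e`. -/
def chartMetric
    (g : Bundle.ContMDiffRiemannianMetric (𝓡 n) ∞ (EuclideanSpace ℝ (Fin n))
      (fun x : M => TangentSpace (𝓡 n) x))
    (e : OpenPartialHomeomorph M (EuclideanSpace ℝ (Fin n))) (y : Fin n → ℝ) :
    Matrix (Fin n) (Fin n) ℝ :=
  Matrix.of fun i j => g.inner (e.symm (WithLp.toLp 2 y)) (coordVec e y i) (coordVec e y j)

/-- `g(t)`, `t ∈ (0, T]`, is a smooth solution of the Ricci flow `∂g/∂t = -2 Ric` on `M`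
(the values of `g` outside `(0, T]` play no role). -/
structure IsRicciFlow
    (g : ℝ → Bundle.ContMDiffRiemannianMetric (𝓡 n) ∞ (EuclideanSpace ℝ (Fin n))
      (fun x : M => TangentSpace (𝓡 n) x)) (T : ℝ) : Prop where
  /-- joint smoothness in space and time -/
  smooth : ∀ e ∈ IsManifold.maximalAtlas (𝓡 n) ∞ M, ∀ i j : Fin n,
    ContDiffOn ℝ ∞ (fun z : Fin (n + 1) → ℝ => chartMetric (g (z 0)) e (Fin.tail z) i j)
      (spacetimeRegion e T)
  /-- the evolution equation -/
  flow : ∀ e ∈ IsManifold.maximalAtlas (𝓡 n) ∞ M, ∀ t ∈ Set.Ioc 0 T, ∀ y ∈ chartRegion e,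
    ∀ i j : Fin n,
      HasDerivWithinAt (fun s => chartMetric (g s) e y i j)
        (-2 * ricci (chartMetric (g t) e) (chartRegion e) i j y) (Set.Ioc 0 T) t

/-- The metric `ḡ` on `M × (0, T]` in the coordinates `(t, x^1, …, x^n)`:
`ḡ_{00} = R - N/(2t)`, `ḡ_{ij} = g_{ij}`, `ḡ_{0i} = 0`. -/
def thermostatMetric
    (g : ℝ → Bundle.ContMDiffRiemannianMetric (𝓡 n) ∞ (EuclideanSpace ℝ (Fin n))
      (fun x : M => TangentSpace (𝓡 n) x))
    (e : OpenPartialHomeomorph M (EuclideanSpace ℝ (Fin n))) (N : ℕ) (z : Fin (n + 1) → ℝ) :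
    Matrix (Fin (n + 1)) (Fin (n + 1)) ℝ :=
  Matrix.of fun a b =>
    Fin.cases
      (Fin.cases
        (scal (chartMetric (g (z 0)) e) (chartRegion e) (Fin.tail z) - (N : ℝ) / (2 * z 0))
        (fun _ => 0) b)
      (fun i => Fin.cases 0 (fun j => chartMetric (g (z 0)) e (Fin.tail z) i j) b) a

end Flow

/-! ### Two-forms on space-time -/

section TwoForms

variable {n : ℕ}

/-- The component `U^{ij}` in `U = ∑_{i,j} U^{ij} ∂_i ∧ ∂_j + ∑_i U^{0i} ∂_0 ∧ ∂_i`, where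
`X ∧ Y = (X ⊗ Y - Y ⊗ X)/2`; it is the tensor component. -/
def spacePart (U : Matrix (Fin (n + 1)) (Fin (n + 1)) ℝ) (i j : Fin n) : ℝ := U i.succ j.succ

/-- The component `U^{0i}` in `U = ∑_{i,j} U^{ij} ∂_i ∧ ∂_j + ∑_i U^{0i} ∂_0 ∧ ∂_i`, where
`X ∧ Y = (X ⊗ Y - Y ⊗ X)/2`; it is twice the tensor component of `U`. -/
def timePart (U : Matrix (Fin (n + 1)) (Fin (n + 1)) ℝ) (i : Fin n) : ℝ := 2 * U 0 i.succ

/-- The components of the tensor `∇_c U`. -/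
def nablaTensor (G : (Fin (n + 1) → ℝ) → Matrix (Fin (n + 1)) (Fin (n + 1)) ℝ)
    (S : Set (Fin (n + 1) → ℝ)) (U : (Fin (n + 1) → ℝ) → Matrix (Fin (n + 1)) (Fin (n + 1)) ℝ)
    (c : Fin (n + 1)) (z : Fin (n + 1) → ℝ) : Matrix (Fin (n + 1)) (Fin (n + 1)) ℝ :=
  Matrix.of fun a b => nablaContra G S U c a b z

/-- The components of the tensor `(∇_0 - Δ) U`. -/
def heatTensor (G : (Fin (n + 1) → ℝ) → Matrix (Fin (n + 1)) (Fin (n + 1)) ℝ)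
    (S : Set (Fin (n + 1) → ℝ)) (U : (Fin (n + 1) → ℝ) → Matrix (Fin (n + 1)) (Fin (n + 1)) ℝ)
    (z : Fin (n + 1) → ℝ) : Matrix (Fin (n + 1)) (Fin (n + 1)) ℝ :=
  Matrix.of fun a b => nablaContra G S U 0 a b z - laplacianContra G S U a b z

/-- `(∇_0 - Δ) f` for a function `f`. -/
def heatScalar (G : (Fin (n + 1) → ℝ) → Matrix (Fin (n + 1)) (Fin (n + 1)) ℝ)
    (S : Set (Fin (n + 1) → ℝ)) (f : (Fin (n + 1) → ℝ) → ℝ) (z : Fin (n + 1) → ℝ) : ℝ :=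
  pd S 0 f z - laplacian G S f z

/-- The extension conditions on the two-form `U` at the point `z`; `z 0` is the time `t`. -/
structure IsExtendedAt (G : (Fin (n + 1) → ℝ) → Matrix (Fin (n + 1)) (Fin (n + 1)) ℝ)
    (S : Set (Fin (n + 1) → ℝ)) (U : (Fin (n + 1) → ℝ) → Matrix (Fin (n + 1)) (Fin (n + 1)) ℝ)
    (z : Fin (n + 1) → ℝ) : Prop where
  /-- `∇_k U^{ij} = (1/4t) (δ^i_k U^{0j} - δ^j_k U^{0i})` -/
  nabla_space : ∀ k i j : Fin n, spacePart (nablaTensor G S U k.succ z) i j =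
    1 / (4 * z 0) * ((if i = k then 1 else 0) * timePart (U z) j
      - (if j = k then 1 else 0) * timePart (U z) i)
  /-- `∇_i U^{0j} = 0` -/
  nabla_time : ∀ i j : Fin n, timePart (nablaTensor G S U i.succ z) j = 0
  /-- `(∇_0 - Δ) U^{ij} = 0` -/
  heat_space : ∀ i j : Fin n, spacePart (heatTensor G S U z) i j = 0
  /-- `(∇_0 - Δ) U^{0i} = (1/2t) U^{0i}` -/
  heat_time : ∀ i : Fin n,
    timePart (heatTensor G S U z) i = 1 / (2 * z 0) * timePart (U z) i

end TwoForms

end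

end HyperbolicThermostat

open HyperbolicThermostat

/-!
The error bound comes from a smooth dependence on the parameter `ε = 1/N`, up to and including
`ε = 0`, and the main terms from an exact identity at `ε = 0`.

*The family.* The thermostat metric itself diverges as `ε → 0`, but its inverse, its Christoffel
symbols and its curvature tensor with lower indices (`thermoInv`, `thermoConn`, `thermoCurv`) are
smooth in `ε` near `0`; the only denominator is `ε S - 1/(2t)`, where `S` is the scalar curvature.
At `ε = 0` the inverse metric is `g^{ij}` on space and zero in the time direction. If `U` satisfies
the extension conditions at a point, then `(∇_0 - Δ) Rm(U, U)` at that point is a polynomial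
`heatForm` in these coefficients, their derivatives, and the values of `U` and `∂_t U`: the space
derivatives of `U` are prescribed and its second derivatives occur only in `(∇_0 - Δ) U`
(`heat_curvForm`, `heatScalar_eq_heatForm`). A function which is `C¹` on a compact convex set is
Lipschitz, so its value at `ε = 1/N` differs from that at `ε = 0` by at most `C/N`, uniformly for
bounded `U` and `∂_t U` (`exists_heatForm_sub_le`).

*The identity at `ε = 0`.* The symmetries of the curvature, the second Bianchi identity and the
parallelism of the inverse metric hold for `ε ≠ 0`, and hence for `ε = 0` by continuity
(`IsCurvature`, `IsFlow.isCurvature_family`). With `τ = 1/(2t)`, the limit curvature has the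
components `R_{ijkl}`, `R_{ij0k} = P_{ijk}` and `R_{0i0j} = M_{ij}` (`IsFlow.limit_space`,
`IsFlow.limit_mixed`, `IsFlow.limit_time`), and the curl of its Ricci tensor is its contraction with
`∂/∂t` up to terms with a factor `τ` (`IsFlow.limit_curlRic`). So the formula for `ΔRm` from the
Bianchi and Ricci identities expresses `(∇_0 - Δ) Rm` by quadratic curvature terms and terms with a
factor `τ` (`IsFlow.limit_heat`). After contraction with `U` the latter cancel against those from the
extension conditions (`IsFlow.limit_contract`), and the quadratic terms are the reaction terms
(`reactionForm_eq`).

The computations are carried out over a commutative algebra with commuting derivations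
`d a = ∂/∂x^a`; it is instantiated with the smooth functions on a region of space-time, and with
those on a region of pairs `(ε, y)`. In the latter `ε` is not a zero divisor (`param_regular`), so
that identities may be proved after multiplication by `ε`; this replaces the passage to the limit.
-/

set_option linter.unusedSectionVars false

namespace ThermostatHarnack

/-! ### Connections and the Ricci identity -/

section Connection

variable {𝒜 ι : Type*} [CommRing 𝒜] [Algebra ℝ 𝒜] [Fintype ι]
  (d : ι → Derivation ℝ 𝒜 𝒜) (Γ : ι → ι → ι → 𝒜)

/-- The curvature `R_{abc}^f` of the connection with Christoffel symbols `Γ a b c = Γ^a_{bc}`. -/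
def curvUp (a b c f : ι) : 𝒜 :=
  d b (Γ f a c) - d a (Γ f b c) + ∑ e, (Γ e a c * Γ f b e - Γ e b c * Γ f a e)

/-- `∇_c A_{ab}`, for the connection `Γ`. -/
def cov₂ (A : ι → ι → 𝒜) (c a b : ι) : 𝒜 :=
  d c (A a b) - ∑ e, (Γ e c a * A e b + Γ e c b * A a e)

/-- `∇_e B_{abc}`, for the connection `Γ`. -/
def cov₃ (B : ι → ι → ι → 𝒜) (e a b c : ι) : 𝒜 :=
  d e (B a b c) - ∑ m, (Γ m e a * B m b c + Γ m e b * B a m c + Γ m e c * B a b m)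

/-- `∇_e T_{abcf}`, for the connection `Γ`. -/
def cov₄ (T : ι → ι → ι → ι → 𝒜) (e a b c f : ι) : 𝒜 :=
  d e (T a b c f) - ∑ m, (Γ m e a * T m b c f + Γ m e b * T a m c f + Γ m e c * T a b m f
    + Γ m e f * T a b c m)

/-- The second covariant derivative `∇_h ∇_e T_{abcf}`. -/
def covTwice₄ (T : ι → ι → ι → ι → 𝒜) (h e a b c f : ι) : 𝒜 :=
  cov₄ d Γ (cov₄ d Γ T e) h a b c f - ∑ m, Γ m h e * cov₄ d Γ T m a b c f

/-! A covariant derivative of a tensor is its entrywise derivative minus one operator `slotᵢ` for each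
slot. Operators on different slots commute, which reduces the Ricci identity to each slot. -/

/-- Contraction of the first of four slots with the endomorphism `A`. -/
def slot₁ (A : Matrix ι ι 𝒜) (T : ι → ι → ι → ι → 𝒜) : ι → ι → ι → ι → 𝒜 :=
  fun a b c f => ∑ m, A m a * T m b c f
/-- Contraction of the second of four slots with the endomorphism `A`. -/
def slot₂ (A : Matrix ι ι 𝒜) (T : ι → ι → ι → ι → 𝒜) : ι → ι → ι → ι → 𝒜 :=
  fun a b c f => ∑ m, A m b * T a m c f
/-- Contraction of the third of four slots with the endomorphism `A`. -/
def slot₃ (A : Matrix ι ι 𝒜) (T : ι → ι → ι → ι → 𝒜) : ι → ι → ι → ι → 𝒜 :=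
  fun a b c f => ∑ m, A m c * T a b m f
/-- Contraction of the fourth of four slots with the endomorphism `A`. -/
def slot₄ (A : Matrix ι ι 𝒜) (T : ι → ι → ι → ι → 𝒜) : ι → ι → ι → ι → 𝒜 :=
  fun a b c f => ∑ m, A m f * T a b c m

/-- The connection form `Γ_b`, the endomorphism with entries `(Γ_b)^f_c = Γ^f_{bc}`. -/
def conn (b : ι) : Matrix ι ι 𝒜 := Matrix.of fun f c => Γ f b c

variable {d Γ}

theorem slot₂_slot₁ (A B : Matrix ι ι 𝒜) (T) : slot₂ A (slot₁ B T) = slot₁ B (slot₂ A T) := by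
  funext a b c f
  simp only [slot₁, slot₂, Finset.mul_sum]
  rw [Finset.sum_comm]
  exact Finset.sum_congr rfl fun _ _ => Finset.sum_congr rfl fun _ _ => by ring

theorem slot₃_slot₁ (A B : Matrix ι ι 𝒜) (T) : slot₃ A (slot₁ B T) = slot₁ B (slot₃ A T) := by
  funext a b c f
  simp only [slot₁, slot₃, Finset.mul_sum]
  rw [Finset.sum_comm]
  exact Finset.sum_congr rfl fun _ _ => Finset.sum_congr rfl fun _ _ => by ring

theorem slot₄_slot₁ (A B : Matrix ι ι 𝒜) (T) : slot₄ A (slot₁ B T) = slot₁ B (slot₄ A T) := by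
  funext a b c f
  simp only [slot₁, slot₄, Finset.mul_sum]
  rw [Finset.sum_comm]
  exact Finset.sum_congr rfl fun _ _ => Finset.sum_congr rfl fun _ _ => by ring

theorem slot₃_slot₂ (A B : Matrix ι ι 𝒜) (T) : slot₃ A (slot₂ B T) = slot₂ B (slot₃ A T) := by
  funext a b c f
  simp only [slot₂, slot₃, Finset.mul_sum]
  rw [Finset.sum_comm]
  exact Finset.sum_congr rfl fun _ _ => Finset.sum_congr rfl fun _ _ => by ring

theorem slot₄_slot₂ (A B : Matrix ι ι 𝒜) (T) : slot₄ A (slot₂ B T) = slot₂ B (slot₄ A T) := by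
  funext a b c f
  simp only [slot₂, slot₄, Finset.mul_sum]
  rw [Finset.sum_comm]
  exact Finset.sum_congr rfl fun _ _ => Finset.sum_congr rfl fun _ _ => by ring

theorem slot₄_slot₃ (A B : Matrix ι ι 𝒜) (T) : slot₄ A (slot₃ B T) = slot₃ B (slot₄ A T) := by
  funext a b c f
  simp only [slot₃, slot₄, Finset.mul_sum]
  rw [Finset.sum_comm]
  exact Finset.sum_congr rfl fun _ _ => Finset.sum_congr rfl fun _ _ => by ring

theorem slot₁_slot₁ (A B : Matrix ι ι 𝒜) (T) : slot₁ A (slot₁ B T) = slot₁ (B * A) T := by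
  funext a b c f
  simp only [slot₁, Matrix.mul_apply, Finset.mul_sum, Finset.sum_mul]
  rw [Finset.sum_comm]
  exact Finset.sum_congr rfl fun _ _ => Finset.sum_congr rfl fun _ _ => by ring

theorem slot₂_slot₂ (A B : Matrix ι ι 𝒜) (T) : slot₂ A (slot₂ B T) = slot₂ (B * A) T := by
  funext a b c f
  simp only [slot₂, Matrix.mul_apply, Finset.mul_sum, Finset.sum_mul]
  rw [Finset.sum_comm]
  exact Finset.sum_congr rfl fun _ _ => Finset.sum_congr rfl fun _ _ => by ring

theorem slot₃_slot₃ (A B : Matrix ι ι 𝒜) (T) : slot₃ A (slot₃ B T) = slot₃ (B * A) T := by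
  funext a b c f
  simp only [slot₃, Matrix.mul_apply, Finset.mul_sum, Finset.sum_mul]
  rw [Finset.sum_comm]
  exact Finset.sum_congr rfl fun _ _ => Finset.sum_congr rfl fun _ _ => by ring

theorem slot₄_slot₄ (A B : Matrix ι ι 𝒜) (T) : slot₄ A (slot₄ B T) = slot₄ (B * A) T := by
  funext a b c f
  simp only [slot₄, Matrix.mul_apply, Finset.mul_sum, Finset.sum_mul]
  rw [Finset.sum_comm]
  exact Finset.sum_congr rfl fun _ _ => Finset.sum_congr rfl fun _ _ => by ring

/-- Entrywise derivative of a tensor with four slots. -/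
def deriv₄ (D : Derivation ℝ 𝒜 𝒜) (T : ι → ι → ι → ι → 𝒜) : ι → ι → ι → ι → 𝒜 :=
  fun a b c f => D (T a b c f)

theorem deriv₄_slot₁ (D : Derivation ℝ 𝒜 𝒜) (A : Matrix ι ι 𝒜) (T) :
    deriv₄ D (slot₁ A T) = slot₁ (A.map D) T + slot₁ A (deriv₄ D T) := by
  funext a b c f
  simp only [deriv₄, slot₁, map_sum, Derivation.leibniz, smul_eq_mul, Pi.add_apply,
    ← Finset.sum_add_distrib, Matrix.map_apply]
  exact Finset.sum_congr rfl fun _ _ => by ring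

theorem deriv₄_slot₂ (D : Derivation ℝ 𝒜 𝒜) (A : Matrix ι ι 𝒜) (T) :
    deriv₄ D (slot₂ A T) = slot₂ (A.map D) T + slot₂ A (deriv₄ D T) := by
  funext a b c f
  simp only [deriv₄, slot₂, map_sum, Derivation.leibniz, smul_eq_mul, Pi.add_apply,
    ← Finset.sum_add_distrib, Matrix.map_apply]
  exact Finset.sum_congr rfl fun _ _ => by ring

theorem deriv₄_slot₃ (D : Derivation ℝ 𝒜 𝒜) (A : Matrix ι ι 𝒜) (T) :
    deriv₄ D (slot₃ A T) = slot₃ (A.map D) T + slot₃ A (deriv₄ D T) := by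
  funext a b c f
  simp only [deriv₄, slot₃, map_sum, Derivation.leibniz, smul_eq_mul, Pi.add_apply,
    ← Finset.sum_add_distrib, Matrix.map_apply]
  exact Finset.sum_congr rfl fun _ _ => by ring

theorem deriv₄_slot₄ (D : Derivation ℝ 𝒜 𝒜) (A : Matrix ι ι 𝒜) (T) :
    deriv₄ D (slot₄ A T) = slot₄ (A.map D) T + slot₄ A (deriv₄ D T) := by
  funext a b c f
  simp only [deriv₄, slot₄, map_sum, Derivation.leibniz, smul_eq_mul, Pi.add_apply,
    ← Finset.sum_add_distrib, Matrix.map_apply]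
  exact Finset.sum_congr rfl fun _ _ => by ring

theorem slot₁_sub (A : Matrix ι ι 𝒜) (T T') : slot₁ A (T - T') = slot₁ A T - slot₁ A T' := by
  funext a b c f; simp [slot₁, mul_sub]
theorem slot₂_sub (A : Matrix ι ι 𝒜) (T T') : slot₂ A (T - T') = slot₂ A T - slot₂ A T' := by
  funext a b c f; simp [slot₂, mul_sub]
theorem slot₃_sub (A : Matrix ι ι 𝒜) (T T') : slot₃ A (T - T') = slot₃ A T - slot₃ A T' := by
  funext a b c f; simp [slot₃, mul_sub]
theorem slot₄_sub (A : Matrix ι ι 𝒜) (T T') : slot₄ A (T - T') = slot₄ A T - slot₄ A T' := by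
  funext a b c f; simp [slot₄, mul_sub]

theorem deriv₄_sub (D : Derivation ℝ 𝒜 𝒜) (T T' : ι → ι → ι → ι → 𝒜) :
    deriv₄ D (T - T') = deriv₄ D T - deriv₄ D T' := by
  funext a b c f; simp [deriv₄]

theorem cov₄_eq_slots (T : ι → ι → ι → ι → 𝒜) (e : ι) :
    cov₄ d Γ T e = deriv₄ (d e) T - slot₁ (conn Γ e) T - slot₂ (conn Γ e) T - slot₃ (conn Γ e) T
      - slot₄ (conn Γ e) T := by
  funext a b c f
  simp only [cov₄, deriv₄, slot₁, slot₂, slot₃, slot₄, conn, Matrix.of_apply, Pi.sub_apply,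
    Finset.sum_add_distrib]
  ring

theorem curvUp_eq_conn (a b c f : ι) :
    curvUp d Γ a b c f = ((conn Γ a).map (d b) - (conn Γ b).map (d a)
      + (conn Γ b * conn Γ a - conn Γ a * conn Γ b)) f c := by
  simp only [curvUp, conn, Matrix.add_apply, Matrix.sub_apply, Matrix.map_apply, Matrix.of_apply,
    Matrix.mul_apply, Finset.sum_sub_distrib]
  congr 2 <;> exact Finset.sum_congr rfl fun _ _ => by ring

/-- The Ricci identity for a tensor with four lower indices. -/
theorem covTwice₄_comm (hd : ∀ a b f, d a (d b f) = d b (d a f))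
    (hΓ : ∀ a b c, Γ a b c = Γ a c b) (T : ι → ι → ι → ι → 𝒜) (h e a b c f : ι) :
    covTwice₄ d Γ T h e a b c f - covTwice₄ d Γ T e h a b c f =
      ∑ m, (curvUp d Γ h e a m * T m b c f + curvUp d Γ h e b m * T a m c f
        + curvUp d Γ h e c m * T a b m f + curvUp d Γ h e f m * T a b c m) := by
  set F : Matrix ι ι 𝒜 := (conn Γ h).map (d e) - (conn Γ e).map (d h)
      + (conn Γ e * conn Γ h - conn Γ h * conn Γ e) with hF
  have key : cov₄ d Γ (cov₄ d Γ T e) h - cov₄ d Γ (cov₄ d Γ T h) e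
      = slot₁ F T + slot₂ F T + slot₃ F T + slot₄ F T := by
    have hdd : deriv₄ (d h) (deriv₄ (d e) T) = deriv₄ (d e) (deriv₄ (d h) T) := by
      funext a b c f; exact hd _ _ _
    have e1 : slot₁ F T = slot₁ ((conn Γ h).map (d e)) T - slot₁ ((conn Γ e).map (d h)) T
        + (slot₁ (conn Γ e * conn Γ h) T - slot₁ (conn Γ h * conn Γ e) T) := by
      funext a b c f
      simp only [slot₁, hF, Pi.add_apply, Pi.sub_apply, Matrix.add_apply, Matrix.sub_apply,
        add_mul, sub_mul, Finset.sum_add_distrib, Finset.sum_sub_distrib]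
    have e2 : slot₂ F T = slot₂ ((conn Γ h).map (d e)) T - slot₂ ((conn Γ e).map (d h)) T
        + (slot₂ (conn Γ e * conn Γ h) T - slot₂ (conn Γ h * conn Γ e) T) := by
      funext a b c f
      simp only [slot₂, hF, Pi.add_apply, Pi.sub_apply, Matrix.add_apply, Matrix.sub_apply,
        add_mul, sub_mul, Finset.sum_add_distrib, Finset.sum_sub_distrib]
    have e3 : slot₃ F T = slot₃ ((conn Γ h).map (d e)) T - slot₃ ((conn Γ e).map (d h)) T
        + (slot₃ (conn Γ e * conn Γ h) T - slot₃ (conn Γ h * conn Γ e) T) := by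
      funext a b c f
      simp only [slot₃, hF, Pi.add_apply, Pi.sub_apply, Matrix.add_apply, Matrix.sub_apply,
        add_mul, sub_mul, Finset.sum_add_distrib, Finset.sum_sub_distrib]
    have e4 : slot₄ F T = slot₄ ((conn Γ h).map (d e)) T - slot₄ ((conn Γ e).map (d h)) T
        + (slot₄ (conn Γ e * conn Γ h) T - slot₄ (conn Γ h * conn Γ e) T) := by
      funext a b c f
      simp only [slot₄, hF, Pi.add_apply, Pi.sub_apply, Matrix.add_apply, Matrix.sub_apply,
        add_mul, sub_mul, Finset.sum_add_distrib, Finset.sum_sub_distrib]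
    rw [e1, e2, e3, e4]
    simp only [cov₄_eq_slots, deriv₄_sub, deriv₄_slot₁, deriv₄_slot₂, deriv₄_slot₃, deriv₄_slot₄,
      slot₁_sub, slot₂_sub, slot₃_sub, slot₄_sub, slot₂_slot₁, slot₃_slot₁, slot₄_slot₁,
      slot₃_slot₂, slot₄_slot₂, slot₄_slot₃, slot₁_slot₁, slot₂_slot₂, slot₃_slot₃, slot₄_slot₄,
      hdd]
    abel
  have key' := congrFun (congrFun (congrFun (congrFun key a) b) c) f
  simp only [Pi.add_apply, Pi.sub_apply] at key'
  simp only [covTwice₄, hΓ _ h e, curvUp_eq_conn, ← hF]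
  rw [sub_sub_sub_cancel_right, key']
  simp only [slot₁, slot₂, slot₃, slot₄, Finset.sum_add_distrib]

theorem map_mul_deriv (D : Derivation ℝ 𝒜 𝒜) (X Y : Matrix ι ι 𝒜) :
    (X * Y).map D = X.map D * Y + X * Y.map D := by
  ext i j
  simp only [Matrix.map_apply, Matrix.mul_apply, Matrix.add_apply, map_sum, Derivation.leibniz,
    smul_eq_mul, Finset.sum_add_distrib]
  rw [add_comm]
  congr 1
  exact Finset.sum_congr rfl fun _ _ => by ring

/-- The Ricci identity for a tensor with two lower indices. -/
theorem cov₃_cov₂_comm (hd : ∀ a b f, d a (d b f) = d b (d a f))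
    (hΓ : ∀ a b c, Γ a b c = Γ a c b) (A : ι → ι → 𝒜) (h e a b : ι) :
    cov₃ d Γ (cov₂ d Γ A) h e a b - cov₃ d Γ (cov₂ d Γ A) e h a b =
      ∑ m, (curvUp d Γ h e a m * A m b + curvUp d Γ h e b m * A a m) := by
  set F : Matrix ι ι 𝒜 := (conn Γ h).map (d e) - (conn Γ e).map (d h)
      + (conn Γ e * conn Γ h - conn Γ h * conn Γ e) with hF
  set X : Matrix ι ι 𝒜 := Matrix.of A with hX
  have hc : ∀ e (Y : ι → ι → 𝒜), (Matrix.of fun a b => cov₂ d Γ Y e a b) + 0 =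
      (Matrix.of Y).map (d e) - (conn Γ e).transpose * Matrix.of Y - Matrix.of Y * conn Γ e := by
    intro e Y
    ext a b
    simp only [cov₂, conn, Matrix.of_apply, Matrix.add_apply, Matrix.zero_apply, Matrix.sub_apply,
      Matrix.map_apply, Matrix.mul_apply, Matrix.transpose_apply, Finset.sum_add_distrib]
    simp only [mul_comm]
    ring
  have hs : ∀ (D : Derivation ℝ 𝒜 𝒜) (X Y : Matrix ι ι 𝒜), (X - Y).map D = X.map D - Y.map D :=
    fun D X Y => by ext i j; simp
  have ht : ∀ (D : Derivation ℝ 𝒜 𝒜) (X : Matrix ι ι 𝒜),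
      X.transpose.map D = (X.map D).transpose := fun D X => by ext i j; simp
  have hcomm : (X.map (d e)).map (d h) = (X.map (d h)).map (d e) := by
    ext i j; simp [hd h e]
  have key := congrArg₂ (· - ·) (hc h (cov₂ d Γ A e)) (hc e (cov₂ d Γ A h))
  have h1 := hc e A
  have h2 := hc h A
  simp only [add_zero] at key h1 h2
  have h3 : ∀ e, (Matrix.of (cov₂ d Γ A e)) = (Matrix.of fun a b => cov₂ d Γ A e a b) :=
    fun e => rfl
  rw [h3 e, h3 h, h1, h2, ← hX] at key
  have key2 : (Matrix.of fun a b => cov₂ d Γ (cov₂ d Γ A e) h a b)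
      - (Matrix.of fun a b => cov₂ d Γ (cov₂ d Γ A h) e a b) = F.transpose * X + X * F := by
    rw [key]
    simp only [hF, hs, map_mul_deriv, ht, hcomm, Matrix.transpose_add, Matrix.transpose_sub,
      Matrix.transpose_mul]
    noncomm_ring
  have key3 := congrFun (congrFun key2 a) b
  simp only [Matrix.sub_apply, Matrix.of_apply, Matrix.add_apply, Matrix.mul_apply,
    Matrix.transpose_apply, hX] at key3
  have h4 : ∀ h e, cov₃ d Γ (cov₂ d Γ A) h e a b
      = cov₂ d Γ (cov₂ d Γ A e) h a b - ∑ m, Γ m h e * cov₂ d Γ A m a b := by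
    intro h e
    simp only [cov₃, cov₂, Finset.sum_add_distrib]
    ring
  rw [h4, h4]
  simp only [hΓ _ h e, curvUp_eq_conn, ← hF]
  rw [sub_sub_sub_cancel_right, key3, Finset.sum_add_distrib]
  congr 1
  exact Finset.sum_congr rfl fun _ _ => mul_comm _ _

/-- The second Bianchi identity for the curvature operator of a torsion-free connection. -/
theorem bianchi_conn (hd : ∀ a b f, d a (d b f) = d b (d a f))
    (F : ι → ι → Matrix ι ι 𝒜)
    (hF : ∀ a b, F a b = (conn Γ a).map (d b) - (conn Γ b).map (d a)
      + (conn Γ b * conn Γ a - conn Γ a * conn Γ b)) (e a b : ι) :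
    ((F a b).map (d e) + conn Γ e * F a b - F a b * conn Γ e)
    + ((F b e).map (d a) + conn Γ a * F b e - F b e * conn Γ a)
    + ((F e a).map (d b) + conn Γ b * F e a - F e a * conn Γ b) = 0 := by
  have ha : ∀ (D : Derivation ℝ 𝒜 𝒜) (X Y : Matrix ι ι 𝒜), (X + Y).map D = X.map D + Y.map D :=
    fun D X Y => by ext i j; simp
  have hs : ∀ (D : Derivation ℝ 𝒜 𝒜) (X Y : Matrix ι ι 𝒜), (X - Y).map D = X.map D - Y.map D :=
    fun D X Y => by ext i j; simp
  have hc : ∀ a b (X : Matrix ι ι 𝒜), (X.map (d a)).map (d b) = (X.map (d b)).map (d a) :=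
    fun a b X => by ext i j; simp [hd a b]
  simp only [hF, map_mul_deriv, ha, hs, hc e a, hc b e, hc b a]
  noncomm_ring

end Connection

/-! ### Curvature tensors -/

section Curvature

variable {𝒜 ι : Type*} [CommRing 𝒜] [Algebra ℝ 𝒜] [Fintype ι] [DecidableEq ι]
  (d : ι → Derivation ℝ 𝒜 𝒜) (Γ : ι → ι → ι → 𝒜)

/-- `R` is a curvature tensor with lower indices for the torsion-free connection `Γ`, which
preserves the (possibly degenerate) contravariant symmetric tensor `H`. -/
structure IsCurvature (H : ι → ι → 𝒜) (R : ι → ι → ι → ι → 𝒜) : Prop where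
  comm : ∀ a b f, d a (d b f) = d b (d a f)
  torsion : ∀ a b c, Γ a b c = Γ a c b
  symm : ∀ a b, H a b = H b a
  parallel : ∀ e a b, d e (H a b) = -∑ m, (Γ a e m * H m b + Γ b e m * H a m)
  raise : ∀ a b c f, curvUp d Γ a b c f = ∑ m, H f m * R a b c m
  anti₁ : ∀ a b c f, R a b c f = -R b a c f
  anti₂ : ∀ a b c f, R a b c f = -R a b f c
  pair : ∀ a b c f, R a b c f = R c f a b
  cyclic : ∀ a b c f, R a b c f + R b c a f + R c a b f = 0
  bianchi : ∀ e a b c f, cov₄ d Γ R e a b c f + cov₄ d Γ R a b e c f + cov₄ d Γ R b e a c f = 0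

theorem eq_zero_of_two_mul {x : 𝒜} (h : 2 * x = 0) : x = 0 := by
  have h1 : algebraMap ℝ 𝒜 (1 / 2) * 2 = 1 := by
    rw [show (2 : 𝒜) = algebraMap ℝ 𝒜 2 from (map_ofNat _ 2).symm, ← map_mul]; norm_num
  calc x = algebraMap ℝ 𝒜 (1 / 2) * (2 * x) := by rw [← mul_assoc, h1, one_mul]
    _ = 0 := by rw [h, mul_zero]

variable {d Γ}

theorem curvUp_swap (a b c f : ι) : curvUp d Γ a b c f = -curvUp d Γ b a c f := by
  simp only [curvUp, Finset.sum_sub_distrib]; ring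

theorem curvUp_cyclic (hΓ : ∀ a b c, Γ a b c = Γ a c b) (a b c f : ι) :
    curvUp d Γ a b c f + curvUp d Γ b c a f + curvUp d Γ c a b f = 0 := by
  simp only [curvUp, Finset.sum_sub_distrib, hΓ _ b a, hΓ _ c a, hΓ _ c b]
  ring

/-- The curvature operator of a connection preserving the symmetric tensor `G` is antisymmetric
with respect to `G`. -/
theorem lower_curvUp_anti (hd : ∀ a b f, d a (d b f) = d b (d a f)) {G : ι → ι → 𝒜}
    (hG : ∀ a b, G a b = G b a)
    (hΓG : ∀ e a b, d e (G a b) = ∑ m, (Γ m e a * G m b + Γ m e b * G a m)) (a b c f : ι) :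
    ∑ m, G f m * curvUp d Γ a b c m = -∑ m, G c m * curvUp d Γ a b f m := by
  set GM : Matrix ι ι 𝒜 := Matrix.of G with hGM
  have mΓG : ∀ e, GM.map (d e) = (conn Γ e).transpose * GM + GM * conn Γ e := by
    intro e
    ext a b
    simp only [hGM, conn, Matrix.map_apply, Matrix.of_apply, hΓG, Matrix.add_apply,
      Matrix.mul_apply, Matrix.transpose_apply, Finset.sum_add_distrib]
    congr 1
    exact Finset.sum_congr rfl fun _ _ => mul_comm _ _
  have ha : ∀ (D : Derivation ℝ 𝒜 𝒜) (X Y : Matrix ι ι 𝒜), (X + Y).map D = X.map D + Y.map D :=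
    fun D X Y => by ext i j; simp
  have ht : ∀ (D : Derivation ℝ 𝒜 𝒜) (X : Matrix ι ι 𝒜),
      X.transpose.map D = (X.map D).transpose := fun D X => by ext i j; simp
  set F : Matrix ι ι 𝒜 := (conn Γ a).map (d b) - (conn Γ b).map (d a)
      + (conn Γ b * conn Γ a - conn Γ a * conn Γ b) with hF
  have h1 : F.transpose * GM + GM * F = 0 := by
    have h2 : (GM.map (d a)).map (d b) = (GM.map (d b)).map (d a) := by
      ext i j; simp [hd a b]
    simp only [mΓG, ha, map_mul_deriv, ht] at h2
    rw [← sub_eq_zero] at h2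
    rw [← h2]
    simp only [hF, Matrix.transpose_add, Matrix.transpose_sub, Matrix.transpose_mul]
    noncomm_ring
  have h3 : (GM * F).transpose = F.transpose * GM := by
    rw [Matrix.transpose_mul]
    congr 1
    ext i j
    simp [hGM, hG i j]
  rw [← h3] at h1
  have h4 := congrFun (congrFun h1 f) c
  simp only [Matrix.add_apply, Matrix.transpose_apply, Matrix.mul_apply, Matrix.zero_apply, hGM,
    Matrix.of_apply] at h4
  simp only [curvUp_eq_conn, ← hF]
  linear_combination h4

/-- A symmetric connection given by the Christoffel formula of `G` preserves `G`. -/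
theorem parallel_of_christoffel {G : ι → ι → 𝒜} (hG : ∀ a b, G a b = G b a)
    (hlow : ∀ a b c, 2 * ∑ m, G a m * Γ m b c = d b (G c a) + d c (G b a) - d a (G b c))
    (e a b : ι) : d e (G a b) = ∑ m, (Γ m e a * G m b + Γ m e b * G a m) := by
  have h1 : ∑ m, (Γ m e a * G m b + Γ m e b * G a m)
      = ∑ m, G b m * Γ m e a + ∑ m, G a m * Γ m e b := by
    rw [← Finset.sum_add_distrib]
    exact Finset.sum_congr rfl fun m _ => by rw [hG b m]; ring
  have h2 : 2 * (d e (G a b) - ∑ m, (Γ m e a * G m b + Γ m e b * G a m)) = 0 := by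
    rw [h1]
    have k1 := hlow b e a
    have k2 := hlow a e b
    linear_combination -k1 - k2 + congrArg (d e) (hG a b)
  exact sub_eq_zero.1 (eq_zero_of_two_mul h2)

/-- The Levi-Civita connection of a metric has a curvature tensor. Here `H` is the inverse of the
metric and `G` is `ε` times the metric, for a constant `ε` which is not a zero divisor: this covers
families in which `G` and `H` extend to `ε = 0` but the metric does not. The identities are proved
after multiplication by `ε`. -/
theorem IsCurvature.of_metric (hd : ∀ a b f, d a (d b f) = d b (d a f))
    (hΓ : ∀ a b c, Γ a b c = Γ a c b) {ε : 𝒜} (hε : ∀ x, ε * x = 0 → x = 0)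
    (hdε : ∀ a, d a ε = 0) {G H : ι → ι → 𝒜} (hG : ∀ a b, G a b = G b a)
    (hH : ∀ a b, H a b = H b a)
    (hGH : ∀ a b, ∑ m, G a m * H m b = if a = b then ε else 0)
    (hΓG : ∀ e a b, d e (G a b) = ∑ m, (Γ m e a * G m b + Γ m e b * G a m))
    {R : ι → ι → ι → ι → 𝒜} (hR : ∀ a b c f, ε * R a b c f = ∑ m, G f m * curvUp d Γ a b c m) :
    IsCurvature d Γ H R := by
  have cancel : ∀ x y : 𝒜, ε * x = ε * y → x = y := fun x y h =>
    sub_eq_zero.1 (hε _ (by rw [mul_sub, h, sub_self]))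
  set GM : Matrix ι ι 𝒜 := Matrix.of G with hGM
  set HM : Matrix ι ι 𝒜 := Matrix.of H with hHM
  have mGH : GM * HM = ε • (1 : Matrix ι ι 𝒜) := by
    ext a b
    simp [hGM, hHM, Matrix.mul_apply, hGH, Matrix.one_apply]
  have mHG : HM * GM = ε • (1 : Matrix ι ι 𝒜) := by
    ext a b
    have : ∑ m, H a m * G m b = ∑ m, G b m * H m a :=
      Finset.sum_congr rfl fun m _ => by rw [hH a m, hG m b, mul_comm]
    simp [hGM, hHM, Matrix.mul_apply, this, hGH, Matrix.one_apply, eq_comm]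
  have mΓG : ∀ e, GM.map (d e) = (conn Γ e).transpose * GM + GM * conn Γ e := by
    intro e
    ext a b
    simp only [hGM, conn, Matrix.map_apply, Matrix.of_apply, hΓG, Matrix.add_apply,
      Matrix.mul_apply, Matrix.transpose_apply, Finset.sum_add_distrib]
    congr 1
    exact Finset.sum_congr rfl fun _ _ => mul_comm _ _
  set F : ι → ι → Matrix ι ι 𝒜 := fun a b => (conn Γ a).map (d b) - (conn Γ b).map (d a)
      + (conn Γ b * conn Γ a - conn Γ a * conn Γ b) with hF
  have hFc : ∀ a b c f, curvUp d Γ a b c f = F a b f c := fun a b c f => curvUp_eq_conn a b c f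
  set RM : ι → ι → Matrix ι ι 𝒜 := fun a b => Matrix.of fun f c => R a b c f with hRM
  have mR : ∀ a b, ε • RM a b = GM * F a b := by
    intro a b
    ext f c
    simp only [hRM, hGM, Matrix.smul_apply, Matrix.of_apply, smul_eq_mul, hR, Matrix.mul_apply, hFc]
  have anti₁ : ∀ a b c f, R a b c f = -R b a c f := by
    intro a b c f
    apply cancel
    rw [mul_neg, hR, hR, ← Finset.sum_neg_distrib]
    exact Finset.sum_congr rfl fun m _ => by rw [curvUp_swap, mul_neg]
  have anti₂ : ∀ a b c f, R a b c f = -R a b f c := by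
    intro a b c f
    apply cancel
    rw [mul_neg, hR, hR, lower_curvUp_anti hd hG hΓG]
  have cyclic : ∀ a b c f, R a b c f + R b c a f + R c a b f = 0 := by
    intro a b c f
    apply hε
    rw [mul_add, mul_add, hR, hR, hR, ← Finset.sum_add_distrib, ← Finset.sum_add_distrib]
    refine Finset.sum_eq_zero fun m _ => ?_
    rw [← mul_add, ← mul_add, curvUp_cyclic hΓ, mul_zero]
  refine ⟨hd, hΓ, hH, ?_, ?_, anti₁, anti₂, ?_, cyclic, ?_⟩
  · intro e a b
    have h1 : (GM * HM).map (d e) = 0 := by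
      rw [mGH]; ext i j
      by_cases hij : i = j <;> simp [hij, hdε]
    rw [map_mul_deriv, mΓG] at h1
    have h2 : ε • (HM.map (d e)) = ε • -(conn Γ e * HM + HM * (conn Γ e).transpose) := by
      have h3 : HM * (((conn Γ e).transpose * GM + GM * conn Γ e) * HM + GM * HM.map (d e))
          = 0 := by
        rw [h1, mul_zero]
      have h4 : HM * (((conn Γ e).transpose * GM + GM * conn Γ e) * HM + GM * HM.map (d e))
          = HM * (conn Γ e).transpose * (GM * HM) + (HM * GM) * (conn Γ e * HM)
            + (HM * GM) * HM.map (d e) := by noncomm_ring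
      rw [h4, mGH, mHG] at h3
      simp only [Matrix.mul_smul, Matrix.smul_mul, mul_one, one_mul] at h3
      rw [eq_comm, ← sub_eq_zero, ← neg_eq_zero, ← h3, smul_neg, smul_add]
      abel
    have h5 := congrFun (congrFun h2 a) b
    simp only [Matrix.smul_apply, Matrix.map_apply, smul_eq_mul, Matrix.neg_apply,
      Matrix.add_apply] at h5
    have h6 := cancel _ _ h5
    rw [hHM] at h6
    simp only [conn, Matrix.of_apply, Matrix.mul_apply, Matrix.transpose_apply] at h6
    rw [h6, ← Finset.sum_add_distrib]
    congr 1
    exact Finset.sum_congr rfl fun _ _ => by ring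
  · intro a b c f
    have h1 : ε • (HM * RM a b) = ε • F a b := by
      rw [← Matrix.mul_smul, mR, ← mul_assoc, mHG, Matrix.smul_mul, one_mul]
    have h2 := congrFun (congrFun h1 f) c
    simp only [Matrix.smul_apply, smul_eq_mul] at h2
    rw [hFc, ← cancel _ _ h2, Matrix.mul_apply]
    rfl
  · -- the pair symmetry is a combination of four cyclic sums
    intro a b c f
    have h : 2 * (R a b c f - R c f a b) = 0 := by
      linear_combination cyclic a b c f + cyclic b c f a - cyclic c f a b - cyclic f a b c
        - anti₁ c a b f - anti₂ b c f a - anti₂ c f b a - anti₁ f b c a + anti₂ b f c a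
        + anti₁ f a c b - anti₂ a f c b + anti₂ a c f b + anti₁ f a b c + anti₂ a b f c
    exact sub_eq_zero.1 (eq_zero_of_two_mul h)
  · -- lower an index in `bianchi_conn`; the Christoffel terms of the first two slots, summed in `hz`,
    -- cancel since `Γ` is symmetric
    intro e a b c f
    have hcov : ∀ e a b c f, ε * cov₄ d Γ R e a b c f =
        (GM * ((F a b).map (d e) + conn Γ e * F a b - F a b * conn Γ e)) f c
          - ε * ∑ m, (Γ m e a * R m b c f + Γ m e b * R a m c f) := by
      intro e a b c f
      have h1 : ε • (RM a b).map (d e) = (GM * F a b).map (d e) := by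
        rw [← mR]; ext i j; simp [hdε]
      rw [map_mul_deriv, mΓG] at h1
      have h2 : GM * ((F a b).map (d e) + conn Γ e * F a b - F a b * conn Γ e)
          = ε • ((RM a b).map (d e) - (conn Γ e).transpose * RM a b - RM a b * conn Γ e) := by
        rw [smul_sub, smul_sub, ← Matrix.mul_smul, ← Matrix.smul_mul, mR, h1]
        noncomm_ring
      rw [h2]
      simp only [cov₄, Matrix.smul_apply, Matrix.sub_apply, Matrix.map_apply, Matrix.mul_apply,
        Matrix.transpose_apply, conn, Matrix.of_apply, hRM, smul_eq_mul, Finset.sum_add_distrib]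
      simp only [mul_comm (R _ _ _ _)]
      ring
    apply hε
    have hb := congrArg (fun X => (GM * X) f c) (bianchi_conn hd F (fun _ _ => rfl) e a b)
    rw [Matrix.mul_add, Matrix.mul_add, Matrix.mul_zero, Matrix.add_apply, Matrix.add_apply,
      Matrix.zero_apply] at hb
    rw [mul_add, mul_add, hcov, hcov, hcov]
    have hz : ∑ m, (Γ m e a * R m b c f + Γ m e b * R a m c f)
        + ∑ m, (Γ m a b * R m e c f + Γ m a e * R b m c f)
        + ∑ m, (Γ m b e * R m a c f + Γ m b a * R e m c f) = 0 := by
      rw [← Finset.sum_add_distrib, ← Finset.sum_add_distrib]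
      refine Finset.sum_eq_zero fun m _ => ?_
      rw [hΓ m a e, hΓ m b e, hΓ m b a, anti₁ a m, anti₁ b m, anti₁ e m]
      ring
    linear_combination hb - ε * hz

end Curvature

/-! ### Ricci curvature and the contracted Bianchi identities -/

section Contractions

variable {𝒜 ι : Type*} [CommRing 𝒜] [Algebra ℝ 𝒜] [Fintype ι]
  (d : ι → Derivation ℝ 𝒜 𝒜) (Γ : ι → ι → ι → 𝒜) (H : ι → ι → 𝒜) (R : ι → ι → ι → ι → 𝒜)

/-- The Ricci tensor `R_{ab} = H^{kl} R_{akbl}`. -/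
def ric (a b : ι) : 𝒜 := ∑ k, ∑ l, H k l * R a k b l

/-- The scalar curvature `H^{kl} R_{kl}`. -/
def sca : 𝒜 := ∑ k, ∑ l, H k l * ric H R k l

/-- `P_{abc} = ∇_a R_{bc} - ∇_b R_{ac}`. -/
def curlRic (a b c : ι) : 𝒜 := cov₂ d Γ (ric H R) a b c - cov₂ d Γ (ric H R) b a c

/-- The commutator term `[∇_f, ∇_a] R_{becg}` of the Ricci identity. -/
def curvAct (f a b e c g : ι) : 𝒜 :=
  ∑ m, (curvUp d Γ f a b m * R m e c g + curvUp d Γ f a e m * R b m c g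
    + curvUp d Γ f a c m * R b e m g + curvUp d Γ f a g m * R b e c m)

variable {d Γ H R}

theorem cov₄_anti₁ {T : ι → ι → ι → ι → 𝒜} (h : ∀ a b c f, T a b c f = -T b a c f)
    (e a b c f : ι) : cov₄ d Γ T e a b c f = -cov₄ d Γ T e b a c f := by
  simp only [cov₄]
  rw [h a b c f, map_neg, neg_sub, sub_eq_add_neg, sub_eq_add_neg, add_comm _ (-(d e) _),
    add_right_inj, ← Finset.sum_neg_distrib]
  exact Finset.sum_congr rfl fun m _ => by
    linear_combination (-Γ m e a) * h m b c f - Γ m e b * h a m c f - Γ m e c * h a b m f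
      - Γ m e f * h a b c m

theorem cov₄_anti₂ {T : ι → ι → ι → ι → 𝒜} (h : ∀ a b c f, T a b c f = -T a b f c)
    (e a b c f : ι) : cov₄ d Γ T e a b c f = -cov₄ d Γ T e a b f c := by
  simp only [cov₄]
  rw [h a b c f, map_neg, neg_sub, sub_eq_add_neg, sub_eq_add_neg, add_comm _ (-(d e) _),
    add_right_inj, ← Finset.sum_neg_distrib]
  exact Finset.sum_congr rfl fun m _ => by
    linear_combination (-Γ m e a) * h m b c f - Γ m e b * h a m c f - Γ m e c * h a b m f
      - Γ m e f * h a b c m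

theorem cov₄_pair {T : ι → ι → ι → ι → 𝒜} (h : ∀ a b c f, T a b c f = T c f a b)
    (e a b c f : ι) : cov₄ d Γ T e a b c f = cov₄ d Γ T e c f a b := by
  simp only [cov₄]
  rw [h a b c f]
  congr 1
  exact Finset.sum_congr rfl fun m _ => by
    linear_combination (Γ m e a) * h m b c f + Γ m e b * h a m c f + Γ m e c * h a b m f
      + Γ m e f * h a b c m

theorem covTwice₄_anti₁ {T : ι → ι → ι → ι → 𝒜} (h : ∀ a b c f, T a b c f = -T b a c f)
    (p e a b c f : ι) : covTwice₄ d Γ T p e a b c f = -covTwice₄ d Γ T p e b a c f := by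
  simp only [covTwice₄]
  rw [cov₄_anti₁ (cov₄_anti₁ h e), neg_sub, sub_eq_add_neg, sub_eq_add_neg, add_comm,
    add_left_inj, ← Finset.sum_neg_distrib]
  exact Finset.sum_congr rfl fun m _ => by rw [cov₄_anti₁ h m a b]; ring

namespace IsCurvature

variable (hC : IsCurvature d Γ H R)
include hC

theorem ric_symm (a b : ι) : ric H R a b = ric H R b a := by
  simp only [ric]
  rw [Finset.sum_comm]
  exact Finset.sum_congr rfl fun _ _ => Finset.sum_congr rfl fun _ _ => by rw [hC.pair, hC.symm]

/-- Contraction with the parallel tensor `H` commutes with covariant differentiation. -/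
theorem deriv_trace (X : ι → ι → 𝒜) (e : ι) :
    d e (∑ k, ∑ l, H k l * X k l) = ∑ k, ∑ l, H k l * cov₂ d Γ X e k l := by
  have h1 : ∑ k, ∑ l, ∑ m, Γ k e m * H m l * X k l = ∑ k, ∑ l, ∑ m, H k l * (Γ m e k * X m l) := by
    calc _ = ∑ k, ∑ m, ∑ l, Γ k e m * H m l * X k l :=
          Finset.sum_congr rfl fun _ _ => Finset.sum_comm
      _ = ∑ m, ∑ k, ∑ l, Γ k e m * H m l * X k l := Finset.sum_comm
      _ = ∑ m, ∑ l, ∑ k, Γ k e m * H m l * X k l :=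
          Finset.sum_congr rfl fun _ _ => Finset.sum_comm
      _ = _ := Finset.sum_congr rfl fun _ _ => Finset.sum_congr rfl fun _ _ =>
          Finset.sum_congr rfl fun _ _ => by ring
  have h2 : ∑ k, ∑ l, ∑ m, Γ l e m * H k m * X k l = ∑ k, ∑ l, ∑ m, H k l * (Γ m e l * X k m) := by
    refine Finset.sum_congr rfl fun _ _ => ?_
    rw [Finset.sum_comm]
    exact Finset.sum_congr rfl fun _ _ => Finset.sum_congr rfl fun _ _ => by ring
  simp only [map_sum, Derivation.leibniz, smul_eq_mul, hC.parallel, cov₂, mul_sub, mul_neg,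
    Finset.mul_sum, Finset.sum_add_distrib, mul_add, Finset.sum_sub_distrib, ← h1, ← h2,
    Finset.sum_neg_distrib]
  simp only [mul_comm (X _ _)]
  ring

/-- Raising an index with `H` commutes with covariant differentiation. -/
theorem raise_deriv (X : ι → 𝒜) (k f : ι) :
    d k (∑ e, H f e * X e) + ∑ m, Γ f k m * ∑ e, H m e * X e
      = ∑ e, H f e * (d k (X e) - ∑ m, Γ m k e * X m) := by
  simp only [map_sum, Derivation.leibniz, smul_eq_mul, hC.parallel, mul_neg,
    Finset.mul_sum, Finset.sum_add_distrib, mul_add, mul_sub, Finset.sum_sub_distrib,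
    Finset.sum_neg_distrib]
  have h1 : ∑ m, ∑ e, Γ f k m * (H m e * X e) = ∑ e, ∑ m, X e * (Γ f k m * H m e) := by
    rw [Finset.sum_comm]
    exact Finset.sum_congr rfl fun _ _ => Finset.sum_congr rfl fun _ _ => by ring
  have h2 : ∑ e, ∑ m, H f e * (Γ m k e * X m) = ∑ e, ∑ m, X e * (Γ e k m * H f m) := by
    rw [Finset.sum_comm]
    exact Finset.sum_congr rfl fun _ _ => Finset.sum_congr rfl fun _ _ => by ring
  rw [h1, h2]
  ring

theorem cov₂_ric (e a b : ι) :
    cov₂ d Γ (ric H R) e a b = ∑ k, ∑ l, H k l * cov₄ d Γ R e a k b l := by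
  rw [cov₂]
  simp only [ric]
  rw [hC.deriv_trace (fun k l => R a k b l)]
  simp only [cov₂, cov₄, Finset.mul_sum, ← Finset.sum_add_distrib]
  have h1 : ∑ m, ∑ k, ∑ l, (Γ m e a * (H k l * R m k b l) + Γ m e b * (H k l * R a k m l))
      = ∑ k, ∑ l, ∑ m, H k l * (Γ m e a * R m k b l + Γ m e b * R a k m l) := by
    rw [Finset.sum_comm]
    refine Finset.sum_congr rfl fun _ _ => ?_
    rw [Finset.sum_comm]
    exact Finset.sum_congr rfl fun _ _ => Finset.sum_congr rfl fun _ _ => by ring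
  rw [h1, ← Finset.sum_sub_distrib]
  refine Finset.sum_congr rfl fun k _ => ?_
  rw [← Finset.sum_sub_distrib]
  refine Finset.sum_congr rfl fun l _ => ?_
  rw [← Finset.mul_sum, ← mul_sub, sub_sub, ← Finset.sum_add_distrib]
  congr 2
  exact Finset.sum_congr rfl fun _ _ => by ring

/-- The contracted second Bianchi identity `P_{abc} = -∇^f R_{abcf}`. -/
theorem curlRic_eq (a b c : ι) :
    curlRic d Γ H R a b c = -∑ e, ∑ f, H e f * cov₄ d Γ R e a b c f := by
  rw [curlRic, hC.cov₂_ric, hC.cov₂_ric, eq_neg_iff_add_eq_zero, ← Finset.sum_sub_distrib,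
    ← Finset.sum_add_distrib]
  refine Finset.sum_eq_zero fun e _ => ?_
  rw [← Finset.sum_sub_distrib, ← Finset.sum_add_distrib]
  refine Finset.sum_eq_zero fun f _ => ?_
  linear_combination H e f * hC.bianchi e a b c f
    - H e f * cov₄_anti₁ (d := d) (Γ := Γ) hC.anti₁ b e a c f

theorem curlRic_swap (a b c : ι) : curlRic d Γ H R a b c = -curlRic d Γ H R b a c := by
  simp only [curlRic]; ring

theorem cov₂_ric_symm (e a b : ι) : cov₂ d Γ (ric H R) e a b = cov₂ d Γ (ric H R) e b a := by
  simp only [cov₂]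
  rw [hC.ric_symm a b]
  congr 1
  exact Finset.sum_congr rfl fun m _ => by rw [hC.ric_symm m b, hC.ric_symm a m, add_comm]

theorem curlRic_cyclic (a b c : ι) :
    curlRic d Γ H R a b c + curlRic d Γ H R b c a + curlRic d Γ H R c a b = 0 := by
  simp only [curlRic]
  rw [hC.cov₂_ric_symm a c b, hC.cov₂_ric_symm b c a, hC.cov₂_ric_symm c b a]
  ring

theorem deriv_sca (e : ι) :
    d e (sca H R) = ∑ k, ∑ l, H k l * cov₂ d Γ (ric H R) e k l :=
  hC.deriv_trace _ e

theorem trace_curlRic (a : ι) : ∑ b, ∑ c, H b c * curlRic d Γ H R a b c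
    = ∑ e, ∑ f, H e f * cov₂ d Γ (ric H R) e a f := by
  simp only [hC.curlRic_eq, hC.cov₂_ric, Finset.mul_sum, mul_neg, ← Finset.sum_neg_distrib]
  calc _ = ∑ b, ∑ e, ∑ c, ∑ f, -(H b c * (H e f * cov₄ d Γ R e a b c f)) :=
        Finset.sum_congr rfl fun _ _ => Finset.sum_comm
    _ = ∑ e, ∑ b, ∑ c, ∑ f, -(H b c * (H e f * cov₄ d Γ R e a b c f)) := Finset.sum_comm
    _ = ∑ e, ∑ b, ∑ f, ∑ c, -(H b c * (H e f * cov₄ d Γ R e a b c f)) :=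
        Finset.sum_congr rfl fun _ _ => Finset.sum_congr rfl fun _ _ => Finset.sum_comm
    _ = ∑ e, ∑ f, ∑ b, ∑ c, -(H b c * (H e f * cov₄ d Γ R e a b c f)) :=
        Finset.sum_congr rfl fun _ _ => Finset.sum_comm
    _ = _ := Finset.sum_congr rfl fun _ _ => Finset.sum_congr rfl fun _ _ =>
        Finset.sum_congr rfl fun _ _ => Finset.sum_congr rfl fun _ _ => by
          rw [cov₄_anti₂ hC.anti₂]; ring

/-- The twice contracted second Bianchi identity `∇^e R_{ae} = ½ ∂_a S`. -/
theorem div_ric (a : ι) :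
    2 * ∑ e, ∑ f, H e f * cov₂ d Γ (ric H R) e a f = d a (sca H R) := by
  have h1 := hC.trace_curlRic a
  have h2 : ∑ b, ∑ c, H b c * curlRic d Γ H R a b c = d a (sca H R)
      - ∑ e, ∑ f, H e f * cov₂ d Γ (ric H R) e a f := by
    simp only [hC.deriv_sca, curlRic, mul_sub, Finset.sum_sub_distrib]
  linear_combination h2 - h1

/-- The divergence of `∇R` on its second slot. -/
theorem trace_covTwice₄ (a b c g : ι) :
    ∑ e, ∑ f, H e f * covTwice₄ d Γ R a f b e c g = -cov₃ d Γ (curlRic d Γ H R) a c g b := by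
  have hP : ∀ b c g, ∑ e, ∑ f, H e f * cov₄ d Γ R f b e c g = -curlRic d Γ H R c g b := by
    intro b c g
    rw [hC.curlRic_eq, neg_neg, Finset.sum_comm]
    exact Finset.sum_congr rfl fun e _ => Finset.sum_congr rfl fun f _ => by
      rw [cov₄_pair hC.pair, hC.symm]
  have h1 : -cov₃ d Γ (curlRic d Γ H R) a c g b =
      d a (-curlRic d Γ H R c g b) - ∑ m, (Γ m a b * -curlRic d Γ H R c g m
        + Γ m a c * -curlRic d Γ H R m g b + Γ m a g * -curlRic d Γ H R c m b) := by
    simp only [cov₃, map_neg, mul_neg, Finset.sum_add_distrib, Finset.sum_neg_distrib]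
    ring
  rw [h1]
  simp only [← hP, Finset.mul_sum, ← Finset.sum_add_distrib]
  rw [hC.deriv_trace (fun e f => cov₄ d Γ R f b e c g)]
  have h2 : ∑ m, ∑ e, ∑ f, (Γ m a b * (H e f * cov₄ d Γ R f m e c g)
        + Γ m a c * (H e f * cov₄ d Γ R f b e m g) + Γ m a g * (H e f * cov₄ d Γ R f b e c m))
      = ∑ e, ∑ f, ∑ m, H e f * (Γ m a b * cov₄ d Γ R f m e c g
        + Γ m a c * cov₄ d Γ R f b e m g + Γ m a g * cov₄ d Γ R f b e c m) := by
    rw [Finset.sum_comm]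
    refine Finset.sum_congr rfl fun _ _ => ?_
    rw [Finset.sum_comm]
    exact Finset.sum_congr rfl fun _ _ => Finset.sum_congr rfl fun _ _ => by ring
  rw [h2, ← Finset.sum_sub_distrib]
  refine Finset.sum_congr rfl fun e _ => ?_
  rw [← Finset.sum_sub_distrib]
  refine Finset.sum_congr rfl fun f _ => ?_
  rw [← Finset.mul_sum, ← mul_sub]
  congr 1
  rw [covTwice₄]
  conv_lhs => rw [cov₄]
  simp only [cov₂, Finset.sum_add_distrib]
  ring

/-- The derivative of the second Bianchi identity. -/
theorem bianchi_deriv (h e a b c f : ι) : covTwice₄ d Γ R h e a b c f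
    + covTwice₄ d Γ R h a b e c f + covTwice₄ d Γ R h b e a c f = 0 := by
  have h0 := congrArg (d h) (hC.bianchi e a b c f)
  rw [map_add, map_add, map_zero] at h0
  have hs : ∑ m, (Γ m h e * (cov₄ d Γ R m a b c f + cov₄ d Γ R a b m c f + cov₄ d Γ R b m a c f)
      + Γ m h a * (cov₄ d Γ R e m b c f + cov₄ d Γ R m b e c f + cov₄ d Γ R b e m c f)
      + Γ m h b * (cov₄ d Γ R e a m c f + cov₄ d Γ R a m e c f + cov₄ d Γ R m e a c f)
      + Γ m h c * (cov₄ d Γ R e a b m f + cov₄ d Γ R a b e m f + cov₄ d Γ R b e a m f)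
      + Γ m h f * (cov₄ d Γ R e a b c m + cov₄ d Γ R a b e c m + cov₄ d Γ R b e a c m)) = 0 :=
    Finset.sum_eq_zero fun m _ => by simp only [hC.bianchi, mul_zero, add_zero]
  simp only [covTwice₄]
  have hu : ∀ (T : ι → ι → ι → ι → 𝒜) (e a b c f : ι), cov₄ d Γ T e a b c f =
      d e (T a b c f) - ∑ m, (Γ m e a * T m b c f + Γ m e b * T a m c f + Γ m e c * T a b m f
        + Γ m e f * T a b c m) := fun _ _ _ _ _ _ => rfl
  rw [hu (cov₄ d Γ R e), hu (cov₄ d Γ R a), hu (cov₄ d Γ R b)]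
  simp only [mul_add, Finset.sum_add_distrib] at hs ⊢
  linear_combination h0 - hs

/-- The Laplacian of the curvature tensor, from the second Bianchi and the Ricci identities. -/
theorem laplacian_curvature (a b c g : ι) :
    ∑ e, ∑ f, H e f * covTwice₄ d Γ R f e a b c g =
      cov₃ d Γ (curlRic d Γ H R) a c g b - cov₃ d Γ (curlRic d Γ H R) b c g a
      - ∑ e, ∑ f, H e f * curvAct d Γ R f a b e c g
      + ∑ e, ∑ f, H e f * curvAct d Γ R f b a e c g := by
  have h1 := hC.trace_covTwice₄ a b c g
  have h2 := hC.trace_covTwice₄ b a c g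
  have key : ∀ e f, covTwice₄ d Γ R f e a b c g = -covTwice₄ d Γ R a f b e c g
      + covTwice₄ d Γ R b f a e c g - curvAct d Γ R f a b e c g + curvAct d Γ R f b a e c g := by
    intro e f
    have k1 := hC.bianchi_deriv f e a b c g
    have k2 := covTwice₄_comm hC.comm hC.torsion R f a b e c g
    have k3 := covTwice₄_comm hC.comm hC.torsion R f b a e c g
    have k4 := covTwice₄_anti₁ (d := d) (Γ := Γ) hC.anti₁ f b e a c g
    simp only [curvAct]
    linear_combination k1 - k2 + k3 - k4
  simp only [key, mul_add, mul_sub, mul_neg, Finset.sum_add_distrib, Finset.sum_sub_distrib,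
    Finset.sum_neg_distrib]
  linear_combination h2 - h1

/-- The divergence of `P` on its first slot. -/
theorem div_curlRic (i j : ι) :
    2 * ∑ k, ∑ l, H k l * cov₃ d Γ (curlRic d Γ H R) k l j i =
      2 * (∑ k, ∑ l, H k l * cov₃ d Γ (cov₂ d Γ (ric H R)) k l j i)
      - (d j (d i (sca H R)) - ∑ m, Γ m j i * d m (sca H R))
      - 2 * ∑ k, ∑ l, H k l * ∑ m, (curvUp d Γ k j l m * ric H R m i
          + curvUp d Γ k j i m * ric H R l m) := by
  have h1 : ∀ k l, cov₃ d Γ (curlRic d Γ H R) k l j i =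
      cov₃ d Γ (cov₂ d Γ (ric H R)) k l j i - cov₃ d Γ (cov₂ d Γ (ric H R)) j k l i
        - ∑ m, (curvUp d Γ k j l m * ric H R m i + curvUp d Γ k j i m * ric H R l m) := by
    intro k l
    rw [← cov₃_cov₂_comm hC.comm hC.torsion]
    simp only [cov₃, curlRic, map_sub, mul_sub, Finset.sum_add_distrib, Finset.sum_sub_distrib]
    ring
  have h2 : 2 * ∑ k, ∑ l, H k l * cov₃ d Γ (cov₂ d Γ (ric H R)) j k l i
      = d j (d i (sca H R)) - ∑ m, Γ m j i * d m (sca H R) := by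
    have h3 : ∀ i, d i (sca H R) = 2 * ∑ k, ∑ l, H k l * cov₂ d Γ (ric H R) k l i := by
      intro i
      rw [← hC.div_ric i]
      simp only [hC.cov₂_ric_symm _ i]
    have h4 : d j (d i (sca H R))
        = 2 * ∑ k, ∑ l, H k l * cov₂ d Γ (fun k l => cov₂ d Γ (ric H R) k l i) j k l := by
      rw [h3 i, ← hC.deriv_trace]
      simp [two_mul]
    have h5 : ∑ m, Γ m j i * d m (sca H R)
        = 2 * ∑ k, ∑ l, ∑ m, H k l * (Γ m j i * cov₂ d Γ (ric H R) k l m) := by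
      simp only [h3, Finset.mul_sum]
      rw [Finset.sum_comm]
      refine Finset.sum_congr rfl fun _ _ => ?_
      rw [Finset.sum_comm]
      exact Finset.sum_congr rfl fun _ _ => Finset.sum_congr rfl fun _ _ => by ring
    rw [h4, h5, ← mul_sub, ← Finset.sum_sub_distrib]
    congr 1
    refine Finset.sum_congr rfl fun k _ => ?_
    rw [← Finset.sum_sub_distrib]
    refine Finset.sum_congr rfl fun l _ => ?_
    rw [← Finset.mul_sum, ← mul_sub]
    congr 1
    rw [cov₃]
    conv_rhs => rw [cov₂]
    simp only [Finset.sum_add_distrib]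
    ring
  rw [← h2]
  simp only [h1, mul_sub, Finset.sum_sub_distrib]

end IsCurvature

end Contractions

/-! ### The thermostat metrics -/

section Thermostat

variable {𝒜 : Type*} [CommRing 𝒜] [Algebra ℝ 𝒜] {n : ℕ}

/-- The element `1/2`. -/
noncomputable def half (𝒜 : Type*) [CommRing 𝒜] [Algebra ℝ 𝒜] : 𝒜 := algebraMap ℝ 𝒜 (1 / 2)

theorem two_mul_half : 2 * half 𝒜 = 1 := by
  rw [half, show (2 : 𝒜) = algebraMap ℝ 𝒜 2 from (map_ofNat _ 2).symm, ← map_mul]; norm_num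

/-- The derivations in the space directions. -/
noncomputable def spatial (d : Fin (n + 1) → Derivation ℝ 𝒜 𝒜) (i : Fin n) :
    Derivation ℝ 𝒜 𝒜 := d i.succ

variable (d : Fin (n + 1) → Derivation ℝ 𝒜 𝒜) (γ γi : Fin n → Fin n → 𝒜)
  (Γ : Fin n → Fin n → Fin n → 𝒜) (R : Fin n → Fin n → Fin n → Fin n → 𝒜) (τ ε u : 𝒜)

/-- A Ricci flow in coordinates, over an algebra `𝒜` of functions on space-time with the coordinate
derivations `d`: the metric `γ`, its inverse `γi`, its Christoffel symbols `Γ`, its curvature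
`R`, and `τ = 1/(2t)`. -/
structure IsFlow : Prop where
  comm : ∀ a b f, d a (d b f) = d b (d a f)
  symm : ∀ i j, γ i j = γ j i
  symm_inv : ∀ i j, γi i j = γi j i
  inv : ∀ i j, ∑ m, γ i m * γi m j = if i = j then 1 else 0
  torsion : ∀ i j k, Γ i j k = Γ i k j
  christoffel : ∀ i j k, 2 * ∑ m, γ i m * Γ m j k
    = spatial d j (γ k i) + spatial d k (γ j i) - spatial d i (γ j k)
  curv : ∀ i j k l, R i j k l = ∑ m, γ l m * curvUp (spatial d) Γ i j k m
  flow : ∀ i j, d 0 (γ i j) = -2 * ric γi R i j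
  time : d 0 τ = -2 * τ ^ 2
  time_space : ∀ i, spatial d i τ = 0

/-- `ε` times the thermostat metric with parameter `N = 1/ε`; the index `0` is the time. -/
noncomputable def scaledMetric (a b : Fin (n + 1)) : 𝒜 :=
  Fin.cases (Fin.cases (ε * sca γi R - τ) (fun _ => 0) b)
    (fun i => Fin.cases 0 (fun j => ε * γ i j) b) a

/-- The inverse of the thermostat metric with parameter `N = 1/ε`; here `u = (ε S - τ)⁻¹`, where `S`
is the scalar curvature. It is defined at `ε = 0` too. -/
noncomputable def thermoInv (a b : Fin (n + 1)) : 𝒜 :=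
  Fin.cases (Fin.cases (ε * u) (fun _ => 0) b)
    (fun i => Fin.cases 0 (fun j => γi i j) b) a

/-- The Christoffel symbols of the thermostat metric, in a form which makes sense at `ε = 0`. -/
noncomputable def thermoConn (a b c : Fin (n + 1)) : 𝒜 :=
  Fin.cases
    (Fin.cases
      (Fin.cases (half 𝒜 * (ε * d 0 (sca γi R) + 2 * τ ^ 2) * u)
        (fun j => half 𝒜 * ε * spatial d j (sca γi R) * u) c)
      (fun i => Fin.cases (half 𝒜 * ε * spatial d i (sca γi R) * u)
        (fun j => ε * ric γi R i j * u) c) b)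
    (fun k => Fin.cases
      (Fin.cases (-(half 𝒜 * ∑ l, γi k l * spatial d l (sca γi R)))
        (fun j => -∑ l, γi k l * ric γi R l j) c)
      (fun i => Fin.cases (-∑ l, γi k l * ric γi R l i) (fun j => Γ k i j) c) b) a

/-- The curvature tensor of the thermostat metric, in a form which makes sense at `ε = 0`. Lowering
the time index involves `1/ε`, so components with a last index `0` are defined through the
antisymmetry in the last two indices. -/
noncomputable def thermoCurv (a b c f : Fin (n + 1)) : 𝒜 :=
  Fin.cases
    (Fin.cases 0
      (fun k => -∑ m : Fin n, γ k m * curvUp d (thermoConn d γi Γ R τ ε u) a b 0 m.succ) c)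
    (fun l => ∑ m : Fin n, γ l m * curvUp d (thermoConn d γi Γ R τ ε u) a b c m.succ) f

variable {d γ γi Γ R τ ε u}

theorem mul_inv_cancel_sum {γ γi : Fin n → Fin n → 𝒜}
    (inv : ∀ i j, ∑ m, γ i m * γi m j = if i = j then 1 else 0) (X : Fin n → 𝒜) (i : Fin n) :
    ∑ j, γ i j * ∑ k, γi j k * X k = X i := by
  simp only [Finset.mul_sum, ← mul_assoc]
  rw [Finset.sum_comm]
  simp only [← Finset.sum_mul, inv]
  simp

namespace IsFlow

variable (hF : IsFlow d γ γi Γ R τ)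
include hF

theorem isCurvature : IsCurvature (spatial d) Γ γi R :=
  IsCurvature.of_metric (ε := 1) (fun a b f => hF.comm _ _ _) hF.torsion (by simp)
    (fun a => by simp) hF.symm hF.symm_inv hF.inv
    (parallel_of_christoffel hF.symm hF.christoffel) (fun a b c f => by rw [one_mul, hF.curv]; rfl)

/-- The Christoffel formula. This is where the Ricci flow equation enters: the time derivative of the
space metric gives the components `Γ^k_{0j} = -R^k_j`. -/
theorem thermo_christoffel (hε : ∀ a, d a ε = 0) (hu : (ε * sca γi R - τ) * u = 1)
    (a b c : Fin (n + 1)) :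
    2 * ∑ m, scaledMetric γ γi R τ ε a m * thermoConn d γi Γ R τ ε u m b c =
      d b (scaledMetric γ γi R τ ε c a) + d c (scaledMetric γ γi R τ ε b a)
        - d a (scaledMetric γ γi R τ ε b c) := by
  have hs : ∀ i, d (Fin.succ i) = spatial d i := fun _ => rfl
  have hεs : ∀ i, spatial d i ε = 0 := fun i => hε i.succ
  have h2 := two_mul_half (𝒜 := 𝒜)
  have hsymm := hF.isCurvature.ric_symm
  rw [Fin.sum_univ_succ]
  cases a using Fin.cases with
  | zero =>
    cases b using Fin.cases with
    | zero =>
      cases c using Fin.cases with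
      | zero =>
        simp [scaledMetric, thermoConn, hε, hF.time]
        linear_combination (2 * half 𝒜 * (ε * d 0 (sca γi R) + 2 * τ ^ 2)) * hu
          + (ε * d 0 (sca γi R) + 2 * τ ^ 2) * h2
      | succ j =>
        simp [scaledMetric, thermoConn, hεs, hs, hF.time_space]
        linear_combination (2 * half 𝒜 * ε * spatial d j (sca γi R)) * hu
          + ε * spatial d j (sca γi R) * h2
    | succ i =>
      cases c using Fin.cases with
      | zero =>
        simp [scaledMetric, thermoConn, hεs, hs, hF.time_space]
        linear_combination (2 * half 𝒜 * ε * spatial d i (sca γi R)) * hu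
          + ε * spatial d i (sca γi R) * h2
      | succ j =>
        simp [scaledMetric, thermoConn, hε, hs, hF.flow]
        linear_combination (2 * ε * ric γi R i j) * hu
  | succ k =>
    have hX := mul_inv_cancel_sum hF.inv
    cases b using Fin.cases with
    | zero =>
      cases c using Fin.cases with
      | zero =>
        simp [scaledMetric, thermoConn, hεs, hs, hF.time_space]
        have := hX (fun l => spatial d l (sca γi R)) k
        simp only [mul_assoc, ← Finset.mul_sum, mul_left_comm _ (half 𝒜), this]
        linear_combination (ε * spatial d k (sca γi R)) * h2
      | succ j =>
        simp [scaledMetric, thermoConn, hε, hs, hF.flow]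
        simp only [mul_assoc, ← Finset.mul_sum, hX (fun l => ric γi R l j) k]
        rw [hsymm]; ring
    | succ i =>
      cases c using Fin.cases with
      | zero =>
        simp [scaledMetric, thermoConn, hε, hs, hF.flow]
        simp only [mul_assoc, ← Finset.mul_sum, hX (fun l => ric γi R l i) k]
        rw [hsymm]; ring
      | succ j =>
        simp [scaledMetric, thermoConn, hεs, hs]
        simp only [mul_assoc, ← Finset.mul_sum]
        linear_combination ε * hF.christoffel k i j

theorem thermoConn_symm (a b c : Fin (n + 1)) :
    thermoConn d γi Γ R τ ε u a b c = thermoConn d γi Γ R τ ε u a c b := by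
  cases a using Fin.cases <;> cases b using Fin.cases <;> cases c using Fin.cases <;>
    simp [thermoConn, hF.isCurvature.ric_symm, hF.torsion _ _]

theorem scaledMetric_symm (a b : Fin (n + 1)) :
    scaledMetric γ γi R τ ε a b = scaledMetric γ γi R τ ε b a := by
  cases a using Fin.cases <;> cases b using Fin.cases <;> simp [scaledMetric]
  rw [hF.symm]

theorem thermoInv_symm (a b : Fin (n + 1)) : thermoInv γi ε u a b = thermoInv γi ε u b a := by
  cases a using Fin.cases <;> cases b using Fin.cases <;> simp [thermoInv]
  rw [hF.symm_inv]

theorem scaledMetric_mul_inv (hu : (ε * sca γi R - τ) * u = 1) (a b : Fin (n + 1)) :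
    ∑ m, scaledMetric γ γi R τ ε a m * thermoInv γi ε u m b = if a = b then ε else 0 := by
  rw [Fin.sum_univ_succ]
  cases a using Fin.cases <;> cases b using Fin.cases
  · simp [scaledMetric, thermoInv]; linear_combination ε * hu
  · simp [scaledMetric, thermoInv, (Fin.succ_ne_zero _).symm]
  · simp [scaledMetric, thermoInv]
  · rename_i i j
    have := hF.inv i j
    simp [scaledMetric, thermoInv, mul_assoc, ← Finset.mul_sum, this]

theorem scaledMetric_curv (hε : ∀ a, d a ε = 0) (hu : (ε * sca γi R - τ) * u = 1)
    (a b c f : Fin (n + 1)) : ε * thermoCurv d γ γi Γ R τ ε u a b c f =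
      ∑ m, scaledMetric γ γi R τ ε f m * curvUp d (thermoConn d γi Γ R τ ε u) a b c m := by
  have hanti := lower_curvUp_anti hF.comm (hF.scaledMetric_symm (ε := ε)) (parallel_of_christoffel
    (hF.scaledMetric_symm (ε := ε)) (hF.thermo_christoffel hε hu))
  have hsucc : ∀ c (l : Fin n), ε * thermoCurv d γ γi Γ R τ ε u a b c l.succ =
      ∑ m, scaledMetric γ γi R τ ε l.succ m * curvUp d (thermoConn d γi Γ R τ ε u) a b c m := by
    intro c l
    rw [Fin.sum_univ_succ]
    simp [scaledMetric, thermoCurv, Finset.mul_sum, mul_assoc]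
  cases f using Fin.cases with
  | zero =>
    cases c using Fin.cases with
    | zero =>
      have h := hanti a b 0 0
      rw [show thermoCurv d γ γi Γ R τ ε u a b 0 0 = 0 from rfl, mul_zero, eq_comm]
      exact eq_zero_of_two_mul (by linear_combination h)
    | succ k =>
      rw [hanti, ← hsucc, ← mul_neg]
      rfl
  | succ l => exact hsucc c l

/-- The connection of the thermostat metrics has a curvature tensor. In an algebra of functions which
involve `ε` as a variable, `hreg` holds although `ε` has zeros. -/
theorem isCurvature_thermo (hε : ∀ a, d a ε = 0) (hreg : ∀ x : 𝒜, ε * x = 0 → x = 0)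
    (hu : (ε * sca γi R - τ) * u = 1) :
    IsCurvature d (thermoConn d γi Γ R τ ε u) (thermoInv γi ε u)
      (thermoCurv d γ γi Γ R τ ε u) :=
  IsCurvature.of_metric hF.comm hF.thermoConn_symm hreg hε hF.scaledMetric_symm
    hF.thermoInv_symm (hF.scaledMetric_mul_inv hu)
    (parallel_of_christoffel hF.scaledMetric_symm (hF.thermo_christoffel hε hu))
    (hF.scaledMetric_curv hε hu)

end IsFlow

end Thermostat

/-! ### The curvature tensor at `ε = 0` -/

section Limit

variable {𝒜 : Type*} [CommRing 𝒜] [Algebra ℝ 𝒜] {n : ℕ}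

/-- The components of the one-form `dt`. -/
def dtime (𝒜 : Type*) [CommRing 𝒜] (a : Fin (n + 1)) : 𝒜 := if a = 0 then 1 else 0

@[simp] theorem dtime_zero : dtime 𝒜 (0 : Fin (n + 1)) = 1 := if_pos rfl
@[simp] theorem dtime_succ (i : Fin n) : dtime 𝒜 i.succ = 0 := if_neg (Fin.succ_ne_zero i)

variable {d : Fin (n + 1) → Derivation ℝ 𝒜 𝒜} {γ γi : Fin n → Fin n → 𝒜}
  {Γ : Fin n → Fin n → Fin n → 𝒜} {R : Fin n → Fin n → Fin n → Fin n → 𝒜} {τ u : 𝒜}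

theorem thermoInv_zero (a : Fin (n + 1)) : thermoInv γi 0 u 0 a = 0 := by
  cases a using Fin.cases <;> simp [thermoInv]

theorem thermoInv_zero' (a : Fin (n + 1)) : thermoInv γi 0 u a 0 = 0 := by
  cases a using Fin.cases <;> simp [thermoInv]

theorem thermoInv_succ (i j : Fin n) : thermoInv γi 0 u i.succ j.succ = γi i j := rfl

theorem sum_thermoInv (X : Fin (n + 1) → 𝒜) (k : Fin n) :
    ∑ m, thermoInv γi 0 u k.succ m * X m = ∑ m : Fin n, γi k m * X m.succ := by
  rw [Fin.sum_univ_succ, thermoInv_zero', zero_mul, zero_add]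
  rfl

theorem trace_thermoInv (X : Fin (n + 1) → Fin (n + 1) → 𝒜) :
    ∑ k, ∑ l, thermoInv γi 0 u k l * X k l
      = ∑ k : Fin n, ∑ l : Fin n, γi k l * X k.succ l.succ := by
  rw [Fin.sum_univ_succ]
  simp only [thermoInv_zero, zero_mul, Finset.sum_const_zero, zero_add, sum_thermoInv]

theorem thermoConn_zero (hu : τ * u = -1) (b c : Fin (n + 1)) :
    thermoConn d γi Γ R τ 0 u 0 b c = -(τ * dtime 𝒜 b * dtime 𝒜 c) := by
  cases b using Fin.cases <;> cases c using Fin.cases <;> simp [thermoConn]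
  linear_combination (2 * half 𝒜 * τ) * hu - τ * two_mul_half (𝒜 := 𝒜)

theorem thermoConn_succ (i j k : Fin n) :
    thermoConn d γi Γ R τ 0 u i.succ j.succ k.succ = Γ i j k := rfl

theorem thermoConn_succ_zero (i k : Fin n) :
    thermoConn d γi Γ R τ 0 u k.succ i.succ 0 = -∑ l, γi k l * ric γi R l i := rfl

namespace IsFlow

variable (hF : IsFlow d γ γi Γ R τ) (hu : τ * u = -1)
  {Rm : Fin (n + 1) → Fin (n + 1) → Fin (n + 1) → Fin (n + 1) → 𝒜}
  (hC : IsCurvature d (thermoConn d γi Γ R τ 0 u) (thermoInv γi 0 u) Rm)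
include hF hu hC

omit hu hC in
/-- The degenerate tensor at `ε = 0` is still injective on the space components of a covector. -/
theorem eq_of_raise {X Y : Fin n → 𝒜} (h : ∀ k, ∑ m, γi k m * X m = ∑ m, γi k m * Y m)
    (i : Fin n) : X i = Y i := by
  rw [← mul_inv_cancel_sum hF.inv X i, ← mul_inv_cancel_sum hF.inv Y i]
  simp only [h]

theorem limit_space (i j k l : Fin n) : Rm i.succ j.succ k.succ l.succ = R i j k l := by
  refine hF.eq_of_raise (X := fun l => Rm i.succ j.succ k.succ l.succ) (fun l => ?_) l
  rw [← sum_thermoInv (u := u) (fun l => Rm i.succ j.succ k.succ l), ← hC.raise,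
    ← hF.isCurvature.raise]
  simp only [curvUp]
  rw [Fin.sum_univ_succ]
  simp only [thermoConn_zero hu, thermoConn_succ, dtime_succ]
  simp [spatial]

theorem limit_ric_space (i j : Fin n) :
    ric (thermoInv γi 0 u) Rm i.succ j.succ = ric γi R i j := by
  simp only [ric, trace_thermoInv (fun k l => Rm i.succ k j.succ l), hF.limit_space hu hC]

theorem limit_sca : sca (thermoInv γi 0 u) Rm = sca γi R := by
  simp only [sca, trace_thermoInv (fun k l => ric (thermoInv γi 0 u) Rm k l),
    hF.limit_ric_space hu hC]

theorem limit_conn_space (f : Fin (n + 1)) (i : Fin n) : thermoConn d γi Γ R τ 0 u f i.succ 0 =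
    -(∑ e, thermoInv γi 0 u f e * ric (thermoInv γi 0 u) Rm e i.succ) := by
  cases f using Fin.cases with
  | zero => simp [thermoConn_zero hu, thermoInv_zero]
  | succ f =>
    rw [sum_thermoInv, thermoConn_succ_zero]
    simp only [hF.limit_ric_space hu hC]

/-- The commutator of covariant derivatives of `∂/∂t`, for directions `c`, `k` in which
`∇∂/∂t` is minus the Ricci tensor, up to the term `-τ dt ⊗ ∂/∂t`. -/
theorem limit_raise (c k : Fin (n + 1))
    (hc : ∀ f, thermoConn d γi Γ R τ 0 u f c 0 = -(∑ e, thermoInv γi 0 u f e *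
      ric (thermoInv γi 0 u) Rm e c) - τ * dtime 𝒜 c * dtime 𝒜 f)
    (hk : ∀ f, thermoConn d γi Γ R τ 0 u f k 0 = -(∑ e, thermoInv γi 0 u f e *
      ric (thermoInv γi 0 u) Rm e k) - τ * dtime 𝒜 k * dtime 𝒜 f) (b : Fin n) :
    Rm c k 0 b.succ = curlRic d (thermoConn d γi Γ R τ 0 u) (thermoInv γi 0 u) Rm c k b.succ
      - τ * (dtime 𝒜 k * ric (thermoInv γi 0 u) Rm c b.succ
        - dtime 𝒜 c * ric (thermoInv γi 0 u) Rm k b.succ) := by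
  set Ric := ric (thermoInv γi 0 u) Rm with hRic
  set Γ' := thermoConn d γi Γ R τ 0 u with hΓ'
  set h := thermoInv γi 0 u with hh
  refine hF.eq_of_raise (X := fun b : Fin n => Rm c k 0 b.succ) (Y := fun b : Fin n =>
    curlRic d Γ' h Rm c k b.succ
      - τ * (dtime 𝒜 k * Ric c b.succ - dtime 𝒜 c * Ric k b.succ)) (fun f => ?_) b
  rw [← sum_thermoInv (u := u) (fun b => Rm c k 0 b), ← hC.raise, ← sum_thermoInv (u := u)
    (fun b => curlRic d Γ' h Rm c k b - τ * (dtime 𝒜 k * Ric c b - dtime 𝒜 c * Ric k b))]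
  rw [curvUp, hc, hk]
  simp only [← hh]
  have e1 := hC.raise_deriv (fun e => Ric e c) k f.succ
  have e2 := hC.raise_deriv (fun e => Ric e k) c f.succ
  have hc' := hc f.succ
  have hk' := hk f.succ
  simp only [dtime_succ, mul_zero, sub_zero] at e1 e2 hc' hk' ⊢
  have e3 : ∑ e, (Γ' e c 0 * Γ' f.succ k e - Γ' e k 0 * Γ' f.succ c e)
      = -∑ m, Γ' f.succ k m * ∑ e, h m e * Ric e c + ∑ m, Γ' f.succ c m * ∑ e, h m e * Ric e k
        - τ * dtime 𝒜 c * Γ' f.succ k 0 + τ * dtime 𝒜 k * Γ' f.succ c 0 := by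
    have k1 : ∀ X : Fin (n + 1) → 𝒜, ∑ e, dtime 𝒜 e * X e = X 0 := by
      intro X; rw [Fin.sum_univ_succ]; simp
    rw [← k1 (fun e => Γ' f.succ k e), ← k1 (fun e => Γ' f.succ c e), Finset.mul_sum,
      Finset.mul_sum, ← Finset.sum_neg_distrib, ← Finset.sum_add_distrib,
      ← Finset.sum_sub_distrib, ← Finset.sum_add_distrib]
    exact Finset.sum_congr rfl fun e _ => by rw [hc, hk]; ring
  have e4 : ∑ b, h f.succ b * (curlRic d Γ' h Rm c k b
        - τ * (dtime 𝒜 k * Ric c b - dtime 𝒜 c * Ric k b))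
      = ∑ e, h f.succ e * (d c (Ric e k) - ∑ m, Γ' m c e * Ric m k)
        - ∑ e, h f.succ e * (d k (Ric e c) - ∑ m, Γ' m k e * Ric m c)
        - τ * dtime 𝒜 k * (∑ e, h f.succ e * Ric e c)
        + τ * dtime 𝒜 c * (∑ e, h f.succ e * Ric e k) := by
    rw [Finset.mul_sum, Finset.mul_sum, ← Finset.sum_sub_distrib, ← Finset.sum_sub_distrib,
      ← Finset.sum_add_distrib]
    refine Finset.sum_congr rfl fun e _ => ?_
    have s1 : ∀ a, Ric a e = Ric e a := fun a => hC.ric_symm a e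
    have s2 : ∑ m, Γ' m c k * Ric m e = ∑ m, Γ' m k c * Ric m e :=
      Finset.sum_congr rfl fun m _ => by rw [hC.torsion]
    have s3 : ∀ c k, ∑ m, Γ' m c e * Ric k m = ∑ m, Γ' m c e * Ric m k := fun c k =>
      Finset.sum_congr rfl fun m _ => by rw [hRic, hC.ric_symm]
    simp only [curlRic, cov₂, ← hRic, Finset.sum_add_distrib, s3, s1 c, s1 k, s2]
    ring
  rw [e4, ← e1, ← e2, e3, hc', hk']
  simp only [map_neg]
  ring

/-- `R_{ij0k} = P_{ijk}`. -/
theorem limit_mixed (i j k : Fin n) :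
    Rm i.succ j.succ 0 k.succ = curlRic (spatial d) Γ γi R i j k := by
  rw [hF.limit_raise hu hC i.succ j.succ (fun f => by simp [hF.limit_conn_space hu hC])
    (fun f => by simp [hF.limit_conn_space hu hC])]
  have h : ∀ i j k : Fin n, cov₂ d (thermoConn d γi Γ R τ 0 u) (ric (thermoInv γi 0 u) Rm)
      i.succ j.succ k.succ = cov₂ (spatial d) Γ (ric γi R) i j k := by
    intro i j k
    simp only [cov₂]
    rw [Fin.sum_univ_succ]
    simp [thermoConn_zero hu, thermoConn_succ, hF.limit_ric_space hu hC, spatial]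
  simp [curlRic, h]

/-- `R_{i0} = ½ ∂_i S`. -/
theorem limit_ric_mixed (i : Fin n) :
    2 * ric (thermoInv γi 0 u) Rm i.succ 0 = spatial d i (sca γi R) := by
  rw [← hF.isCurvature.div_ric, ← hF.isCurvature.trace_curlRic]
  simp only [ric, trace_thermoInv (fun k l => Rm i.succ k 0 l), hF.limit_mixed hu hC]

/-- The covariant derivative of `∂/∂t` for the limit connection. -/
theorem limit_conn (f c : Fin (n + 1)) : thermoConn d γi Γ R τ 0 u f c 0 =
    -(∑ e, thermoInv γi 0 u f e * ric (thermoInv γi 0 u) Rm e c)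
      - τ * dtime 𝒜 c * dtime 𝒜 f := by
  cases c using Fin.cases with
  | succ i => simp [hF.limit_conn_space hu hC]
  | zero =>
    cases f using Fin.cases with
    | zero => simp [thermoConn_zero hu, thermoInv_zero]
    | succ k =>
      rw [sum_thermoInv]
      simp [thermoConn, ← hF.limit_ric_mixed hu hC, Finset.mul_sum]
      exact Finset.sum_congr rfl fun l _ => by
        linear_combination (γi k l * ric (thermoInv γi 0 u) Rm l.succ 0) * two_mul_half (𝒜 := 𝒜)

/-- `R_{00} = ½ ∂_t S + τ S`, from the contracted second Bianchi identity. -/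
theorem limit_ric_time : 2 * ric (thermoInv γi 0 u) Rm 0 0 = d 0 (sca γi R) + 2 * τ * sca γi R := by
  have h1 : ∀ k l : Fin n, Rm 0 k.succ 0 l.succ =
      curlRic d (thermoConn d γi Γ R τ 0 u) (thermoInv γi 0 u) Rm 0 k.succ l.succ
        + τ * ric γi R k l := by
    intro k l
    rw [hF.limit_raise hu hC 0 k.succ (fun f => hF.limit_conn hu hC f _)
      (fun f => hF.limit_conn hu hC f _)]
    simp [hF.limit_ric_space hu hC]
  have h2 := hC.trace_curlRic 0
  have h3 := hC.div_ric 0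
  rw [hF.limit_sca hu hC, ← h2, trace_thermoInv (fun k l => curlRic d _ _ Rm 0 k l)] at h3
  rw [← h3, ric, trace_thermoInv (fun k l => Rm 0 k 0 l)]
  simp only [h1, mul_add, Finset.sum_add_distrib, sca]
  simp only [Finset.mul_sum]
  congr 1
  exact Finset.sum_congr rfl fun _ _ => Finset.sum_congr rfl fun _ _ => by ring

/-- The curvature with an index `∂/∂t` is the curl of the Ricci tensor, up to a term coming from
`∇dt = τ dt ⊗ dt`. -/
theorem limit_curlRic (c k b : Fin (n + 1)) :
    curlRic d (thermoConn d γi Γ R τ 0 u) (thermoInv γi 0 u) Rm c k b = Rm c k 0 b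
      + τ * (dtime 𝒜 k * ric (thermoInv γi 0 u) Rm c b
        - dtime 𝒜 c * ric (thermoInv γi 0 u) Rm k b) := by
  have hsucc : ∀ (c k : Fin (n + 1)) (b : Fin n),
      curlRic d (thermoConn d γi Γ R τ 0 u) (thermoInv γi 0 u) Rm c k b.succ = Rm c k 0 b.succ
      + τ * (dtime 𝒜 k * ric (thermoInv γi 0 u) Rm c b.succ
        - dtime 𝒜 c * ric (thermoInv γi 0 u) Rm k b.succ) := by
    intro c k b
    rw [hF.limit_raise hu hC c k (fun f => hF.limit_conn hu hC f _)
      (fun f => hF.limit_conn hu hC f _)]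
    ring
  have hR0 : ∀ a b c, Rm a b c c = 0 := fun a b c => eq_zero_of_two_mul (by
    linear_combination hC.anti₂ a b c c)
  have hR0' : ∀ a b c, Rm c c a b = 0 := fun a b c => by rw [hC.pair, hR0]
  -- the last index `0` is not seen by the degenerate inverse metric; `P_{i00}` is computed from the
  -- components `R_{i0}` and `R_{00}` of the Ricci tensor
  have hmix : ∀ i : Fin n,
      curlRic d (thermoConn d γi Γ R τ 0 u) (thermoInv γi 0 u) Rm i.succ 0 0
        = τ * ric (thermoInv γi 0 u) Rm i.succ 0 := by
    intro i
    have m1 := hF.limit_ric_mixed hu hC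
    have m2 := hF.limit_ric_time hu hC
    have m3 := hF.limit_ric_space hu hC
    set Ric := ric (thermoInv γi 0 u) Rm with hRic
    have hs : ∀ a b, Ric a b = Ric b a := hC.ric_symm
    have n1 := congrArg (d i.succ) m2
    have n2 := congrArg (d 0) (m1 i)
    have n3 := hF.time_space i
    simp only [Derivation.leibniz, map_add, smul_eq_mul, spatial] at n1 n2 n3
    have n4 : d i.succ (2 : 𝒜) = 0 := by simpa using (d i.succ).map_natCast 2
    have n5 : d 0 (2 : 𝒜) = 0 := by simpa using (d 0).map_natCast 2
    rw [n3, n4] at n1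
    rw [n5] at n2
    have hcomm := hF.comm 0 i.succ (sca γi R)
    have hm : ∑ l : Fin n, thermoConn d γi Γ R τ 0 u l.succ 0 0 * Ric i.succ l.succ
        = ∑ l : Fin n, thermoConn d γi Γ R τ 0 u l.succ i.succ 0 * Ric l.succ 0 := by
      have k1 : ∀ l : Fin n, thermoConn d γi Γ R τ 0 u l.succ 0 0
          = -∑ p : Fin n, γi l p * Ric p.succ 0 := by
        intro l; rw [hF.limit_conn hu hC, sum_thermoInv]; simp [hRic]
      simp only [k1, thermoConn_succ_zero, neg_mul, Finset.sum_mul, Finset.sum_neg_distrib,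
        ← m3]
      rw [Finset.sum_comm]
      congr 1
      exact Finset.sum_congr rfl fun p _ => Finset.sum_congr rfl fun l _ => by
        rw [hs l.succ i.succ, hF.symm_inv]; ring
    have e1 : cov₂ d (thermoConn d γi Γ R τ 0 u) Ric i.succ 0 0 = d i.succ (Ric 0 0)
        - 2 * ∑ l : Fin n, thermoConn d γi Γ R τ 0 u l.succ i.succ 0 * Ric l.succ 0 := by
      rw [cov₂, Fin.sum_univ_succ, Finset.mul_sum]
      simp only [thermoConn_zero hu, dtime_succ, mul_zero, zero_mul, neg_zero, add_zero,
        zero_add]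
      congr 1
      exact Finset.sum_congr rfl fun l _ => by rw [hs 0 l.succ]; ring
    have e2 : cov₂ d (thermoConn d γi Γ R τ 0 u) Ric 0 i.succ 0 = d 0 (Ric i.succ 0)
        + τ * Ric i.succ 0
        - ∑ l : Fin n, thermoConn d γi Γ R τ 0 u l.succ i.succ 0 * Ric l.succ 0
        - ∑ l : Fin n, thermoConn d γi Γ R τ 0 u l.succ 0 0 * Ric i.succ l.succ := by
      rw [cov₂, Fin.sum_univ_succ]
      simp only [thermoConn_zero hu, dtime_succ, dtime_zero, mul_zero, zero_mul, neg_zero,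
        Finset.sum_add_distrib, hC.torsion _ 0 (Fin.succ i)]
      ring
    refine sub_eq_zero.1 (eq_zero_of_two_mul ?_)
    rw [curlRic, ← hRic, e1, e2, hm]
    have n6 : 2 * Ric i.succ 0 = d i.succ (sca γi R) := m1 i
    simp only [mul_zero, add_zero] at n1 n2
    linear_combination n1 - n2 - hcomm - 2 * τ * n6
  cases b using Fin.cases with
  | succ b => exact hsucc c k b
  | zero =>
    cases c using Fin.cases with
    | zero =>
      cases k using Fin.cases with
      | zero => simp [curlRic, hR0]
      | succ i => rw [hC.curlRic_swap, hmix, hR0]; simp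
    | succ i =>
      cases k using Fin.cases with
      | zero => rw [hmix, hR0]; simp
      | succ j =>
        -- `P_{ij0}` follows from `P_{j0i}` and `P_{0ij}`
        have h1 := hC.curlRic_cyclic i.succ j.succ 0
        rw [hsucc, hsucc] at h1
        have h2 := hC.anti₁ j.succ 0 0 i.succ
        have h3 := hC.pair 0 j.succ 0 i.succ
        have h4 := hC.ric_symm i.succ j.succ
        rw [hR0]
        simp only [dtime_succ, dtime_zero] at h1 ⊢
        linear_combination h1 - h2 + h3 + τ * h4

/-- `2 R_{0i0j} = 2 M_{ij}`, with `2τ = 1/t`. By `limit_curlRic`, `R_{0i0j}` is `P_{0ji} + τ R_{ij}`,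
which is a divergence of the curvature and thus a divergence of `P`. -/
theorem limit_time (i j : Fin n) : 2 * Rm 0 i.succ 0 j.succ =
    2 * (∑ k, ∑ l, γi k l * cov₃ (spatial d) Γ (cov₂ (spatial d) Γ (ric γi R)) k l i j)
      + 4 * (∑ k, ∑ l, ∑ p, ∑ q, R i k j l * (γi k p * γi l q * ric γi R p q))
      - 2 * (∑ k, ∑ p, γi k p * ric γi R i p * ric γi R k j)
      - (spatial d i (spatial d j (sca γi R)) - ∑ m, Γ m i j * spatial d m (sca γi R))
      + 2 * τ * ric γi R i j := by
  have h1 : 2 * Rm 0 i.succ 0 j.succ = 2 * curlRic d (thermoConn d γi Γ R τ 0 u)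
      (thermoInv γi 0 u) Rm 0 j.succ i.succ + 2 * τ * ric γi R i j := by
    have h2 := hF.limit_curlRic hu hC 0 j.succ i.succ
    have h3 := hF.isCurvature.ric_symm i j
    rw [hF.limit_ric_space hu hC] at h2
    simp only [dtime_succ, dtime_zero] at h2
    linear_combination 2 * hC.pair 0 i.succ 0 j.succ - 2 * h2 - 2 * τ * h3
  have hc : ∀ k l : Fin n, cov₄ d (thermoConn d γi Γ R τ 0 u) Rm k.succ 0 j.succ i.succ l.succ =
      -cov₃ (spatial d) Γ (curlRic (spatial d) Γ γi R) k l i j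
        + ∑ m, (∑ p, γi m p * ric γi R p k) * R m j i l := by
    intro k l
    have hm : ∀ a b c : Fin n, Rm 0 a.succ b.succ c.succ
        = -curlRic (spatial d) Γ γi R c b a := by
      intro a b c
      rw [hC.pair, hF.limit_mixed hu hC, hF.isCurvature.curlRic_swap]
    rw [cov₄, Fin.sum_univ_succ]
    simp only [thermoConn_zero hu, dtime_succ, thermoConn_succ, thermoConn_succ_zero, hm,
      hF.limit_space hu hC, cov₃, map_neg, Finset.sum_add_distrib, spatial]
    simp only [mul_neg, neg_mul, Finset.sum_neg_distrib, mul_zero, zero_mul, neg_zero]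
    ring
  have h2 : curlRic d (thermoConn d γi Γ R τ 0 u) (thermoInv γi 0 u) Rm 0 j.succ i.succ =
      ∑ k, ∑ l, γi k l * cov₃ (spatial d) Γ (curlRic (spatial d) Γ γi R) k l i j
      - ∑ k, ∑ l, γi k l * ∑ m, (∑ p, γi m p * ric γi R p k) * R m j i l := by
    rw [hC.curlRic_eq, trace_thermoInv (fun k l => cov₄ d _ Rm k 0 j.succ i.succ l)]
    simp only [hc, mul_add, mul_neg, Finset.sum_add_distrib, Finset.sum_neg_distrib]
    ring
  have h3 := hF.isCurvature.div_curlRic j i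
  have hS := hF.isCurvature
  have e1 : ∑ k, ∑ l, γi k l * ∑ m, curvUp (spatial d) Γ k i l m * ric γi R m j
      = ∑ k, ∑ p, γi k p * ric γi R i p * ric γi R k j := by
    simp only [hS.raise]
    calc _ = ∑ k, ∑ l, ∑ m, ∑ p, γi m p * (γi k l * R i k p l) * ric γi R m j := by
          simp only [Finset.mul_sum, Finset.sum_mul]
          exact Finset.sum_congr rfl fun _ _ => Finset.sum_congr rfl fun _ _ =>
            Finset.sum_congr rfl fun _ _ => Finset.sum_congr rfl fun _ _ => by
              rw [hS.anti₁, hS.anti₂]; ring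
      _ = ∑ k, ∑ m, ∑ l, ∑ p, γi m p * (γi k l * R i k p l) * ric γi R m j :=
          Finset.sum_congr rfl fun _ _ => Finset.sum_comm
      _ = ∑ m, ∑ k, ∑ l, ∑ p, γi m p * (γi k l * R i k p l) * ric γi R m j := Finset.sum_comm
      _ = ∑ m, ∑ k, ∑ p, ∑ l, γi m p * (γi k l * R i k p l) * ric γi R m j :=
          Finset.sum_congr rfl fun _ _ => Finset.sum_congr rfl fun _ _ => Finset.sum_comm
      _ = ∑ m, ∑ p, ∑ k, ∑ l, γi m p * (γi k l * R i k p l) * ric γi R m j :=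
          Finset.sum_congr rfl fun _ _ => Finset.sum_comm
      _ = _ := by
          simp only [← Finset.sum_mul, ← Finset.mul_sum]
          rfl
  have e2 : ∑ k, ∑ l, γi k l * ∑ m, curvUp (spatial d) Γ k i j m * ric γi R l m
      = -∑ k, ∑ l, ∑ p, ∑ q, R i k j l * (γi k p * γi l q * ric γi R p q) := by
    have e : ∑ k, ∑ l, ∑ p, ∑ q, R i k j l * (γi k p * γi l q * ric γi R p q)
        = ∑ k, ∑ p, ∑ q, ∑ l, R i k j l * (γi k p * γi l q * ric γi R p q) := by
      refine Finset.sum_congr rfl fun _ _ => ?_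
      rw [Finset.sum_comm]
      exact Finset.sum_congr rfl fun _ _ => Finset.sum_comm
    rw [e]
    simp only [hS.raise, Finset.mul_sum, Finset.sum_mul, ← Finset.sum_neg_distrib]
    exact Finset.sum_congr rfl fun k _ => Finset.sum_congr rfl fun p _ =>
      Finset.sum_congr rfl fun q _ => Finset.sum_congr rfl fun l _ => by
        rw [hS.anti₁ k i, hF.symm_inv l q]; ring
  have e3 : ∑ k, ∑ l, γi k l * ∑ m, (∑ p, γi m p * ric γi R p k) * R m j i l
      = -∑ k, ∑ l, ∑ p, ∑ q, R i k j l * (γi k p * γi l q * ric γi R p q) := by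
    have e : ∑ k, ∑ l, ∑ p, ∑ q, R i k j l * (γi k p * γi l q * ric γi R p q)
        = ∑ p, ∑ k, ∑ l, ∑ q, R i k j l * (γi k p * γi l q * ric γi R p q) := by
      rw [Finset.sum_comm (s := Finset.univ) (t := Finset.univ) (f := fun p k =>
        ∑ l, ∑ q, R i k j l * (γi k p * γi l q * ric γi R p q))]
      exact Finset.sum_congr rfl fun _ _ => Finset.sum_comm
    rw [e]
    simp only [Finset.mul_sum, Finset.sum_mul, ← Finset.sum_neg_distrib]
    exact Finset.sum_congr rfl fun p _ => Finset.sum_congr rfl fun k _ =>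
      Finset.sum_congr rfl fun l _ => Finset.sum_congr rfl fun q _ => by
        rw [hS.pair l j, hS.anti₂ i k l j, hF.symm_inv k p, hS.ric_symm q p]; ring
  have e4 : ∑ k, ∑ l, γi k l * ∑ m, (curvUp (spatial d) Γ k i l m * ric γi R m j
        + curvUp (spatial d) Γ k i j m * ric γi R l m)
      = ∑ k, ∑ l, γi k l * ∑ m, curvUp (spatial d) Γ k i l m * ric γi R m j
        + ∑ k, ∑ l, γi k l * ∑ m, curvUp (spatial d) Γ k i j m * ric γi R l m := by
    simp only [Finset.sum_add_distrib, mul_add]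
  rw [h1, h2]
  linear_combination h3 - 2 * e4 - 2 * e1 - 2 * e2 - 2 * e3

end IsFlow

end Limit

/-! ### The evolution of the curvature tensor at `ε = 0` -/

section Heat

variable {𝒜 ι : Type*} [CommRing 𝒜] [Algebra ℝ 𝒜] [Fintype ι]

/-- The part of `g^{ef} [∇_f, ∇_a] R_{becg}` quadratic in the full curvature tensor. -/
def quadCurv (d : ι → Derivation ℝ 𝒜 𝒜) (Γ : ι → ι → ι → 𝒜) (H : ι → ι → 𝒜)
    (R : ι → ι → ι → ι → 𝒜) (a b c g : ι) : 𝒜 :=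
  ∑ e, ∑ f, H e f * ∑ m, (curvUp d Γ f a b m * R m e c g + curvUp d Γ f a c m * R b e m g
    + curvUp d Γ f a g m * R b e c m)

/-- The remaining part of the contracted commutator term is linear in the Ricci tensor. -/
theorem IsCurvature.trace_curvAct {d : ι → Derivation ℝ 𝒜 𝒜} {Γ : ι → ι → ι → 𝒜} {H : ι → ι → 𝒜}
    {R : ι → ι → ι → ι → 𝒜} (hC : IsCurvature d Γ H R) (a b c g : ι) :
    ∑ e, ∑ f, H e f * curvAct d Γ R f a b e c g = quadCurv d Γ H R a b c g
      + ∑ m, (∑ p, H m p * ric H R p a) * R b m c g := by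
  have h : ∑ e, ∑ f, H e f * ∑ m, curvUp d Γ f a e m * R b m c g
      = ∑ m, (∑ p, H m p * ric H R p a) * R b m c g := by
    have h1 : ∀ m p, H m p * ric H R p a * R b m c g
        = ∑ e, ∑ f, H e f * (H m p * R f a e p * R b m c g) := by
      intro m p
      rw [hC.ric_symm, ric, Finset.mul_sum, Finset.sum_mul, Finset.sum_comm]
      refine Finset.sum_congr rfl fun e _ => ?_
      rw [Finset.mul_sum, Finset.sum_mul]
      exact Finset.sum_congr rfl fun f _ => by
        rw [hC.anti₁, hC.anti₂, hC.symm f e]; ring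
    simp only [Finset.sum_mul, h1, hC.raise, Finset.mul_sum]
    symm
    calc _ = ∑ m, ∑ e, ∑ p, ∑ f, H e f * (H m p * R f a e p * R b m c g) :=
          Finset.sum_congr rfl fun _ _ => Finset.sum_comm
      _ = ∑ m, ∑ e, ∑ f, ∑ p, H e f * (H m p * R f a e p * R b m c g) :=
          Finset.sum_congr rfl fun _ _ => Finset.sum_congr rfl fun _ _ => Finset.sum_comm
      _ = ∑ e, ∑ m, ∑ f, ∑ p, H e f * (H m p * R f a e p * R b m c g) := Finset.sum_comm
      _ = _ := Finset.sum_congr rfl fun _ _ => Finset.sum_comm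
  rw [← h, quadCurv, ← Finset.sum_add_distrib]
  refine Finset.sum_congr rfl fun e _ => ?_
  rw [← Finset.sum_add_distrib]
  refine Finset.sum_congr rfl fun f _ => ?_
  rw [← mul_add, ← Finset.sum_add_distrib, curvAct]
  congr 1
  exact Finset.sum_congr rfl fun m _ => by ring

end Heat

section HeatLimit

variable {𝒜 : Type*} [CommRing 𝒜] [Algebra ℝ 𝒜] {n : ℕ}
  {d : Fin (n + 1) → Derivation ℝ 𝒜 𝒜} {γ γi : Fin n → Fin n → 𝒜}
  {Γ : Fin n → Fin n → Fin n → 𝒜} {R : Fin n → Fin n → Fin n → Fin n → 𝒜} {τ u : 𝒜}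

namespace IsFlow

variable (hF : IsFlow d γ γi Γ R τ) (hu : τ * u = -1)
  {Rm : Fin (n + 1) → Fin (n + 1) → Fin (n + 1) → Fin (n + 1) → 𝒜}
  (hC : IsCurvature d (thermoConn d γi Γ R τ 0 u) (thermoInv γi 0 u) Rm)
include hF hu hC

/-- The derivative of `limit_curlRic`. -/
theorem limit_cov₃_curlRic (a c g b : Fin (n + 1)) :
    cov₃ d (thermoConn d γi Γ R τ 0 u) (curlRic d (thermoConn d γi Γ R τ 0 u)
      (thermoInv γi 0 u) Rm) a c g b =
    cov₄ d (thermoConn d γi Γ R τ 0 u) Rm a c g 0 b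
      - ∑ m, (∑ p, thermoInv γi 0 u m p * ric (thermoInv γi 0 u) Rm p a) * Rm c g m b
      - τ * dtime 𝒜 a * Rm c g 0 b
      - τ ^ 2 * dtime 𝒜 a * (dtime 𝒜 g * ric (thermoInv γi 0 u) Rm c b
        - dtime 𝒜 c * ric (thermoInv γi 0 u) Rm g b)
      + τ * (dtime 𝒜 g * cov₂ d (thermoConn d γi Γ R τ 0 u) (ric (thermoInv γi 0 u) Rm) a c b
        - dtime 𝒜 c * cov₂ d (thermoConn d γi Γ R τ 0 u) (ric (thermoInv γi 0 u) Rm) a g b) := by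
  have hτ : d a τ = -2 * τ ^ 2 * dtime 𝒜 a := by
    cases a using Fin.cases with
    | zero => simp [hF.time]
    | succ i => rw [dtime_succ, mul_zero]; exact hF.time_space i
  have hdt : ∀ b : Fin (n + 1), d a (dtime 𝒜 b) = 0 := by
    intro b
    cases b using Fin.cases <;> simp
  have k1 : ∀ X : Fin (n + 1) → 𝒜, ∑ e, dtime 𝒜 e * X e = X 0 := by
    intro X; rw [Fin.sum_univ_succ]; simp
  have hΓ0 := thermoConn_zero (d := d) (γi := γi) (Γ := Γ) (R := R) hu
  have hY := hF.limit_conn hu hC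
  have hP := hF.limit_curlRic hu hC
  set Ric := ric (thermoInv γi 0 u) Rm with hRic
  set Γ' := thermoConn d γi Γ R τ 0 u with hΓ'
  set h := thermoInv γi 0 u with hh
  have s1 : ∑ m, Γ' m a 0 * Rm c g m b
      = -∑ m, (∑ p, h m p * Ric p a) * Rm c g m b - τ * dtime 𝒜 a * Rm c g 0 b := by
    rw [← k1 (fun m => Rm c g m b), Finset.mul_sum, ← Finset.sum_neg_distrib,
      ← Finset.sum_sub_distrib]
    exact Finset.sum_congr rfl fun m _ => by rw [hY]; ring
  have s2 : ∀ c g, ∑ m, Γ' m a c * (dtime 𝒜 m * Ric g b)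
      = -(τ * dtime 𝒜 a * dtime 𝒜 c) * Ric g b := by
    intro c g
    rw [← hΓ0, ← k1 (fun m => Γ' m a c), Finset.sum_mul]
    exact Finset.sum_congr rfl fun m _ => by ring
  have s3 : ∑ m, (Γ' m a c * (Rm m g 0 b + τ * (dtime 𝒜 g * Ric m b - dtime 𝒜 m * Ric g b))
        + Γ' m a g * (Rm c m 0 b + τ * (dtime 𝒜 m * Ric c b - dtime 𝒜 c * Ric m b))
        + Γ' m a b * (Rm c g 0 m + τ * (dtime 𝒜 g * Ric c m - dtime 𝒜 c * Ric g m)))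
      = ∑ m, (Γ' m a c * Rm m g 0 b + Γ' m a g * Rm c m 0 b + Γ' m a 0 * Rm c g m b
          + Γ' m a b * Rm c g 0 m) - ∑ m, Γ' m a 0 * Rm c g m b
        + τ * dtime 𝒜 g * ∑ m, (Γ' m a c * Ric m b + Γ' m a b * Ric c m)
        - τ * dtime 𝒜 c * ∑ m, (Γ' m a g * Ric m b + Γ' m a b * Ric g m)
        - τ * ∑ m, Γ' m a c * (dtime 𝒜 m * Ric g b)
        + τ * ∑ m, Γ' m a g * (dtime 𝒜 m * Ric c b) := by
    simp only [Finset.mul_sum, ← Finset.sum_add_distrib, ← Finset.sum_sub_distrib]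
    exact Finset.sum_congr rfl fun m _ => by ring
  rw [cov₃]
  simp only [hP]
  rw [s3, s2, s2, s1, cov₄, cov₂, cov₂, map_add, Derivation.leibniz, map_sub, Derivation.leibniz,
    Derivation.leibniz, hτ, hdt, hdt]
  simp only [smul_eq_mul]
  ring

/-- The evolution of the limit curvature tensor: besides the quadratic terms there are only terms
which count the indices `∂/∂t`. In `ΔR_{abcg} = ∇_a P_{cgb} - ∇_b P_{cga} + …` the tensor `P` is
replaced by the curvature with an index `0`, and the second Bianchi identity turns the derivatives
into `∇_0 R_{abcg}`; the terms linear in the Ricci tensor cancel. -/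
theorem limit_heat (a b c g : Fin (n + 1)) :
    cov₄ d (thermoConn d γi Γ R τ 0 u) Rm 0 a b c g
      - ∑ e, ∑ f, thermoInv γi 0 u e f * covTwice₄ d (thermoConn d γi Γ R τ 0 u) Rm f e a b c g =
    quadCurv d (thermoConn d γi Γ R τ 0 u) (thermoInv γi 0 u) Rm a b c g
      - quadCurv d (thermoConn d γi Γ R τ 0 u) (thermoInv γi 0 u) Rm b a c g
      + τ * (dtime 𝒜 a * Rm 0 b c g + dtime 𝒜 b * Rm a 0 c g + dtime 𝒜 c * Rm a b 0 g
        + dtime 𝒜 g * Rm a b c 0)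
      - 2 * τ ^ 2 * (dtime 𝒜 g * dtime 𝒜 b * ric (thermoInv γi 0 u) Rm a c
        - dtime 𝒜 g * dtime 𝒜 a * ric (thermoInv γi 0 u) Rm b c
        - dtime 𝒜 c * dtime 𝒜 b * ric (thermoInv γi 0 u) Rm a g
        + dtime 𝒜 c * dtime 𝒜 a * ric (thermoInv γi 0 u) Rm b g) := by
  rw [hC.laplacian_curvature, hC.trace_curvAct, hC.trace_curvAct, hF.limit_cov₃_curlRic hu hC,
    hF.limit_cov₃_curlRic hu hC]
  have hP := hF.limit_curlRic hu hC
  simp only [curlRic] at hP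
  have p1 := hP a b c
  have p2 := hP a b g
  have hB := hC.bianchi 0 a b c g
  have q1 : cov₄ d (thermoConn d γi Γ R τ 0 u) Rm a c g 0 b
      = -cov₄ d (thermoConn d γi Γ R τ 0 u) Rm a b 0 c g := by
    rw [cov₄_pair hC.pair, cov₄_anti₁ hC.anti₁]
  have q2 : cov₄ d (thermoConn d γi Γ R τ 0 u) Rm b c g 0 a
      = cov₄ d (thermoConn d γi Γ R τ 0 u) Rm b 0 a c g := by
    rw [cov₄_pair hC.pair]
  have r1 : ∀ a b, ∑ m, (∑ p, thermoInv γi 0 u m p * ric (thermoInv γi 0 u) Rm p a) * Rm c g m b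
      = -∑ m, (∑ p, thermoInv γi 0 u m p * ric (thermoInv γi 0 u) Rm p a) * Rm b m c g := by
    intro a b
    rw [← Finset.sum_neg_distrib]
    exact Finset.sum_congr rfl fun m _ => by rw [hC.pair c g, hC.anti₁ m b]; ring
  have t1 := hC.pair c g 0 b
  have t2 := hC.pair c g 0 a
  have t3 := hC.anti₁ 0 a c g
  have t5 := hC.anti₂ a b 0 c
  rw [q1, q2, r1, r1, t1, t2, hC.cov₂_ric_symm a c b, hC.cov₂_ric_symm b c a,
    hC.cov₂_ric_symm a g b, hC.cov₂_ric_symm b g a, hC.ric_symm c b, hC.ric_symm g b,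
    hC.ric_symm c a, hC.ric_symm g a]
  linear_combination hB - τ * (dtime 𝒜 b * t3) - τ * dtime 𝒜 g * p1 + τ * dtime 𝒜 c * p2
    - τ * dtime 𝒜 g * t5

end IsFlow

end HeatLimit

/-! ### Contractions with bivectors -/

section Contraction

variable {𝒜 ι : Type*} [CommRing 𝒜] [Fintype ι]

/-- The contraction `T_{abcg} A^{ab} B^{cg}`. -/
def contract (A B : ι → ι → 𝒜) (T : ι → ι → ι → ι → 𝒜) : 𝒜 :=
  ∑ a, ∑ b, ∑ c, ∑ g, T a b c g * A a b * B c g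

theorem contract_add (A B : ι → ι → 𝒜) (T T' : ι → ι → ι → ι → 𝒜) :
    contract A B (fun a b c g => T a b c g + T' a b c g) = contract A B T + contract A B T' := by
  simp only [contract, add_mul, Finset.sum_add_distrib]

theorem contract_sub (A B : ι → ι → 𝒜) (T T' : ι → ι → ι → ι → 𝒜) :
    contract A B (fun a b c g => T a b c g - T' a b c g) = contract A B T - contract A B T' := by
  simp only [contract, sub_mul, Finset.sum_sub_distrib]

theorem contract_neg (A B : ι → ι → 𝒜) (T : ι → ι → ι → ι → 𝒜) :
    contract A B (fun a b c g => -T a b c g) = -contract A B T := by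
  simp only [contract, neg_mul, Finset.sum_neg_distrib]

theorem contract_mul (A B : ι → ι → 𝒜) (r : 𝒜) (T : ι → ι → ι → ι → 𝒜) :
    contract A B (fun a b c g => r * T a b c g) = r * contract A B T := by
  simp only [contract, Finset.mul_sum, mul_assoc]

theorem contract_sum {κ : Type*} (s : Finset κ) (A B : ι → ι → 𝒜) (T : κ → ι → ι → ι → ι → 𝒜) :
    contract A B (fun a b c g => ∑ k ∈ s, T k a b c g) = ∑ k ∈ s, contract A B (T k) := by
  simp only [contract, Finset.sum_mul]
  symm
  rw [Finset.sum_comm]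
  refine Finset.sum_congr rfl fun _ _ => ?_
  rw [Finset.sum_comm]
  refine Finset.sum_congr rfl fun _ _ => ?_
  rw [Finset.sum_comm]
  exact Finset.sum_congr rfl fun _ _ => Finset.sum_comm

theorem contract_swap₁ {A : ι → ι → 𝒜} (hA : ∀ a b, A a b = -A b a) (B : ι → ι → 𝒜)
    (T : ι → ι → ι → ι → 𝒜) :
    contract A B (fun a b c g => T b a c g) = -contract A B T := by
  simp only [contract, ← Finset.sum_neg_distrib]
  rw [Finset.sum_comm]
  exact Finset.sum_congr rfl fun a _ => Finset.sum_congr rfl fun b _ =>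
    Finset.sum_congr rfl fun _ _ => Finset.sum_congr rfl fun _ _ => by rw [hA b a]; ring

theorem contract_pair (A B : ι → ι → 𝒜) (T : ι → ι → ι → ι → 𝒜) :
    contract A B (fun a b c g => T c g a b) = contract B A T := by
  simp only [contract]
  calc _ = ∑ a, ∑ c, ∑ b, ∑ g, T c g a b * A a b * B c g :=
        Finset.sum_congr rfl fun _ _ => Finset.sum_comm
    _ = ∑ c, ∑ a, ∑ b, ∑ g, T c g a b * A a b * B c g := Finset.sum_comm
    _ = ∑ c, ∑ a, ∑ g, ∑ b, T c g a b * A a b * B c g :=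
        Finset.sum_congr rfl fun _ _ => Finset.sum_congr rfl fun _ _ => Finset.sum_comm
    _ = ∑ c, ∑ g, ∑ a, ∑ b, T c g a b * A a b * B c g :=
        Finset.sum_congr rfl fun _ _ => Finset.sum_comm
    _ = _ := Finset.sum_congr rfl fun _ _ => Finset.sum_congr rfl fun _ _ =>
        Finset.sum_congr rfl fun _ _ => Finset.sum_congr rfl fun _ _ => by ring

theorem contract_swap₂ (A : ι → ι → 𝒜) {B : ι → ι → 𝒜} (hB : ∀ a b, B a b = -B b a)
    (T : ι → ι → ι → ι → 𝒜) :
    contract A B (fun a b c g => T a b g c) = -contract A B T := by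
  calc _ = contract B A (fun a b c g => T c g b a) :=
        contract_pair A B (fun a b c g => T c g b a)
    _ = -contract B A (fun a b c g => T c g a b) := contract_swap₁ hB A (fun a b c g => T c g a b)
    _ = _ := by rw [contract_pair]

theorem contract_smul_left (A B : ι → ι → 𝒜) (r : 𝒜) (T : ι → ι → ι → ι → 𝒜) :
    contract (fun a b => r * A a b) B T = r * contract A B T := by
  simp only [contract, Finset.mul_sum]
  exact Finset.sum_congr rfl fun a _ => Finset.sum_congr rfl fun b _ =>
    Finset.sum_congr rfl fun _ _ => Finset.sum_congr rfl fun _ _ => by ring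

theorem contract_smul_right (A B : ι → ι → 𝒜) (r : 𝒜) (T : ι → ι → ι → ι → 𝒜) :
    contract A (fun a b => r * B a b) T = r * contract A B T := by
  simp only [contract, Finset.mul_sum]
  exact Finset.sum_congr rfl fun a _ => Finset.sum_congr rfl fun b _ =>
    Finset.sum_congr rfl fun _ _ => Finset.sum_congr rfl fun _ _ => by ring

/-- The bivector `∂_l ⊗ X - X ⊗ ∂_l`. -/
def wedge [DecidableEq ι] (X : ι → 𝒜) (l a b : ι) : 𝒜 :=
  (if a = l then 1 else 0) * X b - (if b = l then 1 else 0) * X a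

theorem sum_wedge [DecidableEq ι] (X : ι → 𝒜) (l : ι) {Y : ι → ι → 𝒜}
    (hY : ∀ a b, Y a b = -Y b a) :
    ∑ a, ∑ b, Y a b * wedge X l a b = 2 * ∑ b, Y l b * X b := by
  simp only [wedge, mul_sub, Finset.sum_sub_distrib, ite_mul, one_mul, zero_mul, mul_ite, mul_zero]
  rw [Finset.sum_comm]
  simp only [Finset.sum_ite_eq', Finset.mem_univ, if_true, two_mul]
  rw [sub_eq_add_neg, ← Finset.sum_neg_distrib]
  congr 1
  exact Finset.sum_congr rfl fun b _ => by rw [hY b l]; ring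

theorem contract_wedge [DecidableEq ι] (X : ι → 𝒜) (l : ι) (B : ι → ι → 𝒜)
    {T : ι → ι → ι → ι → 𝒜} (hT : ∀ a b c g, T a b c g = -T b a c g) :
    contract (wedge X l) B T = 2 * ∑ b, ∑ c, ∑ g, T l b c g * X b * B c g := by
  have h1 : contract (wedge X l) B T
      = ∑ a, ∑ b, (∑ c, ∑ g, T a b c g * B c g) * wedge X l a b := by
    simp only [contract, Finset.sum_mul]
    exact Finset.sum_congr rfl fun a _ => Finset.sum_congr rfl fun b _ =>
      Finset.sum_congr rfl fun _ _ => Finset.sum_congr rfl fun _ _ => by ring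
  rw [h1, sum_wedge X l (Y := fun a b => ∑ c, ∑ g, T a b c g * B c g) fun a b => by
    simp only [← Finset.sum_neg_distrib]
    exact Finset.sum_congr rfl fun _ _ => Finset.sum_congr rfl fun _ _ => by rw [hT a b]; ring]
  congr 1
  refine Finset.sum_congr rfl fun b _ => ?_
  simp only [Finset.sum_mul]
  exact Finset.sum_congr rfl fun _ _ => Finset.sum_congr rfl fun _ _ => by ring

end Contraction

section QuadContraction

variable {𝒜 ι : Type*} [CommRing 𝒜] [Algebra ℝ 𝒜] [Fintype ι]
  {d : ι → Derivation ℝ 𝒜 𝒜} {Γ : ι → ι → ι → 𝒜} {H : ι → ι → 𝒜} {R : ι → ι → ι → ι → 𝒜}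

/-- The curvature operator `R_{abcg} U^{cg}`. -/
def curvOp (R : ι → ι → ι → ι → 𝒜) (U : ι → ι → 𝒜) (a b : ι) : 𝒜 := ∑ c, ∑ g, R a b c g * U c g

/-- `H^{ef} H^{mp} R_{afcp} R_{begm}`. -/
def curvSharp (H : ι → ι → 𝒜) (R : ι → ι → ι → ι → 𝒜) (a b c g : ι) : 𝒜 :=
  ∑ e, ∑ f, ∑ m, ∑ p, H e f * H m p * (R a f c p * R b e g m)

/-- The quadratic terms, contracted with a bivector: the analogue of Hamilton's `Rm² + Rm^#`. -/
theorem IsCurvature.contract_quadCurv (hC : IsCurvature d Γ H R) {U : ι → ι → 𝒜}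
    (hU : ∀ a b, U a b = -U b a) :
    2 * contract U U (quadCurv d Γ H R) =
      ∑ e, ∑ f, ∑ m, ∑ p, H e f * H m p * (curvOp R U f p * curvOp R U e m)
        + 4 * contract U U (curvSharp H R) := by
  have h0 : contract U U (quadCurv d Γ H R) = ∑ e, ∑ f, ∑ m, ∑ p, H e f * H m p *
      (contract U U (fun a b c g => R f a b p * R m e c g)
        + contract U U (fun a b c g => R f a c p * R b e m g)
        + contract U U (fun a b c g => R f a g p * R b e c m)) := by
    simp only [← contract_add, ← contract_mul, ← contract_sum]
    congr 1
    funext a b c g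
    simp only [quadCurv, hC.raise, Finset.mul_sum, Finset.sum_mul, ← Finset.sum_add_distrib]
    exact Finset.sum_congr rfl fun e _ => Finset.sum_congr rfl fun f _ =>
      Finset.sum_congr rfl fun m _ => Finset.sum_congr rfl fun p _ => by ring
  have h1 : ∀ e f m p, 2 * contract U U (fun a b c g => R f a b p * R m e c g)
      = curvOp R U f p * curvOp R U e m := by
    intro e f m p
    have s1 := contract_swap₁ hU U (fun a b c g => R f a b p * R m e c g)
    have s2 : contract U U (fun a b c g => R f a b p * R m e c g)
        - contract U U (fun a b c g => R f b a p * R m e c g)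
        = contract U U (fun a b c g => R f p a b * R e m c g) := by
      rw [← contract_sub]
      congr 1
      funext a b c g
      have k1 := hC.cyclic f a b p
      have k2 := hC.anti₁ b f a p
      have k3 := hC.pair a b f p
      rw [hC.anti₁ m e]
      linear_combination (-R e m c g) * (k1 - k2 - k3)
    have s3 : contract U U (fun a b c g => R f p a b * R e m c g)
        = curvOp R U f p * curvOp R U e m := by
      simp only [contract, curvOp, Finset.sum_mul]
      refine Finset.sum_congr rfl fun a _ => Finset.sum_congr rfl fun b _ => ?_
      simp only [Finset.mul_sum]
      exact Finset.sum_congr rfl fun c _ => Finset.sum_congr rfl fun g _ => by ring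
    rw [← s3, ← s2]
    linear_combination s1
  have h2 : ∀ e f m p, contract U U (fun a b c g => R f a c p * R b e m g)
      = contract U U (fun a b c g => R a f c p * R b e g m) := by
    intro e f m p
    congr 1
    funext a b c g
    rw [hC.anti₁ f a, hC.anti₂ b e m g]; ring
  have h3 : ∀ e f m p, contract U U (fun a b c g => R f a g p * R b e c m)
      = contract U U (fun a b c g => R a f c p * R b e g m) := by
    intro e f m p
    rw [contract_swap₂ U hU (fun a b c g => R f a c p * R b e g m), ← contract_neg]
    congr 1
    funext a b c g
    rw [hC.anti₁ f a]; ring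
  have h4 : contract U U (curvSharp H R) = ∑ e, ∑ f, ∑ m, ∑ p, H e f * H m p *
      contract U U (fun a b c g => R a f c p * R b e g m) := by
    simp only [← contract_mul, ← contract_sum]
    rfl
  rw [h0, h4]
  simp only [h2, h3, Finset.mul_sum, ← Finset.sum_add_distrib]
  exact Finset.sum_congr rfl fun e _ => Finset.sum_congr rfl fun f _ =>
    Finset.sum_congr rfl fun m _ => Finset.sum_congr rfl fun p _ => by
      linear_combination H e f * H m p * h1 e f m p

end QuadContraction

section HeatContraction

variable {𝒜 : Type*} [CommRing 𝒜] [Algebra ℝ 𝒜] {n : ℕ}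
  {d : Fin (n + 1) → Derivation ℝ 𝒜 𝒜} {γ γi : Fin n → Fin n → 𝒜}
  {Γ : Fin n → Fin n → Fin n → 𝒜} {R : Fin n → Fin n → Fin n → Fin n → 𝒜} {τ u : 𝒜}

theorem sum_dtime (X : Fin (n + 1) → 𝒜) : ∑ e, dtime 𝒜 e * X e = X 0 := by
  rw [Fin.sum_univ_succ]; simp

theorem contract_dtime (U B : Fin (n + 1) → Fin (n + 1) → 𝒜)
    (T : Fin (n + 1) → Fin (n + 1) → Fin (n + 1) → 𝒜) :
    contract U B (fun a b c g => dtime 𝒜 a * T b c g)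
      = ∑ b, ∑ c, ∑ g, T b c g * U 0 b * B c g := by
  rw [← sum_dtime (fun a => ∑ b, ∑ c, ∑ g, T b c g * U a b * B c g)]
  simp only [contract, Finset.mul_sum]
  exact Finset.sum_congr rfl fun _ _ => Finset.sum_congr rfl fun _ _ =>
    Finset.sum_congr rfl fun _ _ => Finset.sum_congr rfl fun _ _ => by ring

theorem contract_dtime_dtime (U B : Fin (n + 1) → Fin (n + 1) → 𝒜)
    (T : Fin (n + 1) → Fin (n + 1) → 𝒜) :
    contract U B (fun a b c g => dtime 𝒜 c * dtime 𝒜 a * T b g)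
      = ∑ b, ∑ g, T b g * U 0 b * B 0 g := by
  have h : contract U B (fun a b c g => dtime 𝒜 c * dtime 𝒜 a * T b g)
      = contract U B (fun a b c g => dtime 𝒜 a * (dtime 𝒜 c * T b g)) := by
    congr 1; funext a b c g; ring
  rw [h, contract_dtime]
  refine Finset.sum_congr rfl fun b _ => ?_
  rw [← sum_dtime (fun c => ∑ g, T b g * U 0 b * B c g)]
  simp only [Finset.mul_sum]
  exact Finset.sum_congr rfl fun _ _ => Finset.sum_congr rfl fun _ _ => by ring

namespace IsFlow

variable (hF : IsFlow d γ γi Γ R τ) (hu : τ * u = -1)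
  {Rm : Fin (n + 1) → Fin (n + 1) → Fin (n + 1) → Fin (n + 1) → 𝒜}
  (hC : IsCurvature d (thermoConn d γi Γ R τ 0 u) (thermoInv γi 0 u) Rm)
include hF hu hC

/-- The heat operator on `Rm(U, U)` in the limit, for a bivector with `∇_l U = τ ∂_l ∧ U^{0·}` in
space directions `l` and `(∇_0 - Δ) U = τ ∂_0 ∧ U^{0·}`: all terms with a factor `τ` cancel. -/
theorem limit_contract {U : Fin (n + 1) → Fin (n + 1) → 𝒜} (hU : ∀ a b, U a b = -U b a) :
    contract U U (fun a b c g => cov₄ d (thermoConn d γi Γ R τ 0 u) Rm 0 a b c g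
      - ∑ e, ∑ f, thermoInv γi 0 u e f * covTwice₄ d (thermoConn d γi Γ R τ 0 u) Rm f e a b c g)
    + 2 * τ * contract (wedge (U 0) 0) U Rm
    - 4 * τ * ∑ k, ∑ l, thermoInv γi 0 u k l *
        contract (wedge (U 0) l) U (cov₄ d (thermoConn d γi Γ R τ 0 u) Rm k)
    - 2 * τ ^ 2 * ∑ k, ∑ l, thermoInv γi 0 u k l *
        contract (wedge (U 0) k) (wedge (U 0) l) Rm
    = ∑ e, ∑ f, ∑ m, ∑ p, thermoInv γi 0 u e f * thermoInv γi 0 u m p *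
        (curvOp Rm U f p * curvOp Rm U e m)
      + 4 * contract U U (curvSharp (thermoInv γi 0 u) Rm) := by
  rw [← hC.contract_quadCurv hU]
  simp only [hF.limit_heat hu hC]
  set Ric := ric (thermoInv γi 0 u) Rm with hRic
  set E := ∑ b, ∑ c, ∑ g, Rm 0 b c g * U 0 b * U c g with hE
  set F := ∑ b, ∑ g, Ric b g * U 0 b * U 0 g with hFdef
  -- by the symmetries every term with a factor `τ` is a multiple of `E`, with a factor `τ²` of `F`
  have b1 : contract U U (fun a b c g => dtime 𝒜 a * Rm 0 b c g) = E := contract_dtime _ _ _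
  have b2 : contract U U (fun a b c g => dtime 𝒜 b * Rm a 0 c g) = E := by
    rw [contract_swap₁ hU U (fun a b c g => dtime 𝒜 a * Rm b 0 c g), ← contract_neg, ← b1]
    congr 1; funext a b c g; rw [hC.anti₁ b 0]; ring
  have b3 : contract U U (fun a b c g => dtime 𝒜 c * Rm a b 0 g) = E := by
    rw [← b1, ← contract_pair U U (fun a b c g => dtime 𝒜 a * Rm 0 b c g)]
    congr 1; funext a b c g; rw [hC.pair]
  have b4 : contract U U (fun a b c g => dtime 𝒜 g * Rm a b c 0) = E := by
    rw [contract_swap₂ U hU (fun a b c g => dtime 𝒜 c * Rm a b g 0), ← contract_neg, ← b3]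
    congr 1; funext a b c g; rw [hC.anti₂ a b g 0]; ring
  have c1 : contract U U (fun a b c g => dtime 𝒜 c * dtime 𝒜 a * Ric b g) = F :=
    contract_dtime_dtime _ _ _
  have c2 : contract U U (fun a b c g => dtime 𝒜 c * dtime 𝒜 b * Ric a g) = -F := by
    rw [contract_swap₁ hU U (fun a b c g => dtime 𝒜 c * dtime 𝒜 a * Ric b g), c1]
  have c3 : contract U U (fun a b c g => dtime 𝒜 g * dtime 𝒜 a * Ric b c) = -F := by
    rw [contract_swap₂ U hU (fun a b c g => dtime 𝒜 c * dtime 𝒜 a * Ric b g), c1]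
  have c4 : contract U U (fun a b c g => dtime 𝒜 g * dtime 𝒜 b * Ric a c) = F := by
    rw [contract_swap₁ hU U (fun a b c g => dtime 𝒜 g * dtime 𝒜 a * Ric b c), c3, neg_neg]
  have hq : contract U U (fun a b c g => quadCurv d (thermoConn d γi Γ R τ 0 u)
      (thermoInv γi 0 u) Rm b a c g) = -contract U U (fun a b c g =>
        quadCurv d (thermoConn d γi Γ R τ 0 u) (thermoInv γi 0 u) Rm a b c g) :=
    contract_swap₁ hU U _
  have hw0 : contract (wedge (U 0) 0) U Rm = 2 * E := contract_wedge _ _ _ hC.anti₁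
  have hw1 : ∑ k, ∑ l, thermoInv γi 0 u k l *
        contract (wedge (U 0) l) U (cov₄ d (thermoConn d γi Γ R τ 0 u) Rm k)
      = 2 * (E - 2 * τ * F) := by
    have k1 : ∀ k l, contract (wedge (U 0) l) U (cov₄ d (thermoConn d γi Γ R τ 0 u) Rm k)
        = 2 * ∑ b, ∑ c, ∑ g, cov₄ d (thermoConn d γi Γ R τ 0 u) Rm k l b c g * U 0 b * U c g :=
      fun k l => contract_wedge _ _ _ fun a b c g => cov₄_anti₁ hC.anti₁ k a b c g
    have k2 : ∀ b c g, ∑ k, ∑ l, thermoInv γi 0 u k l *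
        cov₄ d (thermoConn d γi Γ R τ 0 u) Rm k l b c g
        = Rm 0 b c g + τ * (dtime 𝒜 g * Ric c b - dtime 𝒜 c * Ric g b) := by
      intro b c g
      have := hC.curlRic_eq c g b
      rw [hF.limit_curlRic hu hC, ← hRic, hC.pair] at this
      rw [this, ← Finset.sum_neg_distrib]
      refine Finset.sum_congr rfl fun k _ => ?_
      rw [← Finset.sum_neg_distrib]
      exact Finset.sum_congr rfl fun l _ => by
        rw [cov₄_pair hC.pair, cov₄_anti₂ hC.anti₂]; ring
    have k3 : ∑ k, ∑ l, thermoInv γi 0 u k l *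
        contract (wedge (U 0) l) U (cov₄ d (thermoConn d γi Γ R τ 0 u) Rm k)
        = 2 * contract U U (fun a b c g => dtime 𝒜 a * (Rm 0 b c g
          + τ * (dtime 𝒜 g * Ric c b - dtime 𝒜 c * Ric g b))) := by
      have k4 : ∀ k l, thermoInv γi 0 u k l *
          contract (wedge (U 0) l) U (cov₄ d (thermoConn d γi Γ R τ 0 u) Rm k)
          = 2 * contract U U (fun a b c g => dtime 𝒜 a * (thermoInv γi 0 u k l *
            cov₄ d (thermoConn d γi Γ R τ 0 u) Rm k l b c g)) := by
        intro k l
        rw [k1, contract_dtime]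
        simp only [Finset.mul_sum]
        exact Finset.sum_congr rfl fun _ _ => Finset.sum_congr rfl fun _ _ =>
          Finset.sum_congr rfl fun _ _ => by ring
      simp only [k4, ← Finset.mul_sum, ← contract_sum, k2]
    have k5 : contract U U (fun a b c g => dtime 𝒜 a * (Rm 0 b c g
          + τ * (dtime 𝒜 g * Ric c b - dtime 𝒜 c * Ric g b)))
        = contract U U (fun a b c g => dtime 𝒜 a * Rm 0 b c g)
          + (τ * contract U U (fun a b c g => dtime 𝒜 g * dtime 𝒜 a * Ric b c)
            - τ * contract U U (fun a b c g => dtime 𝒜 c * dtime 𝒜 a * Ric b g)) := by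
      rw [← contract_mul, ← contract_mul, ← contract_sub, ← contract_add]
      congr 1; funext a b c g
      rw [hRic, hC.ric_symm c b, hC.ric_symm g b]; ring
    rw [k3, k5, b1, c1, c3]; ring
  have hw2 : ∑ k, ∑ l, thermoInv γi 0 u k l * contract (wedge (U 0) k) (wedge (U 0) l) Rm
      = 4 * F := by
    have k1 : ∀ k l, contract (wedge (U 0) k) (wedge (U 0) l) Rm
        = 4 * ∑ b, ∑ g, Rm k b l g * U 0 b * U 0 g := by
      intro k l
      rw [contract_wedge _ _ _ hC.anti₁]
      have k2 : ∀ b, ∑ c, ∑ g, Rm k b c g * U 0 b * wedge (U 0) l c g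
          = 2 * ∑ g, Rm k b l g * U 0 b * U 0 g := fun b =>
        sum_wedge (U 0) l fun c g => by rw [hC.anti₂ k b c g]; ring
      simp only [k2, ← Finset.mul_sum]
      ring
    have k3 : ∀ b g, Ric b g * U 0 b * U 0 g = ∑ k, ∑ l, thermoInv γi 0 u k l *
        (Rm k b l g * U 0 b * U 0 g) := by
      intro b g
      rw [hRic, ric, Finset.sum_mul, Finset.sum_mul]
      refine Finset.sum_congr rfl fun k _ => ?_
      rw [Finset.sum_mul, Finset.sum_mul]
      exact Finset.sum_congr rfl fun l _ => by rw [hC.anti₁ b k, hC.anti₂ k b g l]; ring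
    simp only [k1, hFdef, k3, Finset.mul_sum]
    symm
    calc _ = ∑ b, ∑ k, ∑ g, ∑ l, 4 * (thermoInv γi 0 u k l * (Rm k b l g * U 0 b * U 0 g)) :=
          Finset.sum_congr rfl fun _ _ => Finset.sum_comm
      _ = ∑ k, ∑ b, ∑ g, ∑ l, 4 * (thermoInv γi 0 u k l * (Rm k b l g * U 0 b * U 0 g)) :=
          Finset.sum_comm
      _ = ∑ k, ∑ b, ∑ l, ∑ g, 4 * (thermoInv γi 0 u k l * (Rm k b l g * U 0 b * U 0 g)) :=
          Finset.sum_congr rfl fun _ _ => Finset.sum_congr rfl fun _ _ => Finset.sum_comm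
      _ = ∑ k, ∑ l, ∑ b, ∑ g, 4 * (thermoInv γi 0 u k l * (Rm k b l g * U 0 b * U 0 g)) :=
          Finset.sum_congr rfl fun _ _ => Finset.sum_comm
      _ = _ := Finset.sum_congr rfl fun _ _ => Finset.sum_congr rfl fun _ _ =>
          Finset.sum_congr rfl fun _ _ => Finset.sum_congr rfl fun _ _ => by ring
  simp only [contract_add, contract_sub, contract_mul, hq, b1, b2, b3, b4, c1, c2, c3, c4, hw0,
    hw1, hw2]
  ring

end IsFlow

end HeatContraction

/-! ### The reaction terms in components -/

section Components

variable {𝒜 : Type*} [CommRing 𝒜] {n : ℕ}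

/-- The reaction terms, in components: `h` is the inverse metric, `Rm`, `P` and `Mt` are the components
of a space-time curvature tensor with no, one and two time indices, and `W`, `V` are the components
of a bivector. -/
def reactionForm (h : Fin n → Fin n → 𝒜) (Rm : Fin n → Fin n → Fin n → Fin n → 𝒜)
    (P : Fin n → Fin n → Fin n → 𝒜) (Mt : Fin n → Fin n → 𝒜) (W : Fin n → 𝒜)
    (V : Fin n → Fin n → 𝒜) : 𝒜 :=
  2 * (∑ i, ∑ j, ∑ k, ∑ l, Rm i k j l * (∑ p, ∑ q, h k p * h l q * Mt p q) * W i * W j)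
    - 2 * (∑ i, ∑ j, ∑ k, ∑ l, P i k l * (∑ p, ∑ q, h l p * h k q * P j p q) * W i * W j)
    + 8 * (∑ i, ∑ j, ∑ k, ∑ l, ∑ m,
        Rm i l k m * (∑ p, ∑ q, h l p * h m q * P p j q) * V i j * W k)
    + 4 * (∑ i, ∑ j, ∑ k, ∑ l, ∑ m, ∑ n,
        Rm i m k n * (∑ p, ∑ q, h m p * h n q * Rm j p l q) * V i j * V k l)
    + ∑ i, ∑ j, ∑ k, ∑ l, h i k * h j l * ((∑ m, P i j m * W m) + ∑ m, ∑ n, Rm i j m n * V m n)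
        * ((∑ m, P k l m * W m) + ∑ m, ∑ n, Rm k l m n * V m n)

theorem sum_antisymm_split {U X : Fin (n + 1) → Fin (n + 1) → 𝒜} (hU : ∀ a b, U a b = -U b a)
    (hU0 : U 0 0 = 0) : ∑ a, ∑ b, X a b * U a b = ∑ i : Fin n, ∑ j : Fin n,
      X i.succ j.succ * U i.succ j.succ + ∑ j : Fin n, (X 0 j.succ - X j.succ 0) * U 0 j.succ := by
  rw [Fin.sum_univ_succ]
  simp only [Fin.sum_univ_succ (f := fun b => X _ b * U _ b), hU0, mul_zero, zero_add,
    Finset.sum_add_distrib, sub_mul, Finset.sum_sub_distrib]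
  have : ∑ i : Fin n, X i.succ 0 * U i.succ 0 = -∑ i : Fin n, X i.succ 0 * U 0 i.succ := by
    rw [← Finset.sum_neg_distrib]
    exact Finset.sum_congr rfl fun i _ => by rw [hU i.succ 0]; ring
  rw [this]
  ring

/-- The quadratic terms on space-time in components, for a degenerate inverse metric `H` with
space components `h`. -/
theorem reactionForm_eq {H : Fin (n + 1) → Fin (n + 1) → 𝒜} {h : Fin n → Fin n → 𝒜}
    (hH : ∀ a, H 0 a = 0) (hH' : ∀ a, H a 0 = 0) (hHs : ∀ i j : Fin n, H i.succ j.succ = h i j)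
    (hsymm : ∀ i j, h i j = h j i)
    {R : Fin (n + 1) → Fin (n + 1) → Fin (n + 1) → Fin (n + 1) → 𝒜}
    (anti₁ : ∀ a b c f, R a b c f = -R b a c f) (anti₂ : ∀ a b c f, R a b c f = -R a b f c)
    (pair : ∀ a b c f, R a b c f = R c f a b)
    {U : Fin (n + 1) → Fin (n + 1) → 𝒜} (hU : ∀ a b, U a b = -U b a) (hU0 : U 0 0 = 0) :
    ∑ e, ∑ f, ∑ m, ∑ p, H e f * H m p * (curvOp R U f p * curvOp R U e m)
        + 4 * contract U U (curvSharp H R) =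
      reactionForm h (fun i j k l => R i.succ j.succ k.succ l.succ)
        (fun i j k => R i.succ j.succ 0 k.succ) (fun i j => R 0 i.succ 0 j.succ)
        (fun i => 2 * U 0 i.succ) (fun i j => U i.succ j.succ) := by
  have tr : ∀ X : Fin (n + 1) → Fin (n + 1) → 𝒜, ∑ k, ∑ l, H k l * X k l
      = ∑ k : Fin n, ∑ l : Fin n, h k l * X k.succ l.succ := by
    intro X
    simp [Fin.sum_univ_succ, hH, hH', hHs]
  have tr2 : ∀ X : Fin (n + 1) → Fin (n + 1) → Fin (n + 1) → Fin (n + 1) → 𝒜,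
      ∑ e, ∑ f, ∑ m, ∑ p, H e f * H m p * X e f m p = ∑ e : Fin n, ∑ f : Fin n, ∑ m : Fin n,
        ∑ p : Fin n, h e f * h m p * X e.succ f.succ m.succ p.succ := by
    intro X
    simp only [mul_assoc, ← Finset.mul_sum]
    rw [tr (fun e f => ∑ m, ∑ p, H m p * X e f m p)]
    simp only [tr]
  set F := curvSharp H R with hFdef
  have hF : ∀ a b c g, F a b c g = ∑ e : Fin n, ∑ m : Fin n, ∑ f : Fin n, ∑ p : Fin n,
      h e f * h m p * (R a f.succ c p.succ * R b e.succ g m.succ) := by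
    intro a b c g
    rw [hFdef, curvSharp, tr2 (fun e f m p => R a f c p * R b e g m)]
    exact Finset.sum_congr rfl fun _ _ => Finset.sum_comm
  have F1 : ∀ a b c g, F a b c g = F b a g c := by
    intro a b c g
    rw [hFdef, curvSharp, curvSharp, tr2, tr2]
    calc _ = ∑ f : Fin n, ∑ e : Fin n, ∑ p : Fin n, ∑ m : Fin n, h e f * h m p *
          (R a f.succ c p.succ * R b e.succ g m.succ) := by
            rw [Finset.sum_comm]
            exact Finset.sum_congr rfl fun _ _ => Finset.sum_congr rfl fun _ _ => Finset.sum_comm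
      _ = _ := Finset.sum_congr rfl fun f _ => Finset.sum_congr rfl fun e _ =>
          Finset.sum_congr rfl fun p _ => Finset.sum_congr rfl fun m _ => by
            rw [hsymm e f, hsymm m p]; ring
  have F2 : ∀ a b c g, F a b c g = F c g a b := by
    intro a b c g
    rw [hF, hF, Finset.sum_comm]
    refine Finset.sum_congr rfl fun m _ => Finset.sum_congr rfl fun e _ => ?_
    rw [Finset.sum_comm]
    exact Finset.sum_congr rfl fun p _ => Finset.sum_congr rfl fun f _ => by
      rw [pair a, pair b]; ring
  have split := fun X : Fin (n + 1) → Fin (n + 1) → 𝒜 => sum_antisymm_split (X := X) hU hU0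
  -- the terms of `contract U U F` by the number of time indices
  have hsharp : contract U U F =
      ∑ i : Fin n, ∑ j : Fin n, ∑ k : Fin n, ∑ l : Fin n,
        F i.succ j.succ k.succ l.succ * U i.succ j.succ * U k.succ l.succ
      + 4 * ∑ i : Fin n, ∑ j : Fin n, ∑ k : Fin n,
        F i.succ j.succ 0 k.succ * U i.succ j.succ * U 0 k.succ
      + 2 * ∑ i : Fin n, ∑ j : Fin n,
        (F 0 i.succ 0 j.succ - F 0 i.succ j.succ 0) * U 0 i.succ * U 0 j.succ := by
    set G : Fin (n + 1) → Fin (n + 1) → 𝒜 := fun a b => ∑ c, ∑ g, F a b c g * U c g with hG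
    have hGa : ∀ a b, G a b = -G b a := by
      intro a b
      simp only [hG, ← Finset.sum_neg_distrib]
      rw [Finset.sum_comm]
      exact Finset.sum_congr rfl fun c _ => Finset.sum_congr rfl fun g _ => by
        rw [F1, hU g c]; ring
    have h1 : contract U U F = ∑ a, ∑ b, G a b * U a b := by
      simp only [contract, hG, Finset.sum_mul]
      exact Finset.sum_congr rfl fun _ _ => Finset.sum_congr rfl fun _ _ =>
        Finset.sum_congr rfl fun _ _ => Finset.sum_congr rfl fun _ _ => by ring
    have h2 : ∀ a b, G a b = ∑ k : Fin n, ∑ l : Fin n, F a b k.succ l.succ * U k.succ l.succ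
        + ∑ l : Fin n, (F a b 0 l.succ - F a b l.succ 0) * U 0 l.succ := fun a b => split _
    have h3 : ∑ i : Fin n, ∑ j : Fin n, ∑ k : Fin n,
        F i.succ j.succ k.succ 0 * U i.succ j.succ * U 0 k.succ
        = -∑ i : Fin n, ∑ j : Fin n, ∑ k : Fin n,
          F i.succ j.succ 0 k.succ * U i.succ j.succ * U 0 k.succ := by
      simp only [← Finset.sum_neg_distrib]
      rw [Finset.sum_comm]
      exact Finset.sum_congr rfl fun j _ => Finset.sum_congr rfl fun i _ =>
        Finset.sum_congr rfl fun k _ => by rw [F1, hU i.succ]; ring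
    have h4 : ∑ j : Fin n, ∑ k : Fin n, ∑ l : Fin n,
        F 0 j.succ k.succ l.succ * U k.succ l.succ * U 0 j.succ
        = ∑ i : Fin n, ∑ j : Fin n, ∑ k : Fin n,
          F i.succ j.succ 0 k.succ * U i.succ j.succ * U 0 k.succ := by
      rw [Finset.sum_comm]
      refine Finset.sum_congr rfl fun k _ => ?_
      rw [Finset.sum_comm]
      exact Finset.sum_congr rfl fun l _ => Finset.sum_congr rfl fun j _ => by rw [F2]
    rw [h1, split]
    have h5 : ∑ j : Fin n, (G 0 j.succ - G j.succ 0) * U 0 j.succ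
        = 2 * ∑ j : Fin n, G 0 j.succ * U 0 j.succ := by
      rw [Finset.mul_sum]
      exact Finset.sum_congr rfl fun j _ => by rw [hGa j.succ 0]; ring
    have h6 : ∑ i : Fin n, ∑ j : Fin n, G i.succ j.succ * U i.succ j.succ
        = ∑ i : Fin n, ∑ j : Fin n, ∑ k : Fin n, ∑ l : Fin n,
            F i.succ j.succ k.succ l.succ * U i.succ j.succ * U k.succ l.succ
          + ∑ i : Fin n, ∑ j : Fin n, ∑ k : Fin n,
            F i.succ j.succ 0 k.succ * U i.succ j.succ * U 0 k.succ
          - ∑ i : Fin n, ∑ j : Fin n, ∑ k : Fin n,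
            F i.succ j.succ k.succ 0 * U i.succ j.succ * U 0 k.succ := by
      simp only [h2, ← Finset.sum_add_distrib, ← Finset.sum_sub_distrib]
      refine Finset.sum_congr rfl fun i _ => Finset.sum_congr rfl fun j _ => ?_
      rw [Finset.sum_mul]
      refine Finset.sum_congr rfl fun k _ => ?_
      have : ∑ l : Fin n, F i.succ j.succ k.succ l.succ * U i.succ j.succ * U k.succ l.succ
          = (∑ l : Fin n, F i.succ j.succ k.succ l.succ * U k.succ l.succ) * U i.succ j.succ := by
        rw [Finset.sum_mul]
        exact Finset.sum_congr rfl fun l _ => by ring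
      rw [this]
      ring
    have h7 : ∑ j : Fin n, G 0 j.succ * U 0 j.succ = ∑ j : Fin n, ∑ k : Fin n, ∑ l : Fin n,
          F 0 j.succ k.succ l.succ * U k.succ l.succ * U 0 j.succ
        + ∑ i : Fin n, ∑ j : Fin n,
        (F 0 i.succ 0 j.succ - F 0 i.succ j.succ 0) * U 0 i.succ * U 0 j.succ := by
      rw [← Finset.sum_add_distrib]
      refine Finset.sum_congr rfl fun i _ => ?_
      rw [← Finset.sum_add_distrib, h2, ← Finset.sum_add_distrib, Finset.sum_mul]
      refine Finset.sum_congr rfl fun k _ => ?_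
      rw [← Finset.sum_mul]
      ring
    rw [h5, h6, h7, h3, h4]
    ring
  have hQ : ∀ i j : Fin n, curvOp R U i.succ j.succ
      = ∑ m : Fin n, R i.succ j.succ 0 m.succ * (2 * U 0 m.succ)
        + ∑ m : Fin n, ∑ l : Fin n, R i.succ j.succ m.succ l.succ * U m.succ l.succ := by
    intro i j
    rw [curvOp, split (fun c g => R i.succ j.succ c g), add_comm]
    congr 1
    exact Finset.sum_congr rfl fun m _ => by rw [anti₂ _ _ m.succ 0]; ring
  have t1 : ∑ e, ∑ f, ∑ m, ∑ p, H e f * H m p * (curvOp R U f p * curvOp R U e m) =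
      ∑ i : Fin n, ∑ j : Fin n, ∑ k : Fin n, ∑ l : Fin n, h i k * h j l *
        curvOp R U i.succ j.succ * curvOp R U k.succ l.succ := by
    rw [tr2 (fun e f m p => curvOp R U f p * curvOp R U e m)]
    refine Finset.sum_congr rfl fun e _ => ?_
    rw [Finset.sum_comm]
    exact Finset.sum_congr rfl fun m _ => Finset.sum_congr rfl fun f _ =>
      Finset.sum_congr rfl fun p _ => by ring
  have t2 : ∑ i : Fin n, ∑ j : Fin n, ∑ k : Fin n, ∑ l : Fin n,
        F i.succ j.succ k.succ l.succ * U i.succ j.succ * U k.succ l.succ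
      = ∑ i : Fin n, ∑ j : Fin n, ∑ k : Fin n, ∑ l : Fin n, ∑ m : Fin n, ∑ r : Fin n,
        R i.succ m.succ k.succ r.succ * (∑ p : Fin n, ∑ q : Fin n,
          h m p * h r q * R j.succ p.succ l.succ q.succ) * U i.succ j.succ * U k.succ l.succ := by
    refine Finset.sum_congr rfl fun i _ => Finset.sum_congr rfl fun j _ =>
      Finset.sum_congr rfl fun k _ => Finset.sum_congr rfl fun l _ => ?_
    rw [F1, hFdef, ← hFdef, F1 j.succ, F1 i.succ, hF]
    simp only [Finset.sum_mul, Finset.mul_sum]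
    exact Finset.sum_congr rfl fun _ _ => Finset.sum_congr rfl fun _ _ =>
      Finset.sum_congr rfl fun _ _ => Finset.sum_congr rfl fun _ _ => by ring
  have t3 : 2 * ∑ i : Fin n, ∑ j : Fin n, ∑ k : Fin n,
        F i.succ j.succ 0 k.succ * U i.succ j.succ * U 0 k.succ
      = ∑ i : Fin n, ∑ j : Fin n, ∑ k : Fin n, ∑ l : Fin n, ∑ m : Fin n,
        R i.succ l.succ k.succ m.succ * (∑ p : Fin n, ∑ q : Fin n,
          h l p * h m q * R p.succ j.succ 0 q.succ) * U i.succ j.succ * (2 * U 0 k.succ) := by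
    rw [Finset.sum_comm]
    simp only [Finset.mul_sum]
    refine Finset.sum_congr rfl fun j _ => Finset.sum_congr rfl fun i _ =>
      Finset.sum_congr rfl fun k _ => ?_
    rw [hF, hU i.succ]
    simp only [Finset.sum_mul, Finset.mul_sum]
    exact Finset.sum_congr rfl fun l _ => Finset.sum_congr rfl fun m _ =>
      Finset.sum_congr rfl fun p _ => Finset.sum_congr rfl fun q _ => by
        rw [anti₁ i.succ p.succ]; ring
  have t4 : 4 * ∑ i : Fin n, ∑ j : Fin n, F 0 i.succ 0 j.succ * U 0 i.succ * U 0 j.succ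
      = ∑ i : Fin n, ∑ j : Fin n, ∑ k : Fin n, ∑ l : Fin n, R i.succ k.succ j.succ l.succ *
        (∑ p : Fin n, ∑ q : Fin n, h k p * h l q * R 0 p.succ 0 q.succ) * (2 * U 0 i.succ)
          * (2 * U 0 j.succ) := by
    simp only [Finset.mul_sum]
    refine Finset.sum_congr rfl fun i _ => Finset.sum_congr rfl fun j _ => ?_
    rw [hF]
    simp only [Finset.sum_mul, Finset.mul_sum]
    exact Finset.sum_congr rfl fun l _ => Finset.sum_congr rfl fun m _ =>
      Finset.sum_congr rfl fun p _ => Finset.sum_congr rfl fun q _ => by ring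
  have t5 : 4 * ∑ i : Fin n, ∑ j : Fin n, F 0 i.succ j.succ 0 * U 0 i.succ * U 0 j.succ
      = ∑ i : Fin n, ∑ j : Fin n, ∑ k : Fin n, ∑ l : Fin n, R i.succ k.succ 0 l.succ *
        (∑ p : Fin n, ∑ q : Fin n, h l p * h k q * R j.succ p.succ 0 q.succ) * (2 * U 0 i.succ)
          * (2 * U 0 j.succ) := by
    simp only [Finset.mul_sum]
    refine Finset.sum_congr rfl fun i _ => Finset.sum_congr rfl fun j _ => ?_
    rw [F2, hF]
    simp only [Finset.sum_mul, Finset.mul_sum]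
    rw [Finset.sum_comm]
    exact Finset.sum_congr rfl fun l _ => Finset.sum_congr rfl fun m _ =>
      Finset.sum_congr rfl fun p _ => Finset.sum_congr rfl fun q _ => by
        rw [pair 0]; ring
  rw [hsharp, t1, reactionForm]
  simp only [← hQ, ← t2, ← t3, ← t4, ← t5, sub_mul, Finset.sum_sub_distrib]
  ring

end Components

/-! ### The algebra of smooth functions on a set -/

noncomputable section SmoothFunctions

variable {W W₁ W₂ : Type*} [NormedAddCommGroup W] [NormedSpace ℝ W] [NormedAddCommGroup W₁]
  [NormedSpace ℝ W₁] [NormedAddCommGroup W₂] [NormedSpace ℝ W₂]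

/-- A set on which one-sided calculus works: derivatives within `D` are unique, and second
derivatives are symmetric since `D` is contained in the closure of its interior. -/
structure IsRegularDomain (D : Set W) : Prop where
  uniqueDiffOn : UniqueDiffOn ℝ D
  subset_closure : D ⊆ closure (interior D)

theorem IsRegularDomain.of_convex {D : Set W} (hD : Convex ℝ D) (h : (interior D).Nonempty) :
    IsRegularDomain D :=
  ⟨uniqueDiffOn_convex hD h, by
    rw [hD.closure_interior_eq_closure_of_nonempty_interior h]; exact _root_.subset_closure⟩

theorem IsRegularDomain.inter {D V : Set W} (hD : IsRegularDomain D) (hV : IsOpen V) :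
    IsRegularDomain (D ∩ V) := by
  refine ⟨hD.uniqueDiffOn.inter hV, ?_⟩
  rw [interior_inter, hV.interior_eq, Set.inter_comm, Set.inter_comm _ V]
  exact fun x hx => hV.inter_closure ⟨hx.1, hD.subset_closure hx.2⟩

/-- The extension by zero of a function on `D`. -/
def ext₀ {D : Set W} (f : D → ℝ) : W → ℝ := Function.extend Subtype.val f 0

theorem ext₀_coe {D : Set W} (f : D → ℝ) (x : D) : ext₀ f x = f x :=
  Subtype.val_injective.extend_apply f 0 x

/-- The smooth functions on `D`, as a subalgebra of all functions on `D`. The extension by zero makes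
`ContDiffOn` applicable; which extension is taken does not matter for smoothness within `D`. -/
def smoothSubalgebra (D : Set W) : Subalgebra ℝ (D → ℝ) where
  carrier := {f | ContDiffOn ℝ ∞ (ext₀ f) D}
  mul_mem' {f g} hf hg := (ContDiffOn.mul hf hg).congr fun x hx => by
    exact (ext₀_coe (f * g) ⟨x, hx⟩).trans
      (congrArg₂ (· * ·) (ext₀_coe f ⟨x, hx⟩) (ext₀_coe g ⟨x, hx⟩)).symm
  add_mem' {f g} hf hg := (ContDiffOn.add hf hg).congr fun x hx => by
    exact (ext₀_coe (f + g) ⟨x, hx⟩).trans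
      (congrArg₂ (· + ·) (ext₀_coe f ⟨x, hx⟩) (ext₀_coe g ⟨x, hx⟩)).symm
  algebraMap_mem' r := (contDiffOn_const (c := r)).congr fun x hx => ext₀_coe _ ⟨x, hx⟩

/-- The algebra of smooth functions on `D`. It is a type of its own, to keep the search for algebra
instances short. -/
def smoothAlg (D : Set W) : Type _ := ↥(smoothSubalgebra D)

instance (D : Set W) : CommRing (smoothAlg D) := inferInstanceAs (CommRing (smoothSubalgebra D))

instance (D : Set W) : Algebra ℝ (smoothAlg D) :=
  inferInstanceAs (Algebra ℝ (smoothSubalgebra D))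

variable {D : Set W}

/-- The restriction to `D` of a function which is smooth on `D`. -/
def smoothAlg.mk (F : W → ℝ) (hF : ContDiffOn ℝ ∞ F D) : smoothAlg D :=
  ⟨fun x => F x, hF.congr fun x hx => ext₀_coe _ ⟨x, hx⟩⟩

namespace smoothAlg

theorem contDiffOn (f : smoothAlg D) : ContDiffOn ℝ ∞ (ext₀ f.1) D := f.2

theorem contDiffOn_of_eq (f : smoothAlg D) {F : W → ℝ} (h : ∀ x : D, F x = f.1 x) :
    ContDiffOn ℝ ∞ F D :=
  (contDiffOn f).congr fun x hx => (h ⟨x, hx⟩).trans (ext₀_coe _ ⟨x, hx⟩).symm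

@[ext] theorem ext {f g : smoothAlg D} (h : ∀ x, f.1 x = g.1 x) : f = g :=
  Subtype.ext (funext h)

/-- Evaluation at a point. -/
def eval (x : D) : smoothAlg D →ₐ[ℝ] ℝ :=
  (Pi.evalAlgHom ℝ (fun _ : D => ℝ) x).comp (smoothSubalgebra D).val

theorem eval_apply (x : D) (f : smoothAlg D) : eval x f = f.1 x := rfl

@[simp] theorem add_val (f g : smoothAlg D) (x : D) : (f + g).1 x = f.1 x + g.1 x := rfl

@[simp] theorem sub_val (f g : smoothAlg D) (x : D) : (f - g).1 x = f.1 x - g.1 x := rfl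

@[simp] theorem mul_val (f g : smoothAlg D) (x : D) : (f * g).1 x = f.1 x * g.1 x := rfl

@[simp] theorem sum_val {κ : Type*} (s : Finset κ) (f : κ → smoothAlg D) (x : D) :
    (∑ i ∈ s, f i).1 x = ∑ i ∈ s, (f i).1 x := map_sum (eval x) f s

theorem isUnit_of_ne_zero {f : smoothAlg D} (h : ∀ x, f.1 x ≠ 0) : IsUnit f := by
  refine IsUnit.of_mul_eq_one (mk (fun x => (ext₀ f.1 x)⁻¹) ((contDiffOn f).inv fun x hx => ?_)) ?_
  · exact (ext₀_coe f.1 ⟨x, hx⟩).trans_ne (h _)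
  · ext x
    change f.1 x * (ext₀ f.1 x)⁻¹ = 1
    rw [ext₀_coe, mul_inv_cancel₀ (h x)]

/-- The derivative in the direction `v`. -/
def deriv (hD : UniqueDiffOn ℝ D) (v : W) : Derivation ℝ (smoothAlg D) (smoothAlg D) :=
  Derivation.mk' (R := ℝ) (A := smoothAlg D) (M := smoothAlg D)
    { toFun := fun f => mk (fun x => fderivWithin ℝ (ext₀ f.1) D x v)
        (((contDiffOn f).fderivWithin hD (m := ∞) (by simp)).clm_apply contDiffOn_const)
      map_add' := fun f g => by
        ext x
        have hf := (contDiffOn f).differentiableOn (by simp) x x.2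
        have hg := (contDiffOn g).differentiableOn (by simp) x x.2
        change fderivWithin ℝ (ext₀ (f + g).1) D x v = fderivWithin ℝ (ext₀ f.1) D x v
          + fderivWithin ℝ (ext₀ g.1) D x v
        rw [← add_apply, ← fderivWithin_add (hD x x.2) hf hg]
        congr 1
        refine fderivWithin_congr' (fun y hy => ?_) x.2
        rw [Pi.add_apply, ext₀_coe _ ⟨y, hy⟩, ext₀_coe _ ⟨y, hy⟩, ext₀_coe _ ⟨y, hy⟩]
        rfl
      map_smul' := fun r f => by
        ext x
        have hf := (contDiffOn f).differentiableOn (by simp) x x.2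
        change fderivWithin ℝ (ext₀ (r • f).1) D x v = r * fderivWithin ℝ (ext₀ f.1) D x v
        rw [← smul_eq_mul, ← smul_apply, ← fderivWithin_const_smul (hD x x.2) hf]
        congr 1
        refine fderivWithin_congr' (fun y hy => ?_) x.2
        rw [Pi.smul_apply, ext₀_coe _ ⟨y, hy⟩, ext₀_coe _ ⟨y, hy⟩]
        rfl }
    (fun f g => by
      ext x
      have hf := (contDiffOn f).differentiableOn (by simp) x x.2
      have hg := (contDiffOn g).differentiableOn (by simp) x x.2
      change fderivWithin ℝ (ext₀ (f * g).1) D x v = f.1 x * fderivWithin ℝ (ext₀ g.1) D x v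
        + g.1 x * fderivWithin ℝ (ext₀ f.1) D x v
      rw [← ext₀_coe f.1 x, ← ext₀_coe g.1 x]
      have := fderivWithin_mul (hD x x.2) hf hg
      have h2 := congrArg (fun L => L v) this
      simp only [add_apply, smul_apply, smul_eq_mul] at h2
      rw [← h2]
      congr 1
      refine fderivWithin_congr' (fun y hy => ?_) x.2
      rw [Pi.mul_apply, ext₀_coe _ ⟨y, hy⟩, ext₀_coe _ ⟨y, hy⟩, ext₀_coe _ ⟨y, hy⟩]
      rfl)

theorem deriv_apply (hD : UniqueDiffOn ℝ D) (v : W) (f : smoothAlg D) (x : D) :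
    (deriv hD v f).1 x = fderivWithin ℝ (ext₀ f.1) D x v := rfl

theorem deriv_apply_of_eq (hD : UniqueDiffOn ℝ D) (v : W) (f : smoothAlg D) {F : W → ℝ}
    (h : ∀ x : D, F x = f.1 x) (x : D) : (deriv hD v f).1 x = fderivWithin ℝ F D x v := by
  rw [deriv_apply]
  congr 1
  exact fderivWithin_congr' (fun y hy => (ext₀_coe _ ⟨y, hy⟩).trans (h ⟨y, hy⟩).symm) x.2

theorem two_le_infty : (2 : WithTop ℕ∞) ≤ ∞ :=
  WithTop.coe_le_coe.2 (le_top : (2 : ℕ∞) ≤ ⊤)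

theorem deriv_comm (hD : IsRegularDomain D) (v w : W) (f : smoothAlg D) :
    deriv hD.uniqueDiffOn v (deriv hD.uniqueDiffOn w f)
      = deriv hD.uniqueDiffOn w (deriv hD.uniqueDiffOn v f) := by
  have key : ∀ v w, ∀ x : D, (deriv hD.uniqueDiffOn v (deriv hD.uniqueDiffOn w f)).1 x
      = fderivWithin ℝ (fderivWithin ℝ (ext₀ f.1) D) D x v w := by
    intro v w x
    rw [deriv_apply_of_eq (F := fun x => fderivWithin ℝ (ext₀ f.1) D x w) _ _ _ (fun x => rfl)]
    have h := ((contDiffOn f).fderivWithin hD.uniqueDiffOn (m := ∞) (by simp)).differentiableOn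
      (by simp) x x.2
    rw [fderivWithin_clm_apply (hD.uniqueDiffOn x x.2) h (differentiableWithinAt_const w)]
    simp
  ext x
  rw [key, key]
  exact ((contDiffOn f) x x.2).isSymmSndFDerivWithinAt (by simpa using two_le_infty)
    hD.uniqueDiffOn (hD.subset_closure x.2) x.2 v w

variable {D₁ : Set W₁} {D₂ : Set W₂}

/-- Composition with a smooth map. -/
def pullback (φ : W₁ → W₂) (hφ : ContDiff ℝ ∞ φ) (hm : Set.MapsTo φ D₁ D₂) :
    smoothAlg D₂ →ₐ[ℝ] smoothAlg D₁ where
  toFun f := mk (fun x => ext₀ f.1 (φ x)) ((contDiffOn f).comp hφ.contDiffOn hm)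
  map_one' := by ext x; exact ext₀_coe _ ⟨φ x, hm x.2⟩
  map_zero' := by ext x; exact ext₀_coe _ ⟨φ x, hm x.2⟩
  map_mul' f g := by
    ext x
    change ext₀ (f * g).1 (φ x) = ext₀ f.1 (φ x) * ext₀ g.1 (φ x)
    rw [ext₀_coe _ ⟨φ x, hm x.2⟩, ext₀_coe _ ⟨φ x, hm x.2⟩, ext₀_coe _ ⟨φ x, hm x.2⟩]; rfl
  map_add' f g := by
    ext x
    change ext₀ (f + g).1 (φ x) = ext₀ f.1 (φ x) + ext₀ g.1 (φ x)
    rw [ext₀_coe _ ⟨φ x, hm x.2⟩, ext₀_coe _ ⟨φ x, hm x.2⟩, ext₀_coe _ ⟨φ x, hm x.2⟩]; rfl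
  commutes' r := by ext x; exact ext₀_coe _ ⟨φ x, hm x.2⟩

theorem pullback_apply (φ : W₁ → W₂) (hφ : ContDiff ℝ ∞ φ) (hm : Set.MapsTo φ D₁ D₂)
    (f : smoothAlg D₂) (x : D₁) : (pullback φ hφ hm f).1 x = f.1 ⟨φ x, hm x.2⟩ :=
  ext₀_coe _ ⟨φ x, hm x.2⟩

theorem pullback_deriv (φ : W₁ → W₂) (hφ : ContDiff ℝ ∞ φ) (hm : Set.MapsTo φ D₁ D₂)
    (hD₁ : UniqueDiffOn ℝ D₁) (hD₂ : UniqueDiffOn ℝ D₂) {v : W₁} {w : W₂}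
    (hφ' : ∀ x, fderiv ℝ φ x v = w) (f : smoothAlg D₂) :
    pullback φ hφ hm (deriv hD₂ w f) = deriv hD₁ v (pullback φ hφ hm f) := by
  ext x
  rw [pullback_apply, deriv_apply, deriv_apply_of_eq (F := ext₀ f.1 ∘ φ) _ _ _ (fun x => rfl),
    fderivWithin_comp x.1 ((contDiffOn f).differentiableOn (by simp) _ (hm x.2))
      (hφ.differentiable (by simp) x.1).differentiableWithinAt hm (hD₁ x x.2),
    (hφ.differentiable (by simp) x.1).fderivWithin (hD₁ x x.2)]
  simp [hφ']

end smoothAlg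

end SmoothFunctions

/-! ### Naturality under algebra homomorphisms -/

section Naturality

variable {𝒜 ℬ ι : Type*} [CommRing 𝒜] [Algebra ℝ 𝒜] [CommRing ℬ] [Algebra ℝ ℬ] [Fintype ι]
  {d : ι → Derivation ℝ 𝒜 𝒜} {d' : ι → Derivation ℝ ℬ ℬ} {Γ : ι → ι → ι → 𝒜}
  {H : ι → ι → 𝒜} {R : ι → ι → ι → ι → 𝒜} {π : 𝒜 →ₐ[ℝ] ℬ}

theorem map_ric (a b : ι) : π (ric H R a b)
    = ric (fun a b => π (H a b)) (fun a b c f => π (R a b c f)) a b := by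
  simp [ric]

theorem map_sca : π (sca H R) = sca (fun a b => π (H a b)) (fun a b c f => π (R a b c f)) := by
  simp [sca, map_ric]

theorem map_curvUp (hπ : ∀ a x, π (d a x) = d' a (π x)) (a b c f : ι) :
    π (curvUp d Γ a b c f) = curvUp d' (fun a b c => π (Γ a b c)) a b c f := by
  simp [curvUp, hπ]

theorem map_cov₂ (hπ : ∀ a x, π (d a x) = d' a (π x)) (A : ι → ι → 𝒜) (c a b : ι) :
    π (cov₂ d Γ A c a b)
      = cov₂ d' (fun a b c => π (Γ a b c)) (fun a b => π (A a b)) c a b := by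
  simp [cov₂, hπ]

theorem map_cov₃ (hπ : ∀ a x, π (d a x) = d' a (π x)) (A : ι → ι → ι → 𝒜) (e a b c : ι) :
    π (cov₃ d Γ A e a b c)
      = cov₃ d' (fun a b c => π (Γ a b c)) (fun a b c => π (A a b c)) e a b c := by
  simp [cov₃, hπ]

theorem map_cov₄ (hπ : ∀ a x, π (d a x) = d' a (π x)) (A : ι → ι → ι → ι → 𝒜) (e a b c f : ι) :
    π (cov₄ d Γ A e a b c f)
      = cov₄ d' (fun a b c => π (Γ a b c)) (fun a b c f => π (A a b c f)) e a b c f := by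
  simp [cov₄, hπ]

theorem map_covTwice₄ (hπ : ∀ a x, π (d a x) = d' a (π x)) (A : ι → ι → ι → ι → 𝒜)
    (h e a b c f : ι) : π (covTwice₄ d Γ A h e a b c f)
      = covTwice₄ d' (fun a b c => π (Γ a b c)) (fun a b c f => π (A a b c f)) h e a b c f := by
  simp only [covTwice₄, map_sub, map_sum, map_mul, map_cov₄ hπ]

theorem map_contract (A B : ι → ι → 𝒜) (T : ι → ι → ι → ι → 𝒜) : π (contract A B T)
    = contract (fun a b => π (A a b)) (fun a b => π (B a b)) (fun a b c f => π (T a b c f)) := by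
  simp [contract]

theorem map_curvOp (U : ι → ι → 𝒜) (a b : ι) : π (curvOp R U a b)
    = curvOp (fun a b c f => π (R a b c f)) (fun a b => π (U a b)) a b := by
  simp [curvOp]

theorem map_curvSharp (a b c g : ι) : π (curvSharp H R a b c g)
    = curvSharp (fun a b => π (H a b)) (fun a b c f => π (R a b c f)) a b c g := by
  simp [curvSharp]

theorem map_half : π (half 𝒜) = half ℬ := π.commutes _

theorem IsCurvature.map (hπ : ∀ a x, π (d a x) = d' a (π x))
    (hd' : ∀ a b f, d' a (d' b f) = d' b (d' a f)) (hC : IsCurvature d Γ H R) :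
    IsCurvature d' (fun a b c => π (Γ a b c)) (fun a b => π (H a b))
      (fun a b c f => π (R a b c f)) where
  comm := hd'
  torsion a b c := by rw [hC.torsion]
  symm a b := by rw [hC.symm]
  parallel a b c := by
    have := congrArg π (hC.parallel a b c)
    simpa [hπ] using this
  raise a b c f := by
    have := congrArg π (hC.raise a b c f)
    simpa [hπ, map_curvUp hπ] using this
  anti₁ a b c f := by rw [hC.anti₁, map_neg]
  anti₂ a b c f := by rw [hC.anti₂, map_neg]
  pair a b c f := by rw [hC.pair]
  cyclic a b c f := by
    have := congrArg π (hC.cyclic a b c f)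
    simpa using this
  bianchi e a b c f := by
    have := congrArg π (hC.bianchi e a b c f)
    simpa only [map_add, map_cov₄ hπ, map_zero] using this

variable {n : ℕ} {d : Fin (n + 1) → Derivation ℝ 𝒜 𝒜} {d' : Fin (n + 1) → Derivation ℝ ℬ ℬ}
  {γ γi : Fin n → Fin n → 𝒜} {Γ : Fin n → Fin n → Fin n → 𝒜}
  {R : Fin n → Fin n → Fin n → Fin n → 𝒜} {τ ε u : 𝒜}

theorem IsFlow.map (hπ : ∀ a x, π (d a x) = d' a (π x))
    (hd' : ∀ a b f, d' a (d' b f) = d' b (d' a f)) (hF : IsFlow d γ γi Γ R τ) :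
    IsFlow d' (fun a b => π (γ a b)) (fun a b => π (γi a b)) (fun a b c => π (Γ a b c))
      (fun a b c f => π (R a b c f)) (π τ) := by
  have hs : ∀ i x, π (spatial d i x) = spatial d' i (π x) := fun i x => hπ i.succ x
  have h2 : π 2 = 2 := map_ofNat π 2
  exact
  { comm := hd'
    symm := fun i j => by rw [hF.symm]
    symm_inv := fun i j => by rw [hF.symm_inv]
    inv := fun i j => by
      have := congrArg π (hF.inv i j)
      simpa [apply_ite] using this
    torsion := fun i j k => by rw [hF.torsion]
    christoffel := fun i j k => by
      have := congrArg π (hF.christoffel i j k)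
      simpa [hs, h2] using this
    curv := fun i j k l => by
      have := congrArg π (hF.curv i j k l)
      simpa [map_curvUp hs] using this
    flow := fun i j => by
      have := congrArg π (hF.flow i j)
      simpa [hπ, map_ric, h2] using this
    time := by
      have := congrArg π hF.time
      simpa [hπ, h2] using this
    time_space := fun i => by
      rw [← hs, hF.time_space, map_zero] }

theorem map_thermoInv (a b : Fin (n + 1)) : π (thermoInv γi ε u a b)
    = thermoInv (fun a b => π (γi a b)) (π ε) (π u) a b := by
  cases a using Fin.cases <;> cases b using Fin.cases <;> simp [thermoInv]

theorem map_thermoConn (hπ : ∀ a x, π (d a x) = d' a (π x)) (a b c : Fin (n + 1)) :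
    π (thermoConn d γi Γ R τ ε u a b c) = thermoConn d' (fun a b => π (γi a b))
      (fun a b c => π (Γ a b c)) (fun a b c f => π (R a b c f)) (π τ) (π ε) (π u) a b c := by
  have hs : ∀ i x, π (spatial d i x) = spatial d' i (π x) := fun i x => hπ i.succ x
  have h2 : π 2 = 2 := map_ofNat π 2
  cases a using Fin.cases <;> cases b using Fin.cases <;> cases c using Fin.cases <;>
    simp [thermoConn, map_sca, map_ric, hπ, hs, map_half, h2]

end Naturality

/-! ### Coordinate formulas and smooth functions -/

noncomputable section Coordinates

variable {ι : Type} [Fintype ι] [DecidableEq ι] {S D : Set (ι → ℝ)}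

/-- The coordinate derivations on smooth functions. -/
def coord (hD : UniqueDiffOn ℝ D) (a : ι) : Derivation ℝ (smoothAlg D) (smoothAlg D) :=
  smoothAlg.deriv hD (Pi.single a 1)

variable (hS : ∃ V, IsOpen V ∧ D = S ∩ V) (hD : UniqueDiffOn ℝ D)

include hS in
theorem pd_eq_coord (a : ι) (f : smoothAlg D) {F : (ι → ℝ) → ℝ} (h : ∀ x : D, F x = f.1 x)
    (x : D) : pd S a F x = (coord hD a f).1 x := by
  obtain ⟨V, hV, rfl⟩ := hS
  rw [coord, smoothAlg.deriv_apply_of_eq hD _ f h, pd,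
    fderivWithin_inter (hV.mem_nhds x.2.2)]

variable {G : (ι → ℝ) → Matrix ι ι ℝ} {g H : ι → ι → smoothAlg D} {Γ : ι → ι → ι → smoothAlg D}
  {R : ι → ι → ι → ι → smoothAlg D}

theorem inv_eq_of_mul_eq (hG : ∀ (x : D) a b, G x a b = (g a b).1 x)
    (hgH : ∀ a b, ∑ m, g a m * H m b = if a = b then 1 else 0) (x : D) (a b : ι) :
    (G x)⁻¹ a b = (H a b).1 x := by
  have : (G x)⁻¹ = Matrix.of fun a b => (H a b).1 x := by
    refine Matrix.inv_eq_right_inv ?_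
    ext a b
    have := congrArg (smoothAlg.eval x) (hgH a b)
    simp only [map_sum, map_mul, apply_ite (smoothAlg.eval x), map_one, map_zero] at this
    simpa [Matrix.mul_apply, Matrix.one_apply, hG, smoothAlg.eval_apply] using this
  rw [this, Matrix.of_apply]

include hS in
theorem christoffel_eq_of_smooth (hG : ∀ (x : D) a b, G x a b = (g a b).1 x)
    (hgs : ∀ a b, g a b = g b a) (hHs : ∀ a b, H a b = H b a)
    (hgH : ∀ a b, ∑ m, g a m * H m b = if a = b then 1 else 0)
    (hΓ : ∀ a b c, 2 * ∑ m, g a m * Γ m b c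
      = coord hD b (g c a) + coord hD c (g b a) - coord hD a (g b c))
    (a b c : ι) (x : D) : christoffel G S a b c x = (Γ a b c).1 x := by
  have hd : ∀ m b c, pd S m (fun y => G y b c) x = (coord hD m (g b c)).1 x := fun m b c =>
    pd_eq_coord hS hD m (g b c) (fun y => hG y b c) x
  have e1 : ∑ m, H a m * (coord hD b (g c m) + coord hD c (g b m) - coord hD m (g b c))
      = 2 * Γ a b c := by
    simp only [← hΓ]
    simp only [mul_left_comm _ (2 : smoothAlg D), ← Finset.mul_sum]
    congr 1
    simp only [Finset.mul_sum, ← mul_assoc]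
    rw [Finset.sum_comm]
    simp only [← Finset.sum_mul]
    have : ∀ m, ∑ i, H a i * g i m = if m = a then 1 else 0 := by
      intro m
      rw [← hgH]
      exact Finset.sum_congr rfl fun i _ => by rw [hHs a i, hgs i m, mul_comm]
    simp [this]
  have e2 := congrArg (smoothAlg.eval x) e1
  simp only [map_sum, map_mul, map_sub, map_add, smoothAlg.eval_apply] at e2
  rw [christoffel]
  simp only [hd, inv_eq_of_mul_eq hG hgH x, e2]
  rw [show ((2 : smoothAlg D).1 x) = 2 from map_ofNat (smoothAlg.eval x) 2]
  ring

include hS in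
theorem riem_eq_of_smooth (hG : ∀ (x : D) a b, G x a b = (g a b).1 x)
    (hΓ : ∀ a b c (x : D), christoffel G S a b c x = (Γ a b c).1 x) (a b c f : ι) (x : D) :
    riem G S a b c f x = (∑ m, g f m * curvUp (coord hD) Γ a b c m).1 x := by
  have e2 : (∑ m, g f m * curvUp (coord hD) Γ a b c m).1 x
      = smoothAlg.eval x (∑ m, g f m * curvUp (coord hD) Γ a b c m) := rfl
  rw [e2, riem]
  simp only [curvUp, map_sum, map_mul, map_sub, map_add, smoothAlg.eval_apply, hG, hΓ,
    pd_eq_coord hS hD _ _ (hΓ _ _ _)]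

theorem ricci_eq_of_smooth (hH : ∀ (x : D) a b, (G x)⁻¹ a b = (H a b).1 x)
    (hR : ∀ a b c f (x : D), riem G S a b c f x = (R a b c f).1 x) (a b : ι) (x : D) :
    ricci G S a b x = (ric H R a b).1 x := by
  rw [ricci]
  simp [ric, hH, hR]

theorem scal_eq_of_smooth (hH : ∀ (x : D) a b, (G x)⁻¹ a b = (H a b).1 x)
    (hR : ∀ a b c f (x : D), riem G S a b c f x = (R a b c f).1 x) (x : D) :
    scal G S x = (sca H R).1 x := by
  have := fun a b => ricci_eq_of_smooth hH hR a b x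
  rw [scal]
  simp [sca, hH, this]

include hS in
theorem nablaCo₂_eq_of_smooth (hΓ : ∀ a b c (x : D), christoffel G S a b c x = (Γ a b c).1 x)
    {A : ι → ι → (ι → ℝ) → ℝ} {A' : ι → ι → smoothAlg D}
    (hA : ∀ a b (x : D), A a b x = (A' a b).1 x) (c a b : ι) (x : D) :
    nablaCo₂ G S A c a b x = (cov₂ (coord hD) Γ A' c a b).1 x := by
  rw [nablaCo₂]
  simp [cov₂, hΓ, hA, pd_eq_coord hS hD _ _ (hA _ _)]

include hS in
theorem nablaCo₃_eq_of_smooth (hΓ : ∀ a b c (x : D), christoffel G S a b c x = (Γ a b c).1 x)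
    {A : ι → ι → ι → (ι → ℝ) → ℝ} {A' : ι → ι → ι → smoothAlg D}
    (hA : ∀ a b c (x : D), A a b c x = (A' a b c).1 x) (e a b c : ι) (x : D) :
    nablaCo₃ G S A e a b c x = (cov₃ (coord hD) Γ A' e a b c).1 x := by
  rw [nablaCo₃]
  simp [cov₃, hΓ, hA, pd_eq_coord hS hD _ _ (hA _ _ _)]

include hS in
theorem hessian_eq_of_smooth (hΓ : ∀ a b c (x : D), christoffel G S a b c x = (Γ a b c).1 x)
    {F : (ι → ℝ) → ℝ} {f : smoothAlg D} (hF : ∀ x : D, F x = f.1 x) (a b : ι) (x : D) :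
    hessian G S F a b x
      = (coord hD a (coord hD b f) - ∑ m, Γ m a b * coord hD m f).1 x := by
  have h1 := fun b => pd_eq_coord hS hD b f hF
  rw [hessian]
  simp [hΓ, h1, pd_eq_coord hS hD _ _ (h1 b)]

end Coordinates

/-! ### The Leibniz rule for full contractions -/

noncomputable section Leibniz

variable {ι : Type} [Fintype ι] [DecidableEq ι] {S D : Set (ι → ℝ)}

theorem pd_mul {a : ι} {f g : (ι → ℝ) → ℝ} {x : ι → ℝ} (hx : UniqueDiffWithinAt ℝ S x)
    (hf : DifferentiableWithinAt ℝ f S x) (hg : DifferentiableWithinAt ℝ g S x) :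
    pd S a (fun y => f y * g y) x = pd S a f x * g x + f x * pd S a g x := by
  rw [pd, pd, pd]
  have h := congrArg (fun L => L (Pi.single a 1)) (fderivWithin_mul hx hf hg)
  simp only [add_apply, smul_apply, smul_eq_mul] at h
  rw [show (fun y => f y * g y) = f * g from rfl, h]
  ring

theorem pd_add {a : ι} {f g : (ι → ℝ) → ℝ} {x : ι → ℝ} (hx : UniqueDiffWithinAt ℝ S x)
    (hf : DifferentiableWithinAt ℝ f S x) (hg : DifferentiableWithinAt ℝ g S x) :
    pd S a (fun y => f y + g y) x = pd S a f x + pd S a g x := by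
  rw [pd, pd, pd, ← add_apply, ← fderivWithin_add hx hf hg]
  rfl

theorem pd_sum {κ : Type*} {s : Finset κ} {a : ι} {f : κ → (ι → ℝ) → ℝ} {x : ι → ℝ}
    (hx : UniqueDiffWithinAt ℝ S x) (hf : ∀ i, DifferentiableWithinAt ℝ (f i) S x) :
    pd S a (fun y => ∑ i ∈ s, f i y) x = ∑ i ∈ s, pd S a (f i) x := by
  classical
  simp only [pd]
  rw [fderivWithin_fun_sum hx fun i _ => hf i]
  simp

theorem pd_congr {a : ι} {f g : (ι → ℝ) → ℝ} {x : ι → ℝ} (h : ∀ᶠ y in nhdsWithin x S, f y = g y)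
    (hx : x ∈ S) : pd S a f x = pd S a g x := by
  rw [pd, pd, Filter.EventuallyEq.fderivWithin_eq_of_mem h hx]

theorem differentiableWithinAt_contract {A B : (ι → ℝ) → ι → ι → ℝ}
    {T : ι → ι → ι → ι → (ι → ℝ) → ℝ} {x : ι → ℝ}
    (hA : ∀ a b, DifferentiableWithinAt ℝ (fun y => A y a b) S x)
    (hB : ∀ a b, DifferentiableWithinAt ℝ (fun y => B y a b) S x)
    (hT : ∀ a b c g, DifferentiableWithinAt ℝ (T a b c g) S x) :
    DifferentiableWithinAt ℝ (fun y => contract (A y) (B y) (fun a b c g => T a b c g y)) S x :=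
  DifferentiableWithinAt.fun_sum fun a _ => DifferentiableWithinAt.fun_sum fun b _ =>
    DifferentiableWithinAt.fun_sum fun c _ => DifferentiableWithinAt.fun_sum fun g _ =>
      ((hT a b c g).fun_mul (hA a b)).fun_mul (hB c g)

theorem pd_contract {A B : (ι → ℝ) → ι → ι → ℝ} {T : ι → ι → ι → ι → (ι → ℝ) → ℝ} {x : ι → ℝ}
    (hx : UniqueDiffWithinAt ℝ S x)
    (hA : ∀ a b, DifferentiableWithinAt ℝ (fun y => A y a b) S x)
    (hB : ∀ a b, DifferentiableWithinAt ℝ (fun y => B y a b) S x)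
    (hT : ∀ a b c g, DifferentiableWithinAt ℝ (T a b c g) S x) (m : ι) :
    pd S m (fun y => contract (A y) (B y) (fun a b c g => T a b c g y)) x
      = contract (fun a b => pd S m (fun y => A y a b) x) (B x) (fun a b c g => T a b c g x)
        + contract (A x) (fun a b => pd S m (fun y => B y a b) x) (fun a b c g => T a b c g x)
        + contract (A x) (B x) (fun a b c g => pd S m (T a b c g) x) := by
  have h4 := fun a b c g => ((hT a b c g).fun_mul (hA a b)).fun_mul (hB c g)
  have h3 := fun a b c => DifferentiableWithinAt.fun_sum fun g (_ : g ∈ Finset.univ) => h4 a b c g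
  have h2 := fun a b => DifferentiableWithinAt.fun_sum fun c (_ : c ∈ Finset.univ) => h3 a b c
  have h1 := fun a => DifferentiableWithinAt.fun_sum fun b (_ : b ∈ Finset.univ) => h2 a b
  simp only [contract, ← Finset.sum_add_distrib]
  rw [pd_sum hx h1]
  refine Finset.sum_congr rfl fun a _ => ?_
  rw [pd_sum hx (h2 a)]
  refine Finset.sum_congr rfl fun b _ => ?_
  rw [pd_sum hx (h3 a b)]
  refine Finset.sum_congr rfl fun c _ => ?_
  rw [pd_sum hx (h4 a b c)]
  refine Finset.sum_congr rfl fun g _ => ?_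
  rw [pd_mul hx (f := fun y => T a b c g y * A y a b) ((hT a b c g).fun_mul (hA a b)) (hB c g),
    pd_mul hx (hT a b c g) (hA a b)]
  ring

theorem contract_christoffel_left (M : ι → ι → ℝ) (A B : ι → ι → ℝ) (T : ι → ι → ι → ι → ℝ) :
    contract (fun a b => ∑ e, (M a e * A e b + M b e * A a e)) B T
      = contract A B (fun a b c g => ∑ e, (M e a * T e b c g + M e b * T a e c g)) := by
  have hX : ∀ (A : ι → ι → ℝ) (T : ι → ι → ι → ι → ℝ),
      contract A B T = ∑ a, ∑ b, A a b * ∑ c, ∑ g, T a b c g * B c g := by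
    intro A T
    simp only [contract, Finset.mul_sum]
    exact Finset.sum_congr rfl fun _ _ => Finset.sum_congr rfl fun _ _ =>
      Finset.sum_congr rfl fun _ _ => Finset.sum_congr rfl fun _ _ => by ring
  have hT : ∀ a b, ∑ c, ∑ g, (∑ e, (M e a * T e b c g + M e b * T a e c g)) * B c g
      = ∑ e, (M e a * (∑ c, ∑ g, T e b c g * B c g) + M e b * ∑ c, ∑ g, T a e c g * B c g) := by
    intro a b
    simp only [Finset.mul_sum, ← Finset.sum_add_distrib, Finset.sum_mul]
    calc _ = ∑ c, ∑ e, ∑ g, (M e a * T e b c g + M e b * T a e c g) * B c g :=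
          Finset.sum_congr rfl fun _ _ => Finset.sum_comm
      _ = ∑ e, ∑ c, ∑ g, (M e a * T e b c g + M e b * T a e c g) * B c g := Finset.sum_comm
      _ = _ := Finset.sum_congr rfl fun _ _ => Finset.sum_congr rfl fun _ _ =>
          Finset.sum_congr rfl fun _ _ => by ring
  rw [hX, hX]
  simp only [hT]
  set X : ι → ι → ℝ := fun a b => ∑ c, ∑ g, T a b c g * B c g with hXdef
  change ∑ a, ∑ b, (∑ e, (M a e * A e b + M b e * A a e)) * X a b
    = ∑ a, ∑ b, A a b * ∑ e, (M e a * X e b + M e b * X a e)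
  simp only [Finset.sum_mul, Finset.mul_sum, mul_add, add_mul, Finset.sum_add_distrib]
  congr 1
  · calc _ = ∑ a, ∑ e, ∑ b, M a e * A e b * X a b :=
          Finset.sum_congr rfl fun _ _ => Finset.sum_comm
      _ = ∑ e, ∑ a, ∑ b, M a e * A e b * X a b := Finset.sum_comm
      _ = ∑ e, ∑ b, ∑ a, M a e * A e b * X a b :=
          Finset.sum_congr rfl fun _ _ => Finset.sum_comm
      _ = _ := Finset.sum_congr rfl fun _ _ => Finset.sum_congr rfl fun _ _ =>
          Finset.sum_congr rfl fun _ _ => by ring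
  · calc _ = ∑ a, ∑ e, ∑ b, M b e * A a e * X a b :=
          Finset.sum_congr rfl fun _ _ => Finset.sum_comm
      _ = _ := Finset.sum_congr rfl fun _ _ => Finset.sum_congr rfl fun _ _ =>
          Finset.sum_congr rfl fun _ _ => by ring

/-- The Christoffel terms in the Leibniz rule for a full contraction cancel. -/
theorem contract_christoffel (M : ι → ι → ℝ) (A B : ι → ι → ℝ) (T : ι → ι → ι → ι → ℝ) :
    contract (fun a b => ∑ e, (M a e * A e b + M b e * A a e)) B T
      + contract A (fun a b => ∑ e, (M a e * B e b + M b e * B a e)) T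
      = contract A B (fun a b c g => ∑ e, (M e a * T e b c g + M e b * T a e c g
        + M e c * T a b e g + M e g * T a b c e)) := by
  rw [contract_christoffel_left, ← contract_pair _ A T, contract_christoffel_left,
    ← contract_pair A B, ← contract_add]
  congr 1
  funext a b c g
  rw [← Finset.sum_add_distrib]
  exact Finset.sum_congr rfl fun e _ => by ring

theorem contract_add_left (A A' B : ι → ι → ℝ) (T : ι → ι → ι → ι → ℝ) :
    contract (fun a b => A a b + A' a b) B T = contract A B T + contract A' B T := by
  simp only [contract, mul_add, add_mul, Finset.sum_add_distrib]

theorem contract_add_right (A B B' : ι → ι → ℝ) (T : ι → ι → ι → ι → ℝ) :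
    contract A (fun a b => B a b + B' a b) T = contract A B T + contract A B' T := by
  simp only [contract, mul_add, Finset.sum_add_distrib]

theorem contract_sum_left {κ : Type*} (s : Finset κ) (A : κ → ι → ι → ℝ) (B : ι → ι → ℝ)
    (T : ι → ι → ι → ι → ℝ) :
    contract (fun a b => ∑ k ∈ s, A k a b) B T = ∑ k ∈ s, contract (A k) B T := by
  simp only [contract, Finset.sum_mul, Finset.mul_sum]
  symm
  rw [Finset.sum_comm]
  refine Finset.sum_congr rfl fun _ _ => ?_
  rw [Finset.sum_comm]
  refine Finset.sum_congr rfl fun _ _ => ?_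
  rw [Finset.sum_comm]
  exact Finset.sum_congr rfl fun _ _ => Finset.sum_comm

variable (hS : ∃ V, IsOpen V ∧ D = S ∩ V) (hD : UniqueDiffOn ℝ D)
  {G : (ι → ℝ) → Matrix ι ι ℝ} {Γ : ι → ι → ι → smoothAlg D}
  {R T : ι → ι → ι → ι → smoothAlg D}

include hS in
theorem uniqueDiffWithinAt_of_inter (hD : UniqueDiffOn ℝ D) (x : D) : UniqueDiffWithinAt ℝ S x := by
  obtain ⟨V, hV, rfl⟩ := hS
  exact (hD x x.2).mono Set.inter_subset_left

include hS in
theorem differentiableWithinAt_of_smooth (f : smoothAlg D) {F : (ι → ℝ) → ℝ}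
    (h : ∀ x : D, F x = f.1 x) (x : D) : DifferentiableWithinAt ℝ F S x := by
  obtain ⟨V, hV, rfl⟩ := hS
  have := (smoothAlg.contDiffOn_of_eq f h).differentiableOn (by simp) x x.2
  exact (differentiableWithinAt_inter (hV.mem_nhds x.2.2)).1 this

/-- `∇_m V`, as a function with values in the components. -/
def nabla (G : (ι → ℝ) → Matrix ι ι ℝ) (S : Set (ι → ℝ)) (V : (ι → ℝ) → ι → ι → ℝ) (m : ι)
    (y : ι → ℝ) (a b : ι) : ℝ :=
  nablaContra G S (fun y => Matrix.of (V y)) m a b y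

include hS in
/-- The Leibniz rule for a full contraction, in covariant form. -/
theorem pd_contract_nabla (hΓ : ∀ a b c (x : D), christoffel G S a b c x = (Γ a b c).1 x)
    {A B : (ι → ℝ) → ι → ι → ℝ} {F : ι → ι → ι → ι → (ι → ℝ) → ℝ}
    (hF : ∀ a b c g (x : D), F a b c g x = (T a b c g).1 x) (x : D)
    (hA : ∀ a b, DifferentiableWithinAt ℝ (fun y => A y a b) S x)
    (hB : ∀ a b, DifferentiableWithinAt ℝ (fun y => B y a b) S x) (m : ι) :
    pd S m (fun y => contract (A y) (B y) (fun a b c g => F a b c g y)) x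
      = contract (nabla G S A m x) (B x) (fun a b c g => F a b c g x)
        + contract (A x) (nabla G S B m x) (fun a b c g => F a b c g x)
        + contract (A x) (B x) (fun a b c g => (cov₄ (coord hD) Γ T m a b c g).1 x) := by
  have hx := uniqueDiffWithinAt_of_inter hS hD x
  rw [pd_contract hx hA hB (fun a b c g => differentiableWithinAt_of_smooth hS _ (hF a b c g) x)]
  have hn : ∀ V, nabla G S V m x = fun a b => pd S m (fun y => V y a b) x
      + ∑ e, (christoffel G S a m e x * V x e b + christoffel G S b m e x * V x a e) :=
    fun _ => rfl
  simp only [hn, contract_add_left, contract_add_right]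
  have h1 := contract_christoffel (fun a e => christoffel G S a m e x) (A x) (B x)
    (fun a b c g => F a b c g x)
  have h2 : contract (A x) (B x) (fun a b c g => (cov₄ (coord hD) Γ T m a b c g).1 x)
      = contract (A x) (B x) (fun a b c g => pd S m (F a b c g) x)
        - contract (A x) (B x) (fun a b c g => ∑ e, (christoffel G S e m a x * F e b c g x
          + christoffel G S e m b x * F a e c g x + christoffel G S e m c x * F a b e g x
          + christoffel G S e m g x * F a b c e x)) := by
    rw [← contract_sub]
    congr 1
    funext a b c g
    simp [cov₄, hΓ, hF, pd_eq_coord hS hD _ _ (hF _ _ _ _)]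
  rw [h2, ← h1]
  ring

end Leibniz

/-! ### The heat operator on `Rm(V, V)` -/

noncomputable section HeatExpansion

variable {ι : Type} [Fintype ι] [DecidableEq ι] {S D : Set (ι → ℝ)}
  (hS : ∃ V, IsOpen V ∧ D = S ∩ V) (hD : UniqueDiffOn ℝ D)
  {G : (ι → ℝ) → Matrix ι ι ℝ} {Γ : ι → ι → ι → smoothAlg D}
  {R : ι → ι → ι → ι → smoothAlg D} {V : (ι → ℝ) → ι → ι → ℝ}

theorem nablaContraTwice_eq (G : (ι → ℝ) → Matrix ι ι ℝ) (S : Set (ι → ℝ))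
    (V : (ι → ℝ) → ι → ι → ℝ) (h m a b : ι) (y : ι → ℝ) :
    nablaContraTwice G S (fun y => Matrix.of (V y)) h m a b y
      = nabla G S (nabla G S V m) h y a b
        - ∑ e, christoffel G S e h m y * nabla G S V e y a b := by
  have e : nabla G S (nabla G S V m) h y a b
      = pd S h (nablaContra G S (fun y => Matrix.of (V y)) m a b) y
        + ∑ e, (christoffel G S a h e y * nablaContra G S (fun y => Matrix.of (V y)) m e b y
          + christoffel G S b h e y * nablaContra G S (fun y => Matrix.of (V y)) m a e y) := rfl
  rw [e, nablaContraTwice]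
  simp only [nabla]
  ring

theorem contract_comm {R : ι → ι → ι → ι → smoothAlg D} (pair : ∀ a b c f, R a b c f = R c f a b)
    (x : D) (A B : ι → ι → ℝ) : contract A B (fun a b c g => (R a b c g).1 x)
      = contract B A (fun a b c g => (R a b c g).1 x) := by
  rw [← contract_pair]
  congr 1
  funext a b c g
  rw [pair]

include hS in
theorem pd_curvForm (hΓ : ∀ a b c (x : D), christoffel G S a b c x = (Γ a b c).1 x)
    (hR : ∀ a b c f (x : D), riem G S a b c f x = (R a b c f).1 x)
    (pair : ∀ a b c f, R a b c f = R c f a b) (x : D)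
    (hV : ∀ a b, DifferentiableWithinAt ℝ (fun y => V y a b) S x) (m : ι) :
    pd S m (curvForm G S (fun y => Matrix.of (V y))) x
      = 2 * contract (nabla G S V m x) (V x) (fun a b c g => (R a b c g).1 x)
        + contract (V x) (V x) (fun a b c g => (cov₄ (coord hD) Γ R m a b c g).1 x) := by
  have h := pd_contract_nabla hS hD hΓ hR x hV hV m
  have h2 : curvForm G S (fun y => Matrix.of (V y))
      = fun y => contract (V y) (V y) (fun a b c g => riem G S a b c g y) := rfl
  rw [h2, h]
  simp only [hR]
  rw [contract_comm pair x (V x)]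
  ring

theorem differentiableWithinAt_nabla (hS : ∃ V, IsOpen V ∧ D = S ∩ V) (hSu : UniqueDiffOn ℝ S)
    (hΓ : ∀ a b c (x : D), christoffel G S a b c x = (Γ a b c).1 x) (x : D)
    (hV : ∀ a b, ContDiffWithinAt ℝ 2 (fun y => V y a b) S x) (m a b : ι) :
    DifferentiableWithinAt ℝ (fun y => nabla G S V m y a b) S x := by
  have hx : (x : ι → ℝ) ∈ S := by obtain ⟨V, hV, rfl⟩ := hS; exact x.2.1
  have h1 : DifferentiableWithinAt ℝ (fun y => pd S m (fun y => V y a b) y) S x := by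
    have := (hV a b).fderivWithin_right (m := 1) hSu (by norm_num) hx
    exact (this.differentiableWithinAt (by norm_num)).clm_apply (differentiableWithinAt_const _)
  have h2 := fun a b c => differentiableWithinAt_of_smooth hS (Γ a b c) (hΓ a b c) x
  have h3 := fun a b => (hV a b).differentiableWithinAt (by norm_num)
  exact h1.add (DifferentiableWithinAt.fun_sum fun e _ =>
    ((h2 a m e).mul (h3 e b)).add ((h2 b m e).mul (h3 a e)))

include hS in
theorem eventually_pd_curvForm (hΓ : ∀ a b c (x : D), christoffel G S a b c x = (Γ a b c).1 x)
    (hR : ∀ a b c f (x : D), riem G S a b c f x = (R a b c f).1 x)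
    (pair : ∀ a b c f, R a b c f = R c f a b) (x : D)
    (hV : ∀ a b, ContDiffWithinAt ℝ 2 (fun y => V y a b) S x) (m : ι) :
    ∀ᶠ y in nhdsWithin (x : ι → ℝ) S, pd S m (curvForm G S (fun y => Matrix.of (V y))) y
      = 2 * contract (nabla G S V m y) (V y) (fun a b c g => ext₀ (R a b c g).1 y)
        + contract (V y) (V y) (fun a b c g => ext₀ (cov₄ (coord hD) Γ R m a b c g).1 y) := by
  have hx : (x : ι → ℝ) ∈ S := by obtain ⟨V, hV, rfl⟩ := hS; exact x.2.1
  have hDx : D ∈ nhdsWithin (x : ι → ℝ) S := by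
    obtain ⟨W, hW, rfl⟩ := hS
    exact Filter.inter_mem self_mem_nhdsWithin (mem_nhdsWithin_of_mem_nhds (hW.mem_nhds x.2.2))
  have hev : ∀ᶠ y in nhdsWithin (x : ι → ℝ) S,
      ∀ a b, ContDiffWithinAt ℝ 2 (fun y => V y a b) S y := by
    simp only [Filter.eventually_all]
    intro a b
    have := (hV a b).eventually (by simp)
    rwa [Set.insert_eq_of_mem hx] at this
  filter_upwards [hDx, hev] with y hy hVy
  rw [pd_curvForm hS hD hΓ hR pair ⟨y, hy⟩
    (fun a b => (hVy a b).differentiableWithinAt (by norm_num)) m]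
  have e1 : ∀ a b c g, ext₀ (R a b c g).1 y = (R a b c g).1 ⟨y, hy⟩ :=
    fun _ _ _ _ => ext₀_coe _ ⟨y, hy⟩
  have e2 : ∀ a b c g, ext₀ (cov₄ (coord hD) Γ R m a b c g).1 y
      = (cov₄ (coord hD) Γ R m a b c g).1 ⟨y, hy⟩ := fun _ _ _ _ => ext₀_coe _ ⟨y, hy⟩
  simp only [e1, e2]

include hS in
theorem pd_contract_add_contract
    (hΓ : ∀ a b c (x : D), christoffel G S a b c x = (Γ a b c).1 x)
    {T : ι → ι → ι → ι → smoothAlg D}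
    {N : (ι → ℝ) → ι → ι → ℝ} (x : D) (hV : ∀ a b, DifferentiableWithinAt ℝ (fun y => V y a b) S x)
    (hN : ∀ a b, DifferentiableWithinAt ℝ (fun y => N y a b) S x) (m : ι) :
    pd S m (fun y => 2 * contract (N y) (V y) (fun a b c g => ext₀ (R a b c g).1 y)
        + contract (V y) (V y) (fun a b c g => ext₀ (T a b c g).1 y)) x
      = 2 * (contract (nabla G S N m x) (V x) (fun a b c g => (R a b c g).1 x)
        + contract (N x) (nabla G S V m x) (fun a b c g => (R a b c g).1 x)
        + contract (N x) (V x) (fun a b c g => (cov₄ (coord hD) Γ R m a b c g).1 x))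
      + (contract (nabla G S V m x) (V x) (fun a b c g => (T a b c g).1 x)
        + contract (V x) (nabla G S V m x) (fun a b c g => (T a b c g).1 x)
        + contract (V x) (V x) (fun a b c g => (cov₄ (coord hD) Γ T m a b c g).1 x)) := by
  have hx' := uniqueDiffWithinAt_of_inter hS hD x
  have hRe : ∀ a c e g (y : D), ext₀ (R a c e g).1 y = (R a c e g).1 y :=
    fun a c e g y => ext₀_coe _ y
  have hTe : ∀ a c e g (y : D), ext₀ (T a c e g).1 y = (T a c e g).1 y :=
    fun a c e g y => ext₀_coe _ y
  have hRd := differentiableWithinAt_contract hN hV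
    fun a c e g => differentiableWithinAt_of_smooth hS _ (hRe a c e g) x
  have hTd := differentiableWithinAt_contract hV hV
    fun a c e g => differentiableWithinAt_of_smooth hS _ (hTe a c e g) x
  have h1 := pd_contract_nabla hS hD hΓ hRe x hN hV m
  have h2 := pd_contract_nabla hS hD hΓ hTe x hV hV m
  have hc : pd S m (fun _ => (2 : ℝ)) x = 0 := by simp [pd]
  rw [pd_add hx' (hRd.const_mul 2) hTd, pd_mul hx' (differentiableWithinAt_const _) hRd, hc, h1, h2]
  simp only [hRe, hTe]
  ring

theorem contract_nablaContraTwice (B : ι → ι → ℝ) (T : ι → ι → ι → ι → ℝ) (a b : ι) (x : ι → ℝ) :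
    contract (fun c g => nablaContraTwice G S (fun y => Matrix.of (V y)) a b c g x) B T
      = contract (nabla G S (nabla G S V b) a x) B T
        - ∑ e, christoffel G S e a b x * contract (nabla G S V e x) B T := by
  simp only [nablaContraTwice_eq, sub_eq_add_neg, ← Finset.sum_neg_distrib, ← neg_mul,
    contract_add_left, contract_sum_left, contract_smul_left]

theorem contract_covTwice₄ (hΓ : ∀ a b c (x : D), christoffel G S a b c x = (Γ a b c).1 x)
    (A B : ι → ι → ℝ) (a b : ι) (x : D) :
    contract A B (fun c e f g => (covTwice₄ (coord hD) Γ R a b c e f g).1 x)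
      = contract A B (fun c e f g => (cov₄ (coord hD) Γ (cov₄ (coord hD) Γ R b) a c e f g).1 x)
        - ∑ m, christoffel G S m a b x *
          contract A B (fun c e f g => (cov₄ (coord hD) Γ R m c e f g).1 x) := by
  have : ∀ c e f g, (covTwice₄ (coord hD) Γ R a b c e f g).1 x
      = (cov₄ (coord hD) Γ (cov₄ (coord hD) Γ R b) a c e f g).1 x
        - ∑ m, christoffel G S m a b x * (cov₄ (coord hD) Γ R m c e f g).1 x := by
    intro c e f g
    simp [covTwice₄, hΓ]
  simp only [this, contract_sub, contract_sum, contract_mul]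

include hS in
/-- The Hessian of `Rm(V, V)` in terms of covariant derivatives. -/
theorem hessian_curvForm (hSu : UniqueDiffOn ℝ S)
    (hΓ : ∀ a b c (x : D), christoffel G S a b c x = (Γ a b c).1 x)
    (hR : ∀ a b c f (x : D), riem G S a b c f x = (R a b c f).1 x)
    (pair : ∀ a b c f, R a b c f = R c f a b) (x : D)
    (hV : ∀ a b, ContDiffWithinAt ℝ 2 (fun y => V y a b) S x) (a b : ι) :
    hessian G S (curvForm G S (fun y => Matrix.of (V y))) a b x
      = 2 * contract (fun c g => nablaContraTwice G S (fun y => Matrix.of (V y)) a b c g x) (V x)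
          (fun a b c g => (R a b c g).1 x)
        + 2 * contract (nabla G S V a x) (nabla G S V b x) (fun a b c g => (R a b c g).1 x)
        + 2 * contract (nabla G S V a x) (V x)
          (fun c e f g => (cov₄ (coord hD) Γ R b c e f g).1 x)
        + 2 * contract (nabla G S V b x) (V x)
          (fun c e f g => (cov₄ (coord hD) Γ R a c e f g).1 x)
        + contract (V x) (V x) (fun c e f g => (covTwice₄ (coord hD) Γ R a b c e f g).1 x) := by
  have hx : (x : ι → ℝ) ∈ S := by obtain ⟨V, hV, rfl⟩ := hS; exact x.2.1
  have hVd := fun a b => (hV a b).differentiableWithinAt (by norm_num)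
  have hNd := differentiableWithinAt_nabla hS hSu hΓ x hV
  rw [hessian, pd_congr (eventually_pd_curvForm hS hD hΓ hR pair x hV b) hx,
    pd_contract_add_contract hS hD hΓ x hVd (hNd b)]
  simp only [pd_curvForm hS hD hΓ hR pair x hVd]
  rw [contract_nablaContraTwice, contract_covTwice₄ hD hΓ,
    contract_comm pair x (nabla G S V b x) (nabla G S V a x),
    contract_comm (fun c e f g => cov₄_pair pair b c e f g) x (V x)]
  simp only [mul_add, Finset.sum_add_distrib, mul_left_comm _ (2 : ℝ), ← Finset.mul_sum]
  ring

include hS in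
/-- The operator `∇_m - Δ` applied to `Rm(V, V)`: only derivatives of `V` up to first order and
`(∇_m - Δ) V` occur. -/
theorem heat_curvForm (hSu : UniqueDiffOn ℝ S)
    (hΓ : ∀ a b c (x : D), christoffel G S a b c x = (Γ a b c).1 x)
    (hR : ∀ a b c f (x : D), riem G S a b c f x = (R a b c f).1 x)
    (pair : ∀ a b c f, R a b c f = R c f a b) (x : D) (hH : ∀ a b, (G x)⁻¹ a b = (G x)⁻¹ b a)
    (hV : ∀ a b, ContDiffWithinAt ℝ 2 (fun y => V y a b) S x) (m : ι) :
    pd S m (curvForm G S (fun y => Matrix.of (V y))) x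
        - laplacian G S (curvForm G S (fun y => Matrix.of (V y))) x
      = contract (V x) (V x) (fun a b c g => (cov₄ (coord hD) Γ R m a b c g).1 x
          - ∑ e, ∑ f, (G x)⁻¹ e f * (covTwice₄ (coord hD) Γ R f e a b c g).1 x)
        + 2 * contract (fun a b => nablaContra G S (fun y => Matrix.of (V y)) m a b x
          - laplacianContra G S (fun y => Matrix.of (V y)) a b x) (V x)
          (fun a b c g => (R a b c g).1 x)
        - 4 * ∑ k, ∑ l, (G x)⁻¹ k l * contract (nabla G S V l x) (V x)
            (fun a b c g => (cov₄ (coord hD) Γ R k a b c g).1 x)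
        - 2 * ∑ k, ∑ l, (G x)⁻¹ k l * contract (nabla G S V k x) (nabla G S V l x)
            (fun a b c g => (R a b c g).1 x) := by
  have hVd := fun a b => (hV a b).differentiableWithinAt (by norm_num)
  have hL : contract (fun a b => nablaContra G S (fun y => Matrix.of (V y)) m a b x
      - laplacianContra G S (fun y => Matrix.of (V y)) a b x) (V x) (fun a b c g => (R a b c g).1 x)
      = contract (nabla G S V m x) (V x) (fun a b c g => (R a b c g).1 x)
        - ∑ e, ∑ f, (G x)⁻¹ e f *
          contract (fun c g => nablaContraTwice G S (fun y => Matrix.of (V y)) e f c g x) (V x)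
          (fun a b c g => (R a b c g).1 x) := by
    simp only [laplacianContra, sub_eq_add_neg, ← Finset.sum_neg_distrib, ← neg_mul,
      contract_add_left, contract_sum_left, contract_smul_left]
    rfl
  have swap : ∀ X : ι → ι → ℝ, ∑ a, ∑ b, (G x)⁻¹ a b * X a b = ∑ a, ∑ b, (G x)⁻¹ a b * X b a := by
    intro X
    rw [Finset.sum_comm]
    exact Finset.sum_congr rfl fun a _ => Finset.sum_congr rfl fun b _ => by rw [hH]
  rw [hL, contract_sub]
  simp only [contract_sum, contract_mul]
  rw [laplacian, pd_curvForm hS hD hΓ hR pair x hVd m]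
  simp only [hessian_curvForm hS hD hSu hΓ hR pair x hV, mul_add, Finset.sum_add_distrib,
    mul_left_comm _ (2 : ℝ), ← Finset.mul_sum]
  rw [swap fun a b => contract (nabla G S V a x) (V x)
          (fun c e f g => (cov₄ (coord hD) Γ R b c e f g).1 x),
    swap fun a b => contract (V x) (V x)
      (fun c e f g => (covTwice₄ (coord hD) Γ R a b c e f g).1 x)]
  ring

end HeatExpansion

/-! ### Nondegenerate metrics -/

section Metric

variable {𝒜 ℬ : Type*} [CommRing 𝒜] [Algebra ℝ 𝒜] [CommRing ℬ] [Algebra ℝ ℬ] {n : ℕ}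

/-- A nondegenerate metric `g` with inverse `h`, its Christoffel symbols `Γ` and its curvature
tensor `R`, over an algebra with derivations `d`. -/
structure IsMetric (d : Fin n → Derivation ℝ 𝒜 𝒜) (g h : Fin n → Fin n → 𝒜)
    (Γ : Fin n → Fin n → Fin n → 𝒜) (R : Fin n → Fin n → Fin n → Fin n → 𝒜) : Prop where
  symm : ∀ i j, g i j = g j i
  symm_inv : ∀ i j, h i j = h j i
  inv : ∀ i j, ∑ m, g i m * h m j = if i = j then 1 else 0
  torsion : ∀ i j k, Γ i j k = Γ i k j
  christoffel : ∀ i j k, 2 * ∑ m, g i m * Γ m j k = d j (g k i) + d k (g j i) - d i (g j k)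
  curv : ∀ i j k l, R i j k l = ∑ m, g l m * curvUp d Γ i j k m

variable {d : Fin n → Derivation ℝ 𝒜 𝒜} {d' : Fin n → Derivation ℝ ℬ ℬ} {g h : Fin n → Fin n → 𝒜}
  {Γ : Fin n → Fin n → Fin n → 𝒜} {R : Fin n → Fin n → Fin n → Fin n → 𝒜} {π : 𝒜 →ₐ[ℝ] ℬ}

theorem IsMetric.map (hπ : ∀ a x, π (d a x) = d' a (π x)) (hM : IsMetric d g h Γ R) :
    IsMetric d' (fun a b => π (g a b)) (fun a b => π (h a b)) (fun a b c => π (Γ a b c))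
      (fun a b c f => π (R a b c f)) where
  symm i j := by rw [hM.symm]
  symm_inv i j := by rw [hM.symm_inv]
  inv i j := by
    have := congrArg π (hM.inv i j)
    simpa [apply_ite] using this
  torsion i j k := by rw [hM.torsion]
  christoffel i j k := by
    have h2 : π 2 = 2 := map_ofNat π 2
    have := congrArg π (hM.christoffel i j k)
    simpa [hπ, h2] using this
  curv i j k l := by
    have := congrArg π (hM.curv i j k l)
    simpa [map_curvUp hπ] using this

theorem exists_isMetric (d : Fin n → Derivation ℝ 𝒜 𝒜) (hg : ∀ i j, g i j = g j i)
    (hdet : IsUnit (Matrix.of g).det) : ∃ h Γ R, IsMetric d g h Γ R := by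
  set A : Matrix (Fin n) (Fin n) 𝒜 := Matrix.of g with hA
  have hAt : A.transpose = A := by ext i j; exact hg j i
  have inv : ∀ i j, ∑ m, g i m * A⁻¹ m j = if i = j then 1 else 0 := by
    intro i j
    have := congrFun (congrFun (Matrix.mul_nonsing_inv A hdet) i) j
    rwa [Matrix.mul_apply, Matrix.one_apply] at this
  refine ⟨fun i j => A⁻¹ i j, fun i j k => half 𝒜 * ∑ l, A⁻¹ i l * (d j (g k l) + d k (g j l)
    - d l (g j k)), _, hg, fun i j => ?_, inv, fun i j k => ?_, fun i j k => ?_, fun i j k l => rfl⟩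
  · have : (A⁻¹).transpose = A⁻¹ := by rw [Matrix.transpose_nonsing_inv, hAt]
    exact (congrFun (congrFun this j) i)
  · congr 1
    exact Finset.sum_congr rfl fun l _ => by rw [hg j k]; ring
  · have h2 := two_mul_half (𝒜 := 𝒜)
    have := mul_inv_cancel_sum inv (fun l => d j (g k l) + d k (g j l) - d l (g j k)) i
    simp only [mul_left_comm _ (half 𝒜), ← Finset.mul_sum]
    rw [this]
    linear_combination (d j (g k i) + d k (g j i) - d i (g j k)) * h2

theorem IsMetric.isFlow {d : Fin (n + 1) → Derivation ℝ 𝒜 𝒜} {τ : 𝒜}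
    (hM : IsMetric (spatial d) g h Γ R) (hd : ∀ a b f, d a (d b f) = d b (d a f))
    (hflow : ∀ i j, d 0 (g i j) = -2 * ric h R i j) (htime : d 0 τ = -2 * τ ^ 2)
    (hspace : ∀ i, spatial d i τ = 0) : IsFlow d g h Γ R τ where
  comm := hd
  symm := hM.symm
  symm_inv := hM.symm_inv
  inv := hM.inv
  torsion := hM.torsion
  christoffel := hM.christoffel
  curv := hM.curv
  flow := hflow
  time := htime
  time_space := hspace

theorem IsFlow.isMetric {d : Fin (n + 1) → Derivation ℝ 𝒜 𝒜} {τ : 𝒜} (hF : IsFlow d g h Γ R τ) :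
    IsMetric (spatial d) g h Γ R where
  symm := hF.symm
  symm_inv := hF.symm_inv
  inv := hF.inv
  torsion := hF.torsion
  christoffel := hF.christoffel
  curv := hF.curv

end Metric

section Coordinates

variable {n : ℕ} {S D : Set (Fin n → ℝ)} {hD : UniqueDiffOn ℝ D}
  {G : (Fin n → ℝ) → Matrix (Fin n) (Fin n) ℝ} {g h : Fin n → Fin n → smoothAlg D}
  {Γ : Fin n → Fin n → Fin n → smoothAlg D} {R : Fin n → Fin n → Fin n → Fin n → smoothAlg D}

namespace IsMetric

variable (hS : ∃ V, IsOpen V ∧ D = S ∩ V) (hM : IsMetric (coord hD) g h Γ R)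
  (hG : ∀ (x : D) a b, G x a b = (g a b).1 x)
include hM hG

theorem inv_eq (x : D) (a b : Fin n) : (G x)⁻¹ a b = (h a b).1 x :=
  inv_eq_of_mul_eq hG hM.inv x a b

include hS

theorem christoffel_eq (a b c : Fin n) (x : D) :
    HyperbolicThermostat.christoffel G S a b c x = (Γ a b c).1 x :=
  christoffel_eq_of_smooth hS hD hG hM.symm hM.symm_inv hM.inv hM.christoffel a b c x

theorem riem_eq (a b c f : Fin n) (x : D) : riem G S a b c f x = (R a b c f).1 x := by
  rw [hM.curv]
  exact riem_eq_of_smooth hS hD hG (hM.christoffel_eq hS hG) a b c f x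

theorem ricci_eq (a b : Fin n) (x : D) : ricci G S a b x = (ric h R a b).1 x :=
  ricci_eq_of_smooth (hM.inv_eq hG) (hM.riem_eq hS hG) a b x

theorem scal_eq (x : D) : scal G S x = (sca h R).1 x :=
  scal_eq_of_smooth (hM.inv_eq hG) (hM.riem_eq hS hG) x

theorem tensorP_eq (a b c : Fin n) (x : D) :
    tensorP G S a b c x = (curlRic (coord hD) Γ h R a b c).1 x := by
  have hn := nablaCo₂_eq_of_smooth hS hD (hM.christoffel_eq hS hG) (hM.ricci_eq hS hG)
  rw [tensorP, hn, hn, curlRic, smoothAlg.sub_val]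

theorem tensorM_eq (t : ℝ) (a b : Fin n) (x : D) : 2 * tensorM G S t a b x =
    (2 * (∑ k, ∑ l, h k l * cov₃ (coord hD) Γ (cov₂ (coord hD) Γ (ric h R)) k l a b)
      + 4 * (∑ k, ∑ l, ∑ p, ∑ q, R a k b l * (h k p * h l q * ric h R p q))
      - 2 * (∑ k, ∑ p, h k p * ric h R a p * ric h R k b)
      - (coord hD a (coord hD b (sca h R)) - ∑ m, Γ m a b * coord hD m (sca h R))).1 x
      + 1 / t * (ric h R a b).1 x := by
  have hc := hM.christoffel_eq hS hG
  have hn := nablaCo₂_eq_of_smooth hS hD hc (hM.ricci_eq hS hG)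
  have hn₃ := nablaCo₃_eq_of_smooth hS hD hc hn
  have hh := hessian_eq_of_smooth hS hD hc (hM.scal_eq hS hG)
  have h2 : (2 : smoothAlg D).1 x = 2 := map_ofNat (smoothAlg.eval x) 2
  have h4 : (4 : smoothAlg D).1 x = 4 := map_ofNat (smoothAlg.eval x) 4
  simp only [tensorM, hn₃, hh, hM.inv_eq hG, hM.riem_eq hS hG, hM.ricci_eq hS hG,
    smoothAlg.add_val, smoothAlg.sub_val, smoothAlg.mul_val, smoothAlg.sum_val, h2, h4]

  ring

theorem reaction_eq (t : ℝ) (W : Fin n → ℝ) (V : Fin n → Fin n → ℝ) (x : D) :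
    reaction G S t W V x = reactionForm (fun i j => (h i j).1 x) (fun i j k l => (R i j k l).1 x)
      (fun i j k => (curlRic (coord hD) Γ h R i j k).1 x) (fun i j => tensorM G S t i j x) W V := by
  simp only [reaction, reactionForm, hM.inv_eq hG, hM.riem_eq hS hG, hM.tensorP_eq hS hG]

end IsMetric

end Coordinates

/-! ### Ricci flows in charts -/

noncomputable section FlowInCharts

variable {n : ℕ} {M : Type*} [TopologicalSpace M] [ChartedSpace (EuclideanSpace ℝ (Fin n)) M]
  (e : OpenPartialHomeomorph M (EuclideanSpace ℝ (Fin n))) (T : ℝ)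

theorem isOpen_chartRegion : IsOpen (chartRegion e) :=
  e.open_target.preimage (PiLp.continuous_toLp 2 _)

theorem convex_timeSlab : Convex ℝ {z : Fin (n + 1) → ℝ | z 0 ∈ Set.Ioc 0 T} :=
  (convex_Ioc 0 T).linear_preimage (LinearMap.proj 0 : (Fin (n + 1) → ℝ) →ₗ[ℝ] ℝ)

theorem isRegularDomain_spacetimeRegion (hT : 0 < T) : IsRegularDomain (spacetimeRegion e T) := by
  have h1 : IsRegularDomain {z : Fin (n + 1) → ℝ | z 0 ∈ Set.Ioc 0 T} := by
    refine IsRegularDomain.of_convex (convex_timeSlab T) ⟨fun _ => T / 2, ?_⟩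
    rw [mem_interior]
    exact ⟨{z | z 0 ∈ Set.Ioo 0 T}, fun z hz => Set.Ioo_subset_Ioc_self hz,
      isOpen_Ioo.preimage (continuous_apply 0), by constructor <;> linarith⟩
  have h2 : IsOpen {z : Fin (n + 1) → ℝ | Fin.tail z ∈ chartRegion e} :=
    (isOpen_chartRegion e).preimage (continuous_pi fun i => continuous_apply i.succ)
  exact h1.inter h2

variable [IsManifold (𝓡 n) ∞ M]
  {g : ℝ → Bundle.ContMDiffRiemannianMetric (𝓡 n) ∞ (EuclideanSpace ℝ (Fin n))
      (fun x : M => TangentSpace (𝓡 n) x)}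

variable {e} in
theorem mfderiv_symm_injective (he : e ∈ IsManifold.maximalAtlas (𝓡 n) ∞ M)
    {x : EuclideanSpace ℝ (Fin n)} (hx : x ∈ e.target) :
    Function.Injective (mfderiv (𝓡 n) (𝓡 n) e.symm x) := by
  have hd : e.MDifferentiable (𝓡 n) (𝓡 n) :=
    ⟨(contMDiffOn_of_mem_maximalAtlas he).mdifferentiableOn (by simp),
      (contMDiffOn_symm_of_mem_maximalAtlas he).mdifferentiableOn (by simp)⟩
  intro v w hvw
  have h := hd.comp_symm_deriv hx
  have h1 := congrArg (fun L => L v) h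
  have h2 := congrArg (fun L => L w) h
  simp only [ContinuousLinearMap.comp_apply] at h1 h2
  rw [hvw, h2] at h1
  exact h1.symm

theorem chartMetric_symm (g : Bundle.ContMDiffRiemannianMetric (𝓡 n) ∞ (EuclideanSpace ℝ (Fin n))
      (fun x : M => TangentSpace (𝓡 n) x)) (y : Fin n → ℝ) (i j : Fin n) :
    chartMetric g e y i j = chartMetric g e y j i :=
  g.symm _ _ _

variable {e} in
theorem det_chartMetric_ne_zero (g : Bundle.ContMDiffRiemannianMetric (𝓡 n) ∞
      (EuclideanSpace ℝ (Fin n)) (fun x : M => TangentSpace (𝓡 n) x))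
    (he : e ∈ IsManifold.maximalAtlas (𝓡 n) ∞ M) {y : Fin n → ℝ} (hy : y ∈ chartRegion e) :
    (chartMetric g e y).det ≠ 0 := by
  intro h0
  obtain ⟨v, hv, h⟩ := Matrix.exists_mulVec_eq_zero_iff.2 h0
  set w : TangentSpace (𝓡 n) (e.symm (WithLp.toLp 2 y)) := ∑ i, v i • coordVec e y i with hw
  have hzero : g.inner _ w w = 0 := by
    have : g.inner _ w w = ∑ i, v i * (chartMetric g e y).mulVec v i := by
      rw [hw]
      simp only [map_sum, map_smul, sum_apply, smul_apply,
        smul_eq_mul, Matrix.mulVec, dotProduct, Finset.mul_sum, chartMetric, Matrix.of_apply]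
      rw [Finset.sum_comm]
      exact Finset.sum_congr rfl fun i _ => Finset.sum_congr rfl fun j _ => by ring
    rw [this, h]
    simp
  have hw0 : w = 0 := by
    by_contra hne
    exact (g.pos _ w hne).ne' hzero
  have hsum : w = mfderiv (𝓡 n) (𝓡 n) e.symm (WithLp.toLp 2 y) (WithLp.toLp 2 v) := by
    have : (WithLp.toLp 2 v : EuclideanSpace ℝ (Fin n))
        = ∑ i, v i • EuclideanSpace.single i (1 : ℝ) := by
      ext j
      simp [Pi.single_apply]
    rw [this, hw]
    set L : EuclideanSpace ℝ (Fin n) →L[ℝ] TangentSpace (𝓡 n) (e.symm (WithLp.toLp 2 y)) :=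
      mfderiv (𝓡 n) (𝓡 n) e.symm (WithLp.toLp 2 y) with hL
    change ∑ i, v i • L (EuclideanSpace.single i (1 : ℝ))
      = L (∑ i, v i • EuclideanSpace.single i (1 : ℝ))
    rw [map_sum]
    simp only [map_smul]
  have := mfderiv_symm_injective he hy ((hsum.symm.trans hw0).trans (map_zero _).symm)
  apply hv
  ext i
  exact congrArg (fun v : EuclideanSpace ℝ (Fin n) => v i) this

variable {e T}

/-- The components of the evolving metric, as smooth functions on space-time. -/
def flowMetric (hg : IsRicciFlow g T) (he : e ∈ IsManifold.maximalAtlas (𝓡 n) ∞ M) (i j : Fin n) :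
    smoothAlg (spacetimeRegion e T) :=
  smoothAlg.mk _ (hg.smooth e he i j)

theorem isUnit_det_flowMetric (hg : IsRicciFlow g T)
    (he : e ∈ IsManifold.maximalAtlas (𝓡 n) ∞ M) : IsUnit (Matrix.of (flowMetric hg he)).det := by
  refine smoothAlg.isUnit_of_ne_zero fun z => ?_
  rw [← smoothAlg.eval_apply, ← AlgHom.coe_toRingHom, RingHom.map_det]
  exact det_chartMetric_ne_zero (g (z.1 0)) he z.2.2

theorem timeFun_contDiffOn :
    ContDiffOn ℝ ∞ (fun z : Fin (n + 1) → ℝ => 1 / (2 * z 0)) (spacetimeRegion e T) := by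
  refine contDiffOn_const.div (contDiffOn_const.mul (contDiff_apply ℝ ℝ 0).contDiffOn)
    fun z hz => ?_
  have := hz.1.1
  positivity

variable (e T) in
/-- The function `1/(2t)`. -/
def timeFun : smoothAlg (spacetimeRegion e T) := smoothAlg.mk _ timeFun_contDiffOn

theorem coord_timeFun (hS : UniqueDiffOn ℝ (spacetimeRegion e T)) (a : Fin (n + 1)) :
    coord hS a (timeFun e T) = -2 * timeFun e T ^ 2 * if a = 0 then 1 else 0 := by
  set x₀ : smoothAlg (spacetimeRegion e T) := smoothAlg.mk (fun z => z 0)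
    (contDiff_apply ℝ ℝ 0).contDiffOn with hx₀
  have h1 : (2 : smoothAlg (spacetimeRegion e T)) * (x₀ * timeFun e T) = 1 := by
    ext z
    have : (2 : smoothAlg (spacetimeRegion e T)).1 z = 2 := map_ofNat (smoothAlg.eval z) 2
    rw [smoothAlg.mul_val, this]
    change 2 * (z.1 0 * (1 / (2 * z.1 0))) = 1
    have := z.2.1.1
    field_simp
  have h2 : coord hS a x₀ = if a = 0 then 1 else 0 := by
    ext z
    rw [coord, smoothAlg.deriv_apply_of_eq hS _ x₀ (F := fun z => z 0) fun _ => rfl]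
    have := ((ContinuousLinearMap.proj (R := ℝ) (φ := fun _ : Fin (n + 1) => ℝ) 0).hasFDerivWithinAt
      (s := spacetimeRegion e T) (x := z.1)).fderivWithin (hS z z.2)
    have h3 := congrArg (fun L => L (Pi.single a (1 : ℝ))) this
    refine h3.trans ?_
    split_ifs with h
    · subst h; simp; rfl
    · simp [Ne.symm h]; rfl
  have h3 := congrArg (coord hS a) h1
  rw [Derivation.leibniz, Derivation.leibniz] at h3
  simp only [smul_eq_mul, Derivation.map_one_eq_zero, h2] at h3
  have h4 : coord hS a (2 : smoothAlg (spacetimeRegion e T)) = 0 := Derivation.map_natCast _ 2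
  rw [h4] at h3
  linear_combination timeFun e T * h3 - coord hS a (timeFun e T) * h1

/-- The inclusion `y ↦ (t, y)` of the time slice `t`, written as an affine map. -/
def slice (t : ℝ) (y : Fin n → ℝ) : Fin (n + 1) → ℝ :=
  (Pi.single 0 t : Fin (n + 1) → ℝ) + ContinuousLinearMap.pi (R := ℝ) (M := Fin n → ℝ)
    (φ := fun _ : Fin (n + 1) => ℝ) (Fin.cases 0 fun i => ContinuousLinearMap.proj i) y

theorem slice_eq (t : ℝ) (y : Fin n → ℝ) : slice t y = Fin.cons t y := by
  ext a
  cases a using Fin.cases <;> simp [slice]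

theorem contDiff_slice (t : ℝ) : ContDiff ℝ ∞ (slice (n := n) t) :=
  contDiff_const.add (ContinuousLinearMap.contDiff _)

theorem fderiv_slice (t : ℝ) (y : Fin n → ℝ) (i : Fin n) :
    fderiv ℝ (slice t) y (Pi.single i 1) = Pi.single i.succ 1 := by
  have : HasFDerivAt (slice (n := n) t) _ y := (ContinuousLinearMap.hasFDerivAt _).const_add _
  rw [this.fderiv]
  ext a
  cases a using Fin.cases <;> simp [Pi.single_apply]

theorem mapsTo_slice {t : ℝ} (ht : t ∈ Set.Ioc 0 T) :
    Set.MapsTo (slice t) (chartRegion e) (spacetimeRegion e T) := by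
  intro y hy
  rw [slice_eq]
  exact ⟨by simpa using ht, by simpa using hy⟩

/-- Restriction of functions to a time slice. -/
def restrictSlice {t : ℝ} (ht : t ∈ Set.Ioc 0 T) :
    smoothAlg (spacetimeRegion e T) →ₐ[ℝ] smoothAlg (chartRegion e) :=
  smoothAlg.pullback (slice t) (contDiff_slice t) (mapsTo_slice ht)

theorem restrictSlice_apply {t : ℝ} (ht : t ∈ Set.Ioc 0 T) (f : smoothAlg (spacetimeRegion e T))
    (z : spacetimeRegion e T) (hz : z.1 0 = t) :
    (restrictSlice ht f).1 ⟨Fin.tail z.1, z.2.2⟩ = f.1 z := by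
  subst hz
  rw [restrictSlice, smoothAlg.pullback_apply]
  have : (⟨slice (z.1 0) (Fin.tail z.1), mapsTo_slice ht z.2.2⟩ : spacetimeRegion e T) = z :=
    Subtype.ext ((slice_eq _ _).trans (Fin.cons_self_tail z.1))
  exact congrArg f.1 this

theorem restrictSlice_coord {t : ℝ} (ht : t ∈ Set.Ioc 0 T)
    (hS : UniqueDiffOn ℝ (spacetimeRegion e T)) (i : Fin n) (f : smoothAlg (spacetimeRegion e T)) :
    restrictSlice ht (spatial (coord hS) i f)
      = coord (isOpen_chartRegion e).uniqueDiffOn i (restrictSlice ht f) :=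
  smoothAlg.pullback_deriv _ _ _ _ hS (fun y => fderiv_slice t y i) f

theorem chartMetric_eq_restrictSlice (hg : IsRicciFlow g T)
    (he : e ∈ IsManifold.maximalAtlas (𝓡 n) ∞ M) {t : ℝ} (ht : t ∈ Set.Ioc 0 T)
    (y : chartRegion e) (i j : Fin n) :
    chartMetric (g t) e y i j = (restrictSlice ht (flowMetric hg he i j)).1 y := by
  rw [restrictSlice, smoothAlg.pullback_apply]
  change _ = chartMetric (g (slice t y.1 0)) e (Fin.tail (slice t y.1)) i j
  rw [slice_eq]
  simp

/-- The flow equation, which is stated along curves with fixed space coordinates, in terms of the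
derivation `∂_0`. -/
theorem pd_flowMetric (hg : IsRicciFlow g T) (he : e ∈ IsManifold.maximalAtlas (𝓡 n) ∞ M)
    (hS : UniqueDiffOn ℝ (spacetimeRegion e T)) (z : spacetimeRegion e T) (i j : Fin n) :
    (coord hS 0 (flowMetric hg he i j)).1 z
      = -2 * ricci (chartMetric (g (z.1 0)) e) (chartRegion e) i j (Fin.tail z.1) := by
  have h1 := hg.flow e he (z.1 0) z.2.1 (Fin.tail z.1) z.2.2 i j
  set F : (Fin (n + 1) → ℝ) → ℝ := fun z => chartMetric (g (z 0)) e (Fin.tail z) i j with hF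
  have h2 : HasFDerivWithinAt F (fderivWithin ℝ F (spacetimeRegion e T) z)
      (spacetimeRegion e T) z :=
    ((hg.smooth e he i j).differentiableOn (by simp) z z.2).hasFDerivWithinAt
  set c : ℝ → Fin (n + 1) → ℝ := fun s => z.1 + (s - z.1 0) • Pi.single 0 1 with hc
  have hc0 : ∀ s, c s 0 = s := fun s => by simp [hc]
  have hct : ∀ s, Fin.tail (c s) = Fin.tail z.1 := fun s => by
    ext i
    simp [hc, Fin.tail]
  have hcz : c (z.1 0) = z.1 := by simp [hc]
  have h3 : HasDerivWithinAt c (Pi.single 0 1) (Set.Ioc 0 T) (z.1 0) := by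
    have : HasDerivAt c ((1 : ℝ) • Pi.single 0 1) (z.1 0) :=
      (((hasDerivAt_id (z.1 0)).sub_const _).smul_const _).const_add _
    simpa using this.hasDerivWithinAt
  have hm : Set.MapsTo c (Set.Ioc 0 T) (spacetimeRegion e T) := fun s hs =>
    ⟨by rw [hc0]; exact hs, by rw [hct]; exact z.2.2⟩
  have h4 := HasFDerivWithinAt.comp_hasDerivWithinAt (z.1 0) (by rw [hcz]; exact h2) h3 hm
  have h5 : F ∘ c = fun s => chartMetric (g s) e (Fin.tail z.1) i j := by
    funext s
    simp only [hF, Function.comp, hc0, hct]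
  rw [h5] at h4
  rw [coord, smoothAlg.deriv_apply_of_eq hS _ _ (F := F) fun _ => rfl]
  exact (uniqueDiffOn_Ioc 0 T _ z.2.1).eq_deriv _ h4 h1

/-- A Ricci flow gives a flow over the algebra of smooth functions on space-time. -/
theorem exists_isFlow (hg : IsRicciFlow g T) (he : e ∈ IsManifold.maximalAtlas (𝓡 n) ∞ M)
    (hS : IsRegularDomain (spacetimeRegion e T)) :
    ∃ h Γ R, IsFlow (coord hS.uniqueDiffOn) (flowMetric hg he) h Γ R (timeFun e T) := by
  obtain ⟨h, Γ, R, hM⟩ := exists_isMetric (spatial (coord hS.uniqueDiffOn))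
    (g := flowMetric hg he) (fun i j => by ext z; exact chartMetric_symm e _ _ _ _)
    (isUnit_det_flowMetric hg he)
  refine ⟨h, Γ, R, hM.isFlow (fun a b f => smoothAlg.deriv_comm hS _ _ f) (fun i j => ?_) ?_
    fun i => ?_⟩
  · ext z
    rw [pd_flowMetric hg he, smoothAlg.mul_val]
    have h2 : (-2 : smoothAlg (spacetimeRegion e T)).1 z = -2 := by
      rw [← smoothAlg.eval_apply, map_neg, map_ofNat]
    have hM' := hM.map (restrictSlice_coord z.2.1 hS.uniqueDiffOn)
    have := hM'.ricci_eq ⟨Set.univ, isOpen_univ, (Set.inter_univ _).symm⟩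
      (chartMetric_eq_restrictSlice hg he z.2.1) i j ⟨Fin.tail z.1, z.2.2⟩
    rw [h2, this, ← map_ric, restrictSlice_apply z.2.1 _ z rfl]
  · rw [coord_timeFun]; simp
  · exact (coord_timeFun _ _).trans (by simp)

end FlowInCharts

/-! ### Families of functions with a parameter -/

section ThermoMetric

variable {𝒜 : Type*} [CommRing 𝒜] [Algebra ℝ 𝒜] {n : ℕ}
  {d : Fin (n + 1) → Derivation ℝ 𝒜 𝒜} {γ γi : Fin n → Fin n → 𝒜} {Γ : Fin n → Fin n → Fin n → 𝒜}
  {R : Fin n → Fin n → Fin n → Fin n → 𝒜} {τ ε u ν : 𝒜}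

/-- For invertible `ε` the thermostat metric is a metric. -/
theorem IsFlow.isMetric_thermo (hF : IsFlow d γ γi Γ R τ) (hε : ∀ a, d a ε = 0)
    (hν : ν * ε = 1) (hνd : ∀ a, d a ν = 0) (hu : (ε * sca γi R - τ) * u = 1) :
    IsMetric d (fun a b => ν * scaledMetric γ γi R τ ε a b) (thermoInv γi ε u)
      (thermoConn d γi Γ R τ ε u) (thermoCurv d γ γi Γ R τ ε u) where
  symm a b := by rw [hF.scaledMetric_symm]
  symm_inv := hF.thermoInv_symm
  inv a b := by
    simp only [mul_assoc, ← Finset.mul_sum, hF.scaledMetric_mul_inv hu]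
    split_ifs
    · exact hν
    · exact mul_zero _
  torsion := hF.thermoConn_symm
  christoffel a b c := by
    simp only [mul_assoc, ← Finset.mul_sum, Derivation.leibniz, hνd, smul_eq_mul, mul_zero,
      add_zero]
    linear_combination ν * hF.thermo_christoffel hε hu a b c
  curv a b c f := by
    simp only [mul_assoc, ← Finset.mul_sum, ← hF.scaledMetric_curv hε hu]
    linear_combination -thermoCurv d γ γi Γ R τ ε u a b c f * hν

theorem map_thermoCurv {ℬ : Type*} [CommRing ℬ] [Algebra ℝ ℬ] {π : 𝒜 →ₐ[ℝ] ℬ}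
    {d' : Fin (n + 1) → Derivation ℝ ℬ ℬ} (hπ : ∀ a x, π (d a x) = d' a (π x))
    (a b c f : Fin (n + 1)) :
    π (thermoCurv d γ γi Γ R τ ε u a b c f) = thermoCurv d' (fun a b => π (γ a b))
      (fun a b => π (γi a b)) (fun a b c => π (Γ a b c)) (fun a b c f => π (R a b c f))
      (π τ) (π ε) (π u) a b c f := by
  cases f using Fin.cases with
  | zero => cases c using Fin.cases <;> simp [thermoCurv, map_curvUp hπ, map_thermoConn hπ]
  | succ l => simp [thermoCurv, map_curvUp hπ, map_thermoConn hπ]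

end ThermoMetric

noncomputable section Family

variable {m : ℕ} {S : Set (Fin m → ℝ)}

theorem IsRegularDomain.univ_prod (hS : IsRegularDomain S) :
    IsRegularDomain ((Set.univ : Set ℝ) ×ˢ S) := by
  refine ⟨uniqueDiffOn_univ.prod hS.uniqueDiffOn, ?_⟩
  rw [interior_prod_eq, closure_prod_eq, interior_univ, closure_univ]
  exact Set.prod_mono_right hS.subset_closure

/-- The pairs `(ε, y)` with `ε s - τ ≠ 0` at `y`. For the scalar curvature `s` and `τ = 1/(2t)`, these
are the pairs for which `ε` times the time component of the thermostat metric does not vanish. -/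
def familyDomain (s τ : smoothAlg S) : Set (ℝ × (Fin m → ℝ)) :=
  {p | p.2 ∈ S ∧ p.1 * ext₀ s.1 p.2 - ext₀ τ.1 p.2 ≠ 0}

variable {s τ : smoothAlg S}

theorem exists_familyDomain_eq (s τ : smoothAlg S) :
    ∃ V, IsOpen V ∧ familyDomain s τ = (Set.univ : Set ℝ) ×ˢ S ∩ V := by
  have hm : Set.MapsTo Prod.snd ((Set.univ : Set ℝ) ×ˢ S) S := fun p hp => hp.2
  have h : ContinuousOn (fun p : ℝ × (Fin m → ℝ) => p.1 * ext₀ s.1 p.2 - ext₀ τ.1 p.2)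
      ((Set.univ : Set ℝ) ×ˢ S) :=
    (continuousOn_fst.mul (s.contDiffOn.continuousOn.comp continuousOn_snd hm)).sub
      (τ.contDiffOn.continuousOn.comp continuousOn_snd hm)
  obtain ⟨V, hV, h2⟩ := continuousOn_iff'.1 h {0}ᶜ isOpen_compl_singleton
  refine ⟨V, hV, ?_⟩
  rw [Set.inter_comm, ← h2]
  ext p
  simp [familyDomain, and_comm]

theorem isRegularDomain_familyDomain (hS : IsRegularDomain S) (s τ : smoothAlg S) :
    IsRegularDomain (familyDomain s τ) := by
  obtain ⟨V, hV, h⟩ := exists_familyDomain_eq s τ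
  rw [h]
  exact hS.univ_prod.inter hV

/-- The slice of `familyDomain s τ` with parameter `ε`. -/
def memberDomain (s τ : smoothAlg S) (ε : ℝ) : Set (Fin m → ℝ) := {y | (ε, y) ∈ familyDomain s τ}

theorem exists_memberDomain_eq (s τ : smoothAlg S) (ε : ℝ) :
    ∃ V, IsOpen V ∧ memberDomain s τ ε = S ∩ V := by
  obtain ⟨V, hV, h⟩ := exists_familyDomain_eq s τ
  refine ⟨{y | (ε, y) ∈ V}, hV.preimage (by fun_prop), ?_⟩
  ext y
  simp [memberDomain, h]

/-- The coordinate derivations on families of functions. -/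
def famCoord (hD : UniqueDiffOn ℝ (familyDomain s τ)) (a : Fin m) :
    Derivation ℝ (smoothAlg (familyDomain s τ)) (smoothAlg (familyDomain s τ)) :=
  smoothAlg.deriv hD (0, Pi.single a 1)

/-- A function as a constant family. -/
def constFamily (s τ : smoothAlg S) : smoothAlg S →ₐ[ℝ] smoothAlg (familyDomain s τ) :=
  smoothAlg.pullback Prod.snd contDiff_snd fun _ hp => hp.1

theorem constFamily_coord (hS : UniqueDiffOn ℝ S) (hD : UniqueDiffOn ℝ (familyDomain s τ))
    (a : Fin m) (f : smoothAlg S) :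
    constFamily s τ (coord hS a f) = famCoord hD a (constFamily s τ f) :=
  smoothAlg.pullback_deriv _ _ _ _ _ (fun p => by rw [fderiv_snd]; rfl) f

/-- The member with parameter `ε` of a family of functions. -/
def member {D : Set (Fin m → ℝ)} {ε : ℝ} (hm : Set.MapsTo (fun y => (ε, y)) D (familyDomain s τ)) :
    smoothAlg (familyDomain s τ) →ₐ[ℝ] smoothAlg D :=
  smoothAlg.pullback (fun y => (ε, y)) (contDiff_const.prodMk contDiff_id) hm

theorem member_apply {D : Set (Fin m → ℝ)} {ε : ℝ}
    (hm : Set.MapsTo (fun y => (ε, y)) D (familyDomain s τ)) (f : smoothAlg (familyDomain s τ))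
    (x : D) : (member hm f).1 x = f.1 ⟨(ε, x.1), hm x.2⟩ :=
  smoothAlg.pullback_apply _ _ _ f x

theorem member_coord {D : Set (Fin m → ℝ)} {ε : ℝ}
    (hm : Set.MapsTo (fun y => (ε, y)) D (familyDomain s τ)) (hD' : UniqueDiffOn ℝ D)
    (hD : UniqueDiffOn ℝ (familyDomain s τ)) (a : Fin m) (f : smoothAlg (familyDomain s τ)) :
    member hm (famCoord hD a f) = coord hD' a (member hm f) :=
  smoothAlg.pullback_deriv _ _ _ _ _ (fun y => by
    have : HasFDerivAt (fun y : Fin m → ℝ => (ε, y))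
        ((0 : (Fin m → ℝ) →L[ℝ] ℝ).prod (ContinuousLinearMap.id ℝ _)) y :=
      (hasFDerivAt_const ε y).prodMk (hasFDerivAt_id y)
    rw [this.fderiv]
    rfl) f

theorem member_constFamily {D : Set (Fin m → ℝ)} {ε : ℝ}
    (hm : Set.MapsTo (fun y => (ε, y)) D (familyDomain s τ)) (f : smoothAlg S) (x : D) :
    (member hm (constFamily s τ f)).1 x = f.1 ⟨x.1, (hm x.2).1⟩ := by
  rw [member_apply]
  exact smoothAlg.pullback_apply _ _ _ f _

/-- The parameter `ε`, as a function. -/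
def param (s τ : smoothAlg S) : smoothAlg (familyDomain s τ) :=
  smoothAlg.mk Prod.fst contDiff_fst.contDiffOn

theorem famCoord_param (hD : UniqueDiffOn ℝ (familyDomain s τ)) (a : Fin m) :
    famCoord hD a (param s τ) = 0 := by
  ext p
  rw [famCoord, smoothAlg.deriv_apply_of_eq hD _ _ (F := Prod.fst) fun _ => rfl,
    fderivWithin_fst (hD p p.2)]
  rfl

/-- A family of functions is determined, by continuity, by its members with nonzero parameter. -/
theorem param_regular (f : smoothAlg (familyDomain s τ)) (h : param s τ * f = 0) : f = 0 := by
  have h1 : ∀ p : familyDomain s τ, p.1.1 * f.1 p = 0 := fun p =>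
    congrArg (fun f : smoothAlg (familyDomain s τ) => f.1 p) h
  have h2 : ∀ p : familyDomain s τ, p.1.1 ≠ 0 → f.1 p = 0 := fun p hp =>
    (mul_eq_zero.1 (h1 p)).resolve_left hp
  ext p
  by_cases hp : p.1.1 = 0
  swap
  · exact h2 p hp
  obtain ⟨V, hV, hDV⟩ := exists_familyDomain_eq s τ
  have hpV : p.1 ∈ V := (hDV.subset p.2).2
  set c : ℝ → ℝ × (Fin m → ℝ) := fun ε => (ε, p.1.2) with hc
  have hc0 : c 0 = p.1 := by rw [hc, ← hp]
  have hcc : Continuous c := by fun_prop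
  have hev : ∀ᶠ ε in nhdsWithin (0 : ℝ) {0}ᶜ, c ε ∈ familyDomain s τ := by
    refine Filter.Eventually.filter_mono nhdsWithin_le_nhds ?_
    filter_upwards [(hV.preimage hcc).mem_nhds (by rw [Set.mem_preimage, hc0]; exact hpV)] with ε hε
    rw [hDV]
    exact ⟨⟨trivial, p.2.1⟩, hε⟩
  have hlim : Filter.Tendsto (fun ε => ext₀ f.1 (c ε)) (nhdsWithin (0 : ℝ) {0}ᶜ)
      (nhds (ext₀ f.1 p.1)) := by
    refine (f.contDiffOn.continuousOn p.1 p.2).tendsto.comp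
      (tendsto_nhdsWithin_iff.2 ⟨?_, hev⟩)
    rw [← hc0]
    exact (hcc.tendsto 0).mono_left nhdsWithin_le_nhds
  have hzero : Filter.Tendsto (fun ε => ext₀ f.1 (c ε)) (nhdsWithin (0 : ℝ) {0}ᶜ) (nhds 0) := by
    refine tendsto_const_nhds.congr' ?_
    filter_upwards [hev, self_mem_nhdsWithin] with ε hε hne
    exact ((ext₀_coe f.1 ⟨c ε, hε⟩).trans (h2 ⟨c ε, hε⟩ hne)).symm
  rw [← ext₀_coe f.1 p]
  exact tendsto_nhds_unique hlim hzero

theorem exists_inv_family (s τ : smoothAlg S) :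
    ∃ u, (param s τ * constFamily s τ s - constFamily s τ τ) * u = 1 := by
  refine (smoothAlg.isUnit_of_ne_zero fun p => ?_).exists_right_inv
  exact p.2.2

end Family

/-! ### The heat operator as a function of the parameter -/

noncomputable section HeatForm

variable {n : ℕ}

/-- The components of `∇U` at a point, in terms of the values `u` of `U` and `w` of `∂_0 U`: the
space derivatives are those prescribed by the extension conditions, and `Γ₀ a e = Γ^a_{0e}`. -/
def nablaForm (τ : ℝ) (u w : Fin (n + 1) → Fin (n + 1) → ℝ) (Γ₀ : Fin (n + 1) → Fin (n + 1) → ℝ)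
    (k a b : Fin (n + 1)) : ℝ :=
  Fin.cases (w a b + ∑ e, (Γ₀ a e * u e b + Γ₀ b e * u a e))
    (fun l => τ * wedge (u 0) l.succ a b) k

/-- The value of the heat operator on `Rm(U, U)` at a point, for a bivector that satisfies the
extension conditions: `H` is the inverse metric, `Rm` the curvature tensor, `B` its
covariant derivative and `A` the heat operator on it. -/
def heatForm (τ : ℝ) (u w : Fin (n + 1) → Fin (n + 1) → ℝ)
    (H Γ₀ : Fin (n + 1) → Fin (n + 1) → ℝ)
    (A Rm : Fin (n + 1) → Fin (n + 1) → Fin (n + 1) → Fin (n + 1) → ℝ)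
    (B : Fin (n + 1) → Fin (n + 1) → Fin (n + 1) → Fin (n + 1) → Fin (n + 1) → ℝ) : ℝ :=
  contract u u A + 2 * τ * contract (wedge (u 0) 0) u Rm
    - 4 * ∑ k, ∑ l, H k l * contract (nablaForm τ u w Γ₀ l) u (B k)
    - 2 * ∑ k, ∑ l, H k l * contract (nablaForm τ u w Γ₀ k) (nablaForm τ u w Γ₀ l) Rm

/-- Where the inverse metric has no time components, the time derivative of `U` does not enter. -/
theorem heatForm_of_degenerate (τ : ℝ) (u w : Fin (n + 1) → Fin (n + 1) → ℝ)
    {H : Fin (n + 1) → Fin (n + 1) → ℝ} (Γ₀ : Fin (n + 1) → Fin (n + 1) → ℝ)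
    (A Rm : Fin (n + 1) → Fin (n + 1) → Fin (n + 1) → Fin (n + 1) → ℝ)
    (B : Fin (n + 1) → Fin (n + 1) → Fin (n + 1) → Fin (n + 1) → Fin (n + 1) → ℝ)
    (hH : ∀ a, H 0 a = 0) (hH' : ∀ a, H a 0 = 0) :
    heatForm τ u w H Γ₀ A Rm B = contract u u A + 2 * τ * contract (wedge (u 0) 0) u Rm
      - 4 * τ * ∑ k, ∑ l, H k l * contract (wedge (u 0) l) u (B k)
      - 2 * τ ^ 2 * ∑ k, ∑ l, H k l * contract (wedge (u 0) k) (wedge (u 0) l) Rm := by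
  have h1 : ∀ l : Fin n, nablaForm τ u w Γ₀ l.succ = fun a b => τ * wedge (u 0) l.succ a b :=
    fun _ => rfl
  rw [heatForm]
  simp only [Fin.sum_univ_succ, hH, hH', zero_mul, zero_add, Finset.sum_const_zero, h1,
    contract_smul_left, contract_smul_right, mul_left_comm _ τ, ← Finset.mul_sum]
  ring

section Smooth

variable {W : Type*} [NormedAddCommGroup W] [NormedSpace ℝ W] {X : Set W} {κ : Type*} [Fintype κ]

theorem contDiffOn_contract {A B : W → κ → κ → ℝ} {T : W → κ → κ → κ → κ → ℝ}
    (hA : ∀ a b, ContDiffOn ℝ 1 (fun p => A p a b) X)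
    (hB : ∀ a b, ContDiffOn ℝ 1 (fun p => B p a b) X)
    (hT : ∀ a b c g, ContDiffOn ℝ 1 (fun p => T p a b c g) X) :
    ContDiffOn ℝ 1 (fun p => contract (A p) (B p) (T p)) X :=
  ContDiffOn.sum fun a _ => ContDiffOn.sum fun b _ => ContDiffOn.sum fun c _ =>
    ContDiffOn.sum fun g _ => ((hT a b c g).mul (hA a b)).mul (hB c g)

theorem contDiffOn_wedge {u : W → Fin (n + 1) → Fin (n + 1) → ℝ}
    (hu : ∀ a b, ContDiffOn ℝ 1 (fun p => u p a b) X) (l a b : Fin (n + 1)) :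
    ContDiffOn ℝ 1 (fun p => wedge (u p 0) l a b) X :=
  (contDiffOn_const.mul (hu 0 b)).sub (contDiffOn_const.mul (hu 0 a))

theorem contDiffOn_nablaForm (τ : ℝ) {u w Γ₀ : W → Fin (n + 1) → Fin (n + 1) → ℝ}
    (hu : ∀ a b, ContDiffOn ℝ 1 (fun p => u p a b) X)
    (hw : ∀ a b, ContDiffOn ℝ 1 (fun p => w p a b) X)
    (hΓ : ∀ a b, ContDiffOn ℝ 1 (fun p => Γ₀ p a b) X) (k a b : Fin (n + 1)) :
    ContDiffOn ℝ 1 (fun p => nablaForm τ (u p) (w p) (Γ₀ p) k a b) X := by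
  cases k using Fin.cases with
  | zero =>
    exact (hw a b).add (ContDiffOn.sum fun e _ =>
      ((hΓ a e).mul (hu e b)).add ((hΓ b e).mul (hu a e)))
  | succ l => exact contDiffOn_const.mul (contDiffOn_wedge hu l.succ a b)

theorem contDiffOn_heatForm (τ : ℝ) {u w Γ₀ H : W → Fin (n + 1) → Fin (n + 1) → ℝ}
    {A Rm : W → Fin (n + 1) → Fin (n + 1) → Fin (n + 1) → Fin (n + 1) → ℝ}
    {B : W → Fin (n + 1) → Fin (n + 1) → Fin (n + 1) → Fin (n + 1) → Fin (n + 1) → ℝ}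
    (hu : ∀ a b, ContDiffOn ℝ 1 (fun p => u p a b) X)
    (hw : ∀ a b, ContDiffOn ℝ 1 (fun p => w p a b) X)
    (hH : ∀ a b, ContDiffOn ℝ 1 (fun p => H p a b) X)
    (hΓ : ∀ a b, ContDiffOn ℝ 1 (fun p => Γ₀ p a b) X)
    (hA : ∀ a b c g, ContDiffOn ℝ 1 (fun p => A p a b c g) X)
    (hR : ∀ a b c g, ContDiffOn ℝ 1 (fun p => Rm p a b c g) X)
    (hB : ∀ k a b c g, ContDiffOn ℝ 1 (fun p => B p k a b c g) X) :
    ContDiffOn ℝ 1 (fun p => heatForm τ (u p) (w p) (H p) (Γ₀ p) (A p) (Rm p) (B p)) X := by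
  have hY := contDiffOn_nablaForm τ hu hw hΓ
  refine (((contDiffOn_contract hu hu hA).add (contDiffOn_const.mul
    (contDiffOn_contract (contDiffOn_wedge hu 0) hu hR))).sub (contDiffOn_const.mul
    (ContDiffOn.sum fun k _ => ContDiffOn.sum fun l _ => (hH k l).mul ?_))).sub
    (contDiffOn_const.mul
    (ContDiffOn.sum fun k _ => ContDiffOn.sum fun l _ => (hH k l).mul ?_))
  · exact contDiffOn_contract (hY l) hu (hB k)
  · exact contDiffOn_contract (hY k) (hY l) hR

end Smooth

/-- The heat form depends on the parameter in a Lipschitz way, uniformly for bounded `u` and `w`. -/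
theorem exists_heatForm_sub_le (τ K ε₁ : ℝ) {Γ₀ H : ℝ → Fin (n + 1) → Fin (n + 1) → ℝ}
    {A Rm : ℝ → Fin (n + 1) → Fin (n + 1) → Fin (n + 1) → Fin (n + 1) → ℝ}
    {B : ℝ → Fin (n + 1) → Fin (n + 1) → Fin (n + 1) → Fin (n + 1) → Fin (n + 1) → ℝ}
    (hH : ∀ a b, ContDiffOn ℝ 1 (fun p => H p a b) (Set.Icc 0 ε₁))
    (hΓ : ∀ a b, ContDiffOn ℝ 1 (fun p => Γ₀ p a b) (Set.Icc 0 ε₁))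
    (hA : ∀ a b c g, ContDiffOn ℝ 1 (fun p => A p a b c g) (Set.Icc 0 ε₁))
    (hR : ∀ a b c g, ContDiffOn ℝ 1 (fun p => Rm p a b c g) (Set.Icc 0 ε₁))
    (hB : ∀ k a b c g, ContDiffOn ℝ 1 (fun p => B p k a b c g) (Set.Icc 0 ε₁)) :
    ∃ C : ℝ, ∀ ε ∈ Set.Icc 0 ε₁, ∀ u w : Fin (n + 1) → Fin (n + 1) → ℝ,
      (∀ a b, |u a b| ≤ K) → (∀ a b, |w a b| ≤ K) →
      |heatForm τ u w (H ε) (Γ₀ ε) (A ε) (Rm ε) (B ε)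
        - heatForm τ u w (H 0) (Γ₀ 0) (A 0) (Rm 0) (B 0)| ≤ C * ε := by
  set X : Set (ℝ × (Fin (n + 1) → Fin (n + 1) → ℝ) × (Fin (n + 1) → Fin (n + 1) → ℝ)) :=
    Set.Icc 0 ε₁ ×ˢ (Metric.closedBall 0 K ×ˢ Metric.closedBall 0 K) with hX
  have hm : Set.MapsTo Prod.fst X (Set.Icc 0 ε₁) := fun p hp => hp.1
  have hu : ∀ a b, ContDiffOn ℝ 1 (fun p : ℝ × (Fin (n + 1) → Fin (n + 1) → ℝ) ×
      (Fin (n + 1) → Fin (n + 1) → ℝ) => p.2.1 a b) X := fun a b => by fun_prop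
  have hw : ∀ a b, ContDiffOn ℝ 1 (fun p : ℝ × (Fin (n + 1) → Fin (n + 1) → ℝ) ×
      (Fin (n + 1) → Fin (n + 1) → ℝ) => p.2.2 a b) X := fun a b => by fun_prop
  have hF := contDiffOn_heatForm τ hu hw
    (fun a b => (hH a b).comp contDiffOn_fst hm) (fun a b => (hΓ a b).comp contDiffOn_fst hm)
    (fun a b c g => (hA a b c g).comp contDiffOn_fst hm)
    (fun a b c g => (hR a b c g).comp contDiffOn_fst hm)
    (fun k a b c g => (hB k a b c g).comp contDiffOn_fst hm)
  obtain ⟨C, hC⟩ := hF.exists_lipschitzOnWith one_ne_zero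
    ((convex_Icc _ _).prod ((convex_closedBall _ _).prod (convex_closedBall _ _)))
    (isCompact_Icc.prod ((isCompact_closedBall _ _).prod (isCompact_closedBall _ _)))
  refine ⟨C, fun ε hε u w hu hw => ?_⟩
  have hK : 0 ≤ K := (abs_nonneg _).trans (hu 0 0)
  have hball : ∀ v : Fin (n + 1) → Fin (n + 1) → ℝ, (∀ a b, |v a b| ≤ K) →
      v ∈ Metric.closedBall 0 K := fun v hv => by
    rw [mem_closedBall_zero_iff, pi_norm_le_iff_of_nonneg hK]
    exact fun a => (pi_norm_le_iff_of_nonneg hK).2 fun b => hv a b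
  have h1 : (ε, u, w) ∈ X := ⟨hε, hball u hu, hball w hw⟩
  have h0 : ((0 : ℝ), u, w) ∈ X := ⟨⟨le_rfl, hε.1.trans hε.2⟩, hball u hu, hball w hw⟩
  have := hC.dist_le_mul _ h1 _ h0
  rw [Real.dist_eq] at this
  refine this.trans (le_of_eq ?_)
  rw [Prod.dist_eq]
  simp [hε.1]

end HeatForm

/-! ### Bivectors satisfying the extension conditions -/

noncomputable section Extended

variable {n : ℕ}

theorem antisymm_ext {X Z : Fin (n + 1) → Fin (n + 1) → ℝ} (hX : ∀ a b, X a b = -X b a)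
    (hZ : ∀ a b, Z a b = -Z b a) (h0 : ∀ j : Fin n, X 0 j.succ = Z 0 j.succ)
    (h : ∀ i j : Fin n, X i.succ j.succ = Z i.succ j.succ) : X = Z := by
  funext a b
  cases a using Fin.cases with
  | zero =>
    cases b using Fin.cases with
    | zero => linarith [hX 0 0, hZ 0 0]
    | succ j => exact h0 j
  | succ i =>
    cases b using Fin.cases with
    | zero => rw [hX, hZ, h0]
    | succ j => exact h i j

theorem wedge_antisymm {𝒜 ι : Type*} [CommRing 𝒜] [DecidableEq ι] (X : ι → 𝒜) (l a b : ι) :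
    wedge X l a b = -wedge X l b a := by
  rw [wedge, wedge]; ring

variable {S : Set (Fin (n + 1) → ℝ)} {G : (Fin (n + 1) → ℝ) → Matrix (Fin (n + 1)) (Fin (n + 1)) ℝ}
  {V : (Fin (n + 1) → ℝ) → Fin (n + 1) → Fin (n + 1) → ℝ}

theorem nabla_antisymm (hS : UniqueDiffOn ℝ S) (hV : ∀ y ∈ S, ∀ a b, V y a b = -V y b a)
    (k : Fin (n + 1)) (y : Fin (n + 1) → ℝ) (hy : y ∈ S) (a b : Fin (n + 1)) :
    nabla G S V k y a b = -nabla G S V k y b a := by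
  have h1 : pd S k (fun y => V y a b) y = -pd S k (fun y => V y b a) y := by
    rw [pd_congr (g := fun y => -V y b a)
      (Filter.eventually_of_mem self_mem_nhdsWithin fun y hy => hV y hy a b) hy]
    simp only [pd]
    rw [fderivWithin_fun_neg (hS y hy)]
    rfl
  simp only [nabla, nablaContra, Matrix.of_apply, h1, neg_add, ← Finset.sum_neg_distrib]
  congr 1
  exact Finset.sum_congr rfl fun e _ => by rw [hV y hy e b, hV y hy a e]; ring

variable {D : Set (Fin (n + 1) → ℝ)} {hD : UniqueDiffOn ℝ D}
  {g H : Fin (n + 1) → Fin (n + 1) → smoothAlg D}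
  {Γ : Fin (n + 1) → Fin (n + 1) → Fin (n + 1) → smoothAlg D}
  {R : Fin (n + 1) → Fin (n + 1) → Fin (n + 1) → Fin (n + 1) → smoothAlg D}

/-- The heat operator on `Rm(V, V)` at a point where `V` satisfies the extension conditions. The second
derivatives of `V` enter through `(∇_0 - Δ) V` only, so they are determined by the conditions. -/
theorem heatScalar_eq_heatForm (hS : UniqueDiffOn ℝ S) (hDS : ∃ V, IsOpen V ∧ D = S ∩ V)
    (hM : IsMetric (coord hD) g H Γ R) (hG : ∀ (x : D) a b, G x a b = (g a b).1 x)
    (pair : ∀ a b c f, R a b c f = R c f a b) (x : D)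
    (hV : ∀ y ∈ S, ∀ a b, V y a b = -V y b a)
    (hV2 : ∀ a b, ContDiffWithinAt ℝ 2 (fun y => V y a b) S x)
    (hE : IsExtendedAt G S (fun y => Matrix.of (V y)) x) :
    heatScalar G S (curvForm G S (fun y => Matrix.of (V y))) x
      = heatForm (1 / (2 * x.1 0)) (V x) (fun a b => pd S 0 (fun y => V y a b) x)
        (fun a b => (H a b).1 x) (fun a b => (Γ a 0 b).1 x)
        (fun a b c f => (cov₄ (coord hD) Γ R 0 a b c f - ∑ k, ∑ l, H k l *
          covTwice₄ (coord hD) Γ R l k a b c f).1 x)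
        (fun a b c f => (R a b c f).1 x)
        (fun k a b c f => (cov₄ (coord hD) Γ R k a b c f).1 x) := by
  have hx : x.1 ∈ S := by obtain ⟨V, _, rfl⟩ := hDS; exact x.2.1
  have hΓ := hM.christoffel_eq hDS hG
  have hH := hM.inv_eq hG x
  have h0 : V x 0 0 = 0 := by linarith [hV x hx 0 0]
  have hτ : (1 : ℝ) / (4 * x.1 0) = 1 / (2 * x.1 0) / 2 := by
    rw [div_div]; ring
  set τ := (1 : ℝ) / (2 * x.1 0) with hτdef
  have hN := nabla_antisymm (G := G) hS hV
  have hNN := fun k => nabla_antisymm (G := G) hS (hN k)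
  have hnabla : ∀ k, nabla G S V k x = nablaForm τ (V x) (fun a b => pd S 0 (fun y => V y a b) x)
      (fun a b => (Γ a 0 b).1 x) k := by
    intro k
    cases k using Fin.cases with
    | zero =>
      funext a b
      simp only [nabla, nablaContra, nablaForm, hΓ, Fin.cases_zero, Matrix.of_apply]
    | succ l =>
      refine antisymm_ext (hN l.succ x hx)
        (fun a b => ?_) (fun j => ?_) (fun i j => ?_)
      · simp only [nablaForm, Fin.cases_succ]
        rw [wedge_antisymm]; ring
      · -- `timePart` is twice the tensor component
        have h1 : 2 * nabla G S V l.succ x 0 j.succ = 0 := hE.nabla_time l j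
        have h2 : nabla G S V l.succ x 0 j.succ = 0 := by linarith
        rw [h2]
        simp [nablaForm, wedge, h0, (Fin.succ_ne_zero l).symm]
      · have h1 : nabla G S V l.succ x i.succ j.succ = 1 / (4 * x.1 0) *
          ((if i = l then 1 else 0) * (2 * V x 0 j.succ)
            - (if j = l then 1 else 0) * (2 * V x 0 i.succ)) := hE.nabla_space l i j
        rw [h1, hτ]
        simp only [nablaForm, wedge, Fin.cases_succ, Fin.succ_inj]
        ring
  have hheat : (fun a b => nablaContra G S (fun y => Matrix.of (V y)) 0 a b x
      - laplacianContra G S (fun y => Matrix.of (V y)) a b x)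
      = fun a b => τ * wedge (V x 0) 0 a b := by
    refine antisymm_ext (fun a b => ?_) (fun a b => ?_) (fun j => ?_) (fun i j => ?_)
    · have h1 := hN 0 x hx a b
      simp only [nabla] at h1
      simp only [laplacianContra, nablaContraTwice_eq]
      rw [h1]
      have h2 : ∑ c, ∑ e, (G x)⁻¹ c e * (nabla G S (nabla G S V e) c x a b
            - ∑ f, HyperbolicThermostat.christoffel G S f c e x * nabla G S V f x a b)
          = -∑ c, ∑ e, (G x)⁻¹ c e * (nabla G S (nabla G S V e) c x b a
            - ∑ f, HyperbolicThermostat.christoffel G S f c e x * nabla G S V f x b a) := by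
        simp only [← Finset.sum_neg_distrib]
        refine Finset.sum_congr rfl fun c _ => Finset.sum_congr rfl fun e _ => ?_
        rw [hNN e c x hx a b]
        simp only [hN _ x hx a b, mul_neg, Finset.sum_neg_distrib]
        ring
      rw [h2]
      ring
    · rw [wedge_antisymm]; ring
    · have h1 := hE.heat_time j
      have h2 : 2 * (nablaContra G S (fun y => Matrix.of (V y)) 0 0 j.succ x
        - laplacianContra G S (fun y => Matrix.of (V y)) 0 j.succ x) = τ * (2 * V x 0 j.succ) := h1
      simp only [wedge, if_true, (Fin.succ_ne_zero j), if_false]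
      linarith
    · have h1 : nablaContra G S (fun y => Matrix.of (V y)) 0 i.succ j.succ x
        - laplacianContra G S (fun y => Matrix.of (V y)) i.succ j.succ x = 0 := hE.heat_space i j
      rw [h1]
      simp [wedge, Fin.succ_ne_zero]
  have key := heat_curvForm hDS hD hS hΓ (hM.riem_eq hDS hG) pair x
    (fun a b => by rw [hH, hH, hM.symm_inv]) hV2 0
  rw [heatScalar, key, hheat, heatForm, contract_smul_left]
  simp only [hnabla, hH, smoothAlg.sub_val, smoothAlg.sum_val, smoothAlg.mul_val]
  ring

end Extended

/-! ### The family of thermostat metrics -/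

noncomputable section ThermoFamily

variable {n : ℕ} {S : Set (Fin (n + 1) → ℝ)} {γ γi : Fin n → Fin n → smoothAlg S}
  {Γ : Fin n → Fin n → Fin n → smoothAlg S} {R : Fin n → Fin n → Fin n → Fin n → smoothAlg S}
  {τ : smoothAlg S}

/-- The inverses of the thermostat metrics, as a family with parameter `ε`. -/
def familyInv (γi : Fin n → Fin n → smoothAlg S)
    (R : Fin n → Fin n → Fin n → Fin n → smoothAlg S) (τ : smoothAlg S)
    (u : smoothAlg (familyDomain (sca γi R) τ)) (a b : Fin (n + 1)) :
    smoothAlg (familyDomain (sca γi R) τ) :=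
  thermoInv (fun i j => constFamily _ _ (γi i j)) (param _ _) u a b

/-- The Christoffel symbols of the thermostat metrics, as a family with parameter `ε`. -/
def familyConn (γi : Fin n → Fin n → smoothAlg S) (Γ : Fin n → Fin n → Fin n → smoothAlg S)
    (R : Fin n → Fin n → Fin n → Fin n → smoothAlg S) (τ : smoothAlg S)
    (hD : UniqueDiffOn ℝ (familyDomain (sca γi R) τ))
    (u : smoothAlg (familyDomain (sca γi R) τ)) (a b c : Fin (n + 1)) :
    smoothAlg (familyDomain (sca γi R) τ) :=
  thermoConn (famCoord hD) (fun i j => constFamily _ _ (γi i j))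
    (fun i j k => constFamily _ _ (Γ i j k)) (fun i j k l => constFamily _ _ (R i j k l))
    (constFamily _ _ τ) (param _ _) u a b c

/-- The curvature tensors of the thermostat metrics, as a family with parameter `ε`. -/
def familyCurv (γ γi : Fin n → Fin n → smoothAlg S) (Γ : Fin n → Fin n → Fin n → smoothAlg S)
    (R : Fin n → Fin n → Fin n → Fin n → smoothAlg S) (τ : smoothAlg S)
    (hD : UniqueDiffOn ℝ (familyDomain (sca γi R) τ))
    (u : smoothAlg (familyDomain (sca γi R) τ)) (a b c f : Fin (n + 1)) :
    smoothAlg (familyDomain (sca γi R) τ) :=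
  thermoCurv (famCoord hD) (fun i j => constFamily _ _ (γ i j))
    (fun i j => constFamily _ _ (γi i j)) (fun i j k => constFamily _ _ (Γ i j k))
    (fun i j k l => constFamily _ _ (R i j k l)) (constFamily _ _ τ) (param _ _) u a b c f

variable {u : smoothAlg (familyDomain (sca γi R) τ)}
  {hD : UniqueDiffOn ℝ (familyDomain (sca γi R) τ)}

/-- The curvature identities hold for the whole family, including the degenerate member. -/
theorem IsFlow.isCurvature_family {hS : UniqueDiffOn ℝ S} (hF : IsFlow (coord hS) γ γi Γ R τ)
    (hD' : IsRegularDomain (familyDomain (sca γi R) τ))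
    (hu : (param _ _ * constFamily _ _ (sca γi R) - constFamily _ _ τ) * u = 1) :
    IsCurvature (famCoord hD) (familyConn γi Γ R τ hD u) (familyInv γi R τ u)
      (familyCurv γ γi Γ R τ hD u) :=
  (hF.map (constFamily_coord hS hD) fun _ _ f => smoothAlg.deriv_comm hD' _ _ f).isCurvature_thermo
    (famCoord_param hD) param_regular (by rw [← map_sca]; exact hu)

section Member

variable {D : Set (Fin (n + 1) → ℝ)} {ε : ℝ}
  (hm : Set.MapsTo (fun y => (ε, y)) D (familyDomain (sca γi R) τ))

theorem member_param {m : ℕ} {S D : Set (Fin m → ℝ)} {s τ : smoothAlg S}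
    (hm : Set.MapsTo (fun y => (ε, y)) D (familyDomain s τ)) :
    member hm (param s τ) = algebraMap ℝ _ ε := by
  ext x
  rw [member_apply]
  rfl

theorem member_inv (hu : (param _ _ * constFamily _ _ (sca γi R) - constFamily _ _ τ) * u = 1) :
    (algebraMap ℝ _ ε * member hm (constFamily _ _ (sca γi R)) - member hm (constFamily _ _ τ))
      * member hm u = 1 := by
  rw [← member_param hm, ← map_mul, ← map_sub, ← map_mul, hu, map_one]

/-- For `ε ≠ 0` the member of the family with parameter `ε` belongs to the thermostat metric with
parameter `N = ν = 1/ε`. -/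
theorem IsFlow.isMetric_member {hS : UniqueDiffOn ℝ S} (hF : IsFlow (coord hS) γ γi Γ R τ)
    (hu : (param _ _ * constFamily _ _ (sca γi R) - constFamily _ _ τ) * u = 1)
    (hD' : IsRegularDomain D) {ν : ℝ} (hν : ν * ε = 1) :
    IsMetric (coord hD'.uniqueDiffOn) (fun a b => algebraMap ℝ _ ν * scaledMetric
        (fun i j => member hm (constFamily _ _ (γ i j)))
        (fun i j => member hm (constFamily _ _ (γi i j)))
        (fun i j k l => member hm (constFamily _ _ (R i j k l)))
        (member hm (constFamily _ _ τ)) (algebraMap ℝ _ ε) a b)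
      (fun a b => member hm (familyInv γi R τ u a b))
      (fun a b c => member hm (familyConn γi Γ R τ hD u a b c))
      (fun a b c f => member hm (familyCurv γ γi Γ R τ hD u a b c f)) := by
  have hc := member_coord hm hD'.uniqueDiffOn hD
  have hF' := hF.map (π := (member hm).comp (constFamily (sca γi R) τ))
    (d' := coord hD'.uniqueDiffOn)
    (fun a f => by
      rw [AlgHom.comp_apply, constFamily_coord hS hD, hc]
      rfl)
    fun _ _ f => smoothAlg.deriv_comm hD' _ _ f
  have h := hF'.isMetric_thermo (ε := algebraMap ℝ _ ε) (ν := algebraMap ℝ _ ν) (u := member hm u)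
    (fun a => Derivation.map_algebraMap _ _) (by rw [← map_mul, hν, map_one])
    (fun a => Derivation.map_algebraMap _ _)
    (by rw [← map_sca]; exact member_inv hm hu)
  simp only [familyInv, familyConn, familyCurv, map_thermoInv, map_thermoConn hc,
    map_thermoCurv hc, member_param]
  exact h

end Member

section Degenerate

variable (hm : Set.MapsTo (fun y => ((0 : ℝ), y)) S (familyDomain (sca γi R) τ))

theorem member_zero_constFamily (f : smoothAlg S) : member hm (constFamily _ _ f) = f := by
  ext x
  rw [member_constFamily]

theorem member_zero_inv
    (hu : (param _ _ * constFamily _ _ (sca γi R) - constFamily _ _ τ) * u = 1) :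
    τ * member hm u = -1 := by
  have h := member_inv hm hu
  rw [member_zero_constFamily, member_zero_constFamily, map_zero] at h
  linear_combination -h

theorem member_zero_familyInv (a b : Fin (n + 1)) :
    member hm (familyInv γi R τ u a b) = thermoInv γi 0 (member hm u) a b := by
  rw [familyInv, map_thermoInv, member_param, map_zero]
  simp only [member_zero_constFamily]

theorem member_zero_familyConn (hS : UniqueDiffOn ℝ S) (a b c : Fin (n + 1)) :
    member hm (familyConn γi Γ R τ hD u a b c)
      = thermoConn (coord hS) γi Γ R τ 0 (member hm u) a b c := by
  rw [familyConn, map_thermoConn (member_coord hm hS hD), member_param, map_zero]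
  simp only [member_zero_constFamily]

end Degenerate

end ThermoFamily

/-! ### The limit of the family and the reaction terms -/

noncomputable section Limit

variable {n : ℕ} {S : Set (Fin (n + 1) → ℝ)} {hS : UniqueDiffOn ℝ S}
  {γ γi : Fin n → Fin n → smoothAlg S}
  {Γ : Fin n → Fin n → Fin n → smoothAlg S} {R : Fin n → Fin n → Fin n → Fin n → smoothAlg S}
  {τ u₀ : smoothAlg S}
  {Rm : Fin (n + 1) → Fin (n + 1) → Fin (n + 1) → Fin (n + 1) → smoothAlg S}

/-- At `ε = 0` the heat operator on `Rm(U, U)` is given by the reaction terms. -/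
theorem IsFlow.heatForm_zero (hF : IsFlow (coord hS) γ γi Γ R τ) (hu : τ * u₀ = -1)
    (hC : IsCurvature (coord hS) (thermoConn (coord hS) γi Γ R τ 0 u₀) (thermoInv γi 0 u₀) Rm)
    (z : S) {v : Fin (n + 1) → Fin (n + 1) → ℝ} (hv : ∀ a b, v a b = -v b a)
    (w Γ₀ : Fin (n + 1) → Fin (n + 1) → ℝ) :
    heatForm (τ.1 z) v w (fun a b => (thermoInv γi 0 u₀ a b).1 z) Γ₀
      (fun a b c f => (cov₄ (coord hS) (thermoConn (coord hS) γi Γ R τ 0 u₀) Rm 0 a b c f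
        - ∑ k, ∑ l, thermoInv γi 0 u₀ k l *
          covTwice₄ (coord hS) (thermoConn (coord hS) γi Γ R τ 0 u₀) Rm l k a b c f).1 z)
      (fun a b c f => (Rm a b c f).1 z)
      (fun k a b c f => (cov₄ (coord hS) (thermoConn (coord hS) γi Γ R τ 0 u₀) Rm k a b c f).1 z)
      = reactionForm (fun i j => (γi i j).1 z) (fun i j k l => (R i j k l).1 z)
        (fun i j k => (curlRic (spatial (coord hS)) Γ γi R i j k).1 z)
        (fun i j => (Rm 0 i.succ 0 j.succ).1 z) (fun i => 2 * v 0 i.succ)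
        (fun i j => v i.succ j.succ) := by
  have hH : ∀ a, (thermoInv γi 0 u₀ 0 a).1 z = 0 := fun a => by rw [thermoInv_zero]; rfl
  have hH' : ∀ a, (thermoInv γi 0 u₀ a 0).1 z = 0 := fun a => by rw [thermoInv_zero']; rfl
  rw [heatForm_of_degenerate _ _ _ _ _ _ _ hH hH']
  have key := congrArg (smoothAlg.eval z) (hF.limit_contract hu hC
    (U := fun a b => algebraMap ℝ (smoothAlg S) (v a b)) (fun a b => by rw [hv, map_neg]))
  have e : ∀ x : ℝ, smoothAlg.eval z (algebraMap ℝ (smoothAlg S) x) = x := fun x =>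
    (smoothAlg.eval z).commutes x
  have h4 : smoothAlg.eval z 4 = 4 := map_ofNat _ 4
  have h2 : smoothAlg.eval z 2 = 2 := map_ofNat _ 2
  have hw : ∀ l a b, smoothAlg.eval z (wedge (fun b => algebraMap ℝ (smoothAlg S) (v 0 b)) l a b)
      = wedge (v 0) l a b := fun l a b => by
    rw [wedge, wedge]
    split_ifs <;> simp [e]
  simp only [map_add, map_sub, map_mul, map_sum, map_pow, map_contract, map_curvOp, map_curvSharp,
    e, h2, h4, hw] at key
  simp only [smoothAlg.eval_apply] at key
  simp only [smoothAlg.sub_val, smoothAlg.sum_val, smoothAlg.mul_val]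
  rw [key]
  have hr := reactionForm_eq (H := fun a b => (thermoInv γi 0 u₀ a b).1 z)
    (h := fun i j => (γi i j).1 z) (R := fun a b c f => (Rm a b c f).1 z) hH hH'
    (fun i j => by rw [thermoInv_succ]) (fun i j => by rw [hF.symm_inv])
    (fun a b c f => by rw [hC.anti₁]; rfl) (fun a b c f => by rw [hC.anti₂]; rfl)
    (fun a b c f => by rw [hC.pair]) hv (by linarith [hv 0 0])
  simp only [hF.limit_space hu hC, hF.limit_mixed hu hC] at hr
  exact hr

end Limit

noncomputable section FlowLimit

variable {n : ℕ} {M : Type*} [TopologicalSpace M] [ChartedSpace (EuclideanSpace ℝ (Fin n)) M]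
  [IsManifold (𝓡 n) ∞ M] {e : OpenPartialHomeomorph M (EuclideanSpace ℝ (Fin n))} {T : ℝ}
  {g : ℝ → Bundle.ContMDiffRiemannianMetric (𝓡 n) ∞ (EuclideanSpace ℝ (Fin n))
      (fun x : M => TangentSpace (𝓡 n) x)}
  {hg : IsRicciFlow g T} {he : e ∈ IsManifold.maximalAtlas (𝓡 n) ∞ M}
  {hS : UniqueDiffOn ℝ (spacetimeRegion e T)}
  {h : Fin n → Fin n → smoothAlg (spacetimeRegion e T)}
  {Γ : Fin n → Fin n → Fin n → smoothAlg (spacetimeRegion e T)}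
  {R : Fin n → Fin n → Fin n → Fin n → smoothAlg (spacetimeRegion e T)}

theorem isMetric_slice (hF : IsFlow (coord hS) (flowMetric hg he) h Γ R (timeFun e T)) {t : ℝ}
    (ht : t ∈ Set.Ioc 0 T) :
    IsMetric (coord (isOpen_chartRegion e).uniqueDiffOn)
      (fun i j => restrictSlice ht (flowMetric hg he i j)) (fun i j => restrictSlice ht (h i j))
      (fun i j k => restrictSlice ht (Γ i j k)) (fun i j k l => restrictSlice ht (R i j k l)) :=
  hF.isMetric.map (restrictSlice_coord ht hS)

theorem exists_isOpen_eq_inter {X : Type*} [TopologicalSpace X] (S : Set X) :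
    ∃ V, IsOpen V ∧ S = S ∩ V := ⟨Set.univ, isOpen_univ, (Set.inter_univ _).symm⟩

theorem scal_chartMetric_eq (hF : IsFlow (coord hS) (flowMetric hg he) h Γ R (timeFun e T))
    (z : spacetimeRegion e T) :
    scal (chartMetric (g (z.1 0)) e) (chartRegion e) (Fin.tail z.1) = (sca h R).1 z := by
  rw [(isMetric_slice hF z.2.1).scal_eq (exists_isOpen_eq_inter _)
    (chartMetric_eq_restrictSlice hg he z.2.1) ⟨Fin.tail z.1, z.2.2⟩, ← map_sca,
    restrictSlice_apply z.2.1 _ z rfl]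

/-- The thermostat metric is the member of the family with parameter `ε = 1/N`. -/
theorem thermostatMetric_eq (hF : IsFlow (coord hS) (flowMetric hg he) h Γ R (timeFun e T))
    {N : ℕ} {ε : ℝ} (hε : N * ε = 1) {D : Set (Fin (n + 1) → ℝ)}
    (hm : Set.MapsTo (fun y => (ε, y)) D (familyDomain (sca h R) (timeFun e T)))
    (x : D) (a b : Fin (n + 1)) :
    thermostatMetric g e N x a b = (algebraMap ℝ _ (N : ℝ) * scaledMetric
        (fun i j => member hm (constFamily _ _ (flowMetric hg he i j)))
        (fun i j => member hm (constFamily _ _ (h i j)))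
        (fun i j k l => member hm (constFamily _ _ (R i j k l)))
        (member hm (constFamily _ _ (timeFun e T))) (algebraMap ℝ _ ε) a b).1 x := by
  have hx : x.1 ∈ spacetimeRegion e T := (hm x.2).1
  have e1 : ∀ c : ℝ, (algebraMap ℝ (smoothAlg D) c).1 x = c := fun c => rfl
  have e0 : (0 : smoothAlg D).1 x = 0 := rfl
  rw [smoothAlg.mul_val, e1]
  cases a using Fin.cases with
  | zero =>
    cases b using Fin.cases with
    | zero =>
      simp only [thermostatMetric, scaledMetric, Matrix.of_apply, Fin.cases_zero]
      have h1 := member_constFamily hm (sca h R) x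
      rw [map_sca, map_sca] at h1
      rw [smoothAlg.sub_val, smoothAlg.mul_val, e1, h1, member_constFamily,
        scal_chartMetric_eq hF ⟨x.1, hx⟩]
      change _ = (N : ℝ) * (ε * _ - 1 / (2 * x.1 0))
      linear_combination -(sca h R).1 ⟨x.1, hx⟩ * hε
    | succ j => simp [thermostatMetric, scaledMetric, e0]
  | succ i =>
    cases b using Fin.cases with
    | zero => simp [thermostatMetric, scaledMetric, e0]
    | succ j =>
      simp only [thermostatMetric, scaledMetric, Matrix.of_apply, Fin.cases_succ]
      rw [smoothAlg.mul_val, e1, member_constFamily]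
      change chartMetric _ _ _ _ _ = (N : ℝ) * (ε * chartMetric _ _ _ _ _)
      rw [← mul_assoc, hε, one_mul]

/-- At `ε = 0` the heat operator on `Rm(U, U)` is given by the reaction terms of the flow. -/
theorem heatForm_zero_eq_reaction
    (hF : IsFlow (coord hS) (flowMetric hg he) h Γ R (timeFun e T))
    {u₀ : smoothAlg (spacetimeRegion e T)} (hu : timeFun e T * u₀ = -1)
    {Rm : Fin (n + 1) → Fin (n + 1) → Fin (n + 1) → Fin (n + 1) → smoothAlg (spacetimeRegion e T)}
    (hC : IsCurvature (coord hS) (thermoConn (coord hS) h Γ R (timeFun e T) 0 u₀)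
      (thermoInv h 0 u₀) Rm)
    (z : spacetimeRegion e T) {v : Matrix (Fin (n + 1)) (Fin (n + 1)) ℝ}
    (hv : ∀ a b, v a b = -v b a) (w Γ₀ : Fin (n + 1) → Fin (n + 1) → ℝ) :
    heatForm (1 / (2 * z.1 0)) v w (fun a b => (thermoInv h 0 u₀ a b).1 z) Γ₀
      (fun a b c f => (cov₄ (coord hS) (thermoConn (coord hS) h Γ R (timeFun e T) 0 u₀) Rm 0 a b c f
        - ∑ k, ∑ l, thermoInv h 0 u₀ k l *
          covTwice₄ (coord hS) (thermoConn (coord hS) h Γ R (timeFun e T) 0 u₀) Rm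
            l k a b c f).1 z)
      (fun a b c f => (Rm a b c f).1 z)
      (fun k a b c f =>
        (cov₄ (coord hS) (thermoConn (coord hS) h Γ R (timeFun e T) 0 u₀) Rm k a b c f).1 z)
      = reaction (chartMetric (g (z.1 0)) e) (chartRegion e) (z.1 0) (timePart v) (spacePart v)
        (Fin.tail z.1) := by
  have hM := isMetric_slice hF z.2.1
  have hc := restrictSlice_coord z.2.1 hS
  have hr : ∀ f : smoothAlg (spacetimeRegion e T),
      (restrictSlice z.2.1 f).1 ⟨Fin.tail z.1, z.2.2⟩ = f.1 z :=
    fun f => restrictSlice_apply z.2.1 f z rfl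
  have hG := chartMetric_eq_restrictSlice hg he z.2.1
  have hP : ∀ i j k, (curlRic (coord (isOpen_chartRegion e).uniqueDiffOn)
      (fun i j k => restrictSlice z.2.1 (Γ i j k)) (fun i j => restrictSlice z.2.1 (h i j))
      (fun i j k l => restrictSlice z.2.1 (R i j k l)) i j k).1 ⟨Fin.tail z.1, z.2.2⟩
      = (curlRic (spatial (coord hS)) Γ h R i j k).1 z := by
    intro i j k
    rw [← hr, curlRic, curlRic, map_sub, map_cov₂ hc, map_cov₂ hc]
    simp only [map_ric]
  have hMt : ∀ i j, tensorM (chartMetric (g (z.1 0)) e) (chartRegion e) (z.1 0) i j (Fin.tail z.1)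
      = (Rm 0 i.succ 0 j.succ).1 z := by
    intro i j
    have h1 := hM.tensorM_eq (exists_isOpen_eq_inter _) hG (z.1 0) i j ⟨Fin.tail z.1, z.2.2⟩
    have h3 := congrArg (fun f => (restrictSlice z.2.1 f).1 ⟨Fin.tail z.1, z.2.2⟩)
      (hF.limit_time hu hC i j)
    have r2 : restrictSlice z.2.1 (2 : smoothAlg (spacetimeRegion e T)) = 2 := map_ofNat _ 2
    have r4 : restrictSlice z.2.1 (4 : smoothAlg (spacetimeRegion e T)) = 4 := map_ofNat _ 4
    have hτ : (restrictSlice z.2.1 (timeFun e T)).1 ⟨Fin.tail z.1, z.2.2⟩ = 1 / (2 * z.1 0) := by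
      rw [hr]; rfl
    have e2 : (2 : smoothAlg (chartRegion e)).1 ⟨Fin.tail z.1, z.2.2⟩ = 2 :=
      map_ofNat (smoothAlg.eval (⟨Fin.tail z.1, z.2.2⟩ : chartRegion e)) 2
    simp only [map_add, map_sub, map_mul, map_sum, map_cov₃ hc, map_cov₂ hc, map_ric, map_sca, hc,
      r2, r4] at h3
    rw [smoothAlg.add_val, smoothAlg.mul_val, smoothAlg.mul_val, smoothAlg.mul_val, e2, hτ,
      hr] at h3
    have ht : (1 : ℝ) / z.1 0 = 2 * (1 / (2 * z.1 0)) := by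
      have := z.2.1.1
      field_simp
    rw [ht] at h1
    linear_combination (h1 - h3) / 2
  rw [hM.reaction_eq (exists_isOpen_eq_inter _) hG (z.1 0) _ _ ⟨Fin.tail z.1, z.2.2⟩]
  simp only [hr, hP, hMt]
  exact hF.heatForm_zero hu hC z hv w Γ₀

end FlowLimit

/-! ### The estimate -/

section FamilyValues

variable {n : ℕ} {S D : Set (Fin (n + 1) → ℝ)} {s τ : smoothAlg S} {ε : ℝ}

/-- The heat form of the member with parameter `ε` is obtained from the family by evaluation. -/
theorem heatForm_member (hm : Set.MapsTo (fun y => (ε, y)) D (familyDomain s τ))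
    (hD' : UniqueDiffOn ℝ D) (hD : UniqueDiffOn ℝ (familyDomain s τ))
    (H : Fin (n + 1) → Fin (n + 1) → smoothAlg (familyDomain s τ))
    (Γ : Fin (n + 1) → Fin (n + 1) → Fin (n + 1) → smoothAlg (familyDomain s τ))
    (R : Fin (n + 1) → Fin (n + 1) → Fin (n + 1) → Fin (n + 1) → smoothAlg (familyDomain s τ))
    (x : D) (t : ℝ) (v w : Fin (n + 1) → Fin (n + 1) → ℝ) :
    heatForm t v w (fun a b => (member hm (H a b)).1 x)
      (fun a b => (member hm (Γ a 0 b)).1 x)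
      (fun a b c f => (cov₄ (coord hD') (fun a b c => member hm (Γ a b c))
          (fun a b c f => member hm (R a b c f)) 0 a b c f
        - ∑ k, ∑ l, member hm (H k l) * covTwice₄ (coord hD') (fun a b c => member hm (Γ a b c))
          (fun a b c f => member hm (R a b c f)) l k a b c f).1 x)
      (fun a b c f => (member hm (R a b c f)).1 x)
      (fun k a b c f => (cov₄ (coord hD') (fun a b c => member hm (Γ a b c))
          (fun a b c f => member hm (R a b c f)) k a b c f).1 x)
      = heatForm t v w (fun a b => ext₀ (H a b).1 (ε, x.1)) (fun a b => ext₀ (Γ a 0 b).1 (ε, x.1))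
        (fun a b c f => ext₀ (cov₄ (famCoord hD) Γ R 0 a b c f
          - ∑ k, ∑ l, H k l * covTwice₄ (famCoord hD) Γ R l k a b c f).1 (ε, x.1))
        (fun a b c f => ext₀ (R a b c f).1 (ε, x.1))
        (fun k a b c f => ext₀ (cov₄ (famCoord hD) Γ R k a b c f).1 (ε, x.1)) := by
  have hc := member_coord hm hD' hD
  have hv : ∀ f : smoothAlg (familyDomain s τ), ext₀ f.1 (ε, x.1) = (member hm f).1 x := fun f =>
    (ext₀_coe f.1 ⟨(ε, x.1), hm x.2⟩).trans (member_apply hm f x).symm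
  simp only [hv, map_sub, map_sum, map_mul, map_cov₄ hc, map_covTwice₄ hc]

theorem contDiffOn_family_value {X : Set ℝ} {y : Fin (n + 1) → ℝ}
    (hX : Set.MapsTo (fun ε => (ε, y)) X (familyDomain s τ)) (f : smoothAlg (familyDomain s τ)) :
    ContDiffOn ℝ 1 (fun ε => ext₀ f.1 (ε, y)) X :=
  (f.contDiffOn.comp (contDiff_id.prodMk contDiff_const).contDiffOn hX).of_le
    (WithTop.coe_le_coe.2 le_top)

end FamilyValues

end ThermostatHarnack

open ThermostatHarnack in
theorem lemma4p1 {n : ℕ} {M : Type*} [TopologicalSpace M]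
    [ChartedSpace (EuclideanSpace ℝ (Fin n)) M] [IsManifold (𝓡 n) ∞ M]
    (g : ℝ → Bundle.ContMDiffRiemannianMetric (𝓡 n) ∞ (EuclideanSpace ℝ (Fin n))
      (fun x : M => TangentSpace (𝓡 n) x))
    (T : ℝ) (hg : IsRicciFlow g T)
    (e : OpenPartialHomeomorph M (EuclideanSpace ℝ (Fin n)))
    (he : e ∈ IsManifold.maximalAtlas (𝓡 n) ∞ M)
    (z : Fin (n + 1) → ℝ) (hz : z ∈ spacetimeRegion e T) (K : ℝ) :
    ∃ C : ℝ, ∃ N₀ : ℕ, ∀ N : ℕ, N₀ ≤ N →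
      ∀ U : (Fin (n + 1) → ℝ) → Matrix (Fin (n + 1)) (Fin (n + 1)) ℝ,
        (∀ y ∈ spacetimeRegion e T, ∀ a b, U y a b = -U y b a) →
        (∀ a b, ContDiffWithinAt ℝ 2 (fun y => U y a b) (spacetimeRegion e T) z) →
        (∀ a b, |U z a b| ≤ K) →
        (∀ a b, |pd (spacetimeRegion e T) 0 (fun y => U y a b) z| ≤ K) →
        IsExtendedAt (thermostatMetric g e N) (spacetimeRegion e T) U z →
        |heatScalar (thermostatMetric g e N) (spacetimeRegion e T)
            (curvForm (thermostatMetric g e N) (spacetimeRegion e T) U) z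
          - reaction (chartMetric (g (z 0)) e) (chartRegion e) (z 0)
              (timePart (U z)) (spacePart (U z)) (Fin.tail z)| ≤ C / N := by
  have hS := isRegularDomain_spacetimeRegion e T (hz.1.1.trans_le hz.1.2)
  obtain ⟨h, Γ, R, hF⟩ := exists_isFlow hg he hS
  obtain ⟨u, hu⟩ := exists_inv_family (sca h R) (timeFun e T)
  have hDr := isRegularDomain_familyDomain hS (sca h R) (timeFun e T)
  have hD := hDr.uniqueDiffOn
  have hC := hF.isCurvature_family (hD := hD) hDr hu
  have hm0 : Set.MapsTo (fun y => ((0 : ℝ), y)) (spacetimeRegion e T)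
      (familyDomain (sca h R) (timeFun e T)) := fun y hy => by
    have h1 : ext₀ (timeFun e T).1 y = 1 / (2 * y 0) := ext₀_coe _ ⟨y, hy⟩
    have := hy.1.1
    refine ⟨hy, ?_⟩
    simp only [h1, zero_mul, zero_sub, neg_ne_zero]
    positivity
  -- at the given point the family is defined on an interval of parameters around `0`
  obtain ⟨ε₁, hε₁, hX⟩ : ∃ ε₁ > 0, Set.MapsTo (fun ε : ℝ => (ε, z)) (Set.Icc 0 ε₁)
      (familyDomain (sca h R) (timeFun e T)) := by
    obtain ⟨V, hV, hDV⟩ := exists_familyDomain_eq (sca h R) (timeFun e T)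
    have h0 : (0 : ℝ) ∈ (fun ε : ℝ => (ε, z)) ⁻¹' V := (hDV.subset (hm0 hz)).2
    have hV' : IsOpen ((fun ε : ℝ => (ε, z)) ⁻¹' V) := hV.preimage (by fun_prop)
    obtain ⟨r, hr, hball⟩ := Metric.isOpen_iff.1 hV' 0 h0
    refine ⟨r / 2, half_pos hr, fun ε hε => hDV.superset ⟨⟨trivial, hz⟩, hball ?_⟩⟩
    rw [Metric.mem_ball, dist_zero_right, Real.norm_of_nonneg hε.1]
    linarith [hε.2]
  have hval := fun f => contDiffOn_family_value hX f
  obtain ⟨C, hC'⟩ := exists_heatForm_sub_le (1 / (2 * z 0)) K ε₁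
    (fun a b => hval (familyInv h R (timeFun e T) u a b))
    (fun a b => hval (familyConn h Γ R (timeFun e T) hD u a 0 b))
    (fun a b c f => hval (cov₄ (famCoord hD) (familyConn h Γ R (timeFun e T) hD u)
      (familyCurv (flowMetric hg he) h Γ R (timeFun e T) hD u) 0 a b c f
        - ∑ k, ∑ l, familyInv h R (timeFun e T) u k l * covTwice₄ (famCoord hD)
          (familyConn h Γ R (timeFun e T) hD u)
          (familyCurv (flowMetric hg he) h Γ R (timeFun e T) hD u) l k a b c f))
    (fun a b c f => hval (familyCurv (flowMetric hg he) h Γ R (timeFun e T) hD u a b c f))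
    (fun k a b c f => hval (cov₄ (famCoord hD) (familyConn h Γ R (timeFun e T) hD u)
      (familyCurv (flowMetric hg he) h Γ R (timeFun e T) hD u) k a b c f))
  -- the member of interest has the parameter `1 / N`
  obtain ⟨N₀, hN₀⟩ := exists_nat_gt (1 / ε₁)
  refine ⟨C, N₀, fun N hN U hU hU2 hUK hUK' hE => ?_⟩
  have hNpos : 1 / ε₁ < (N : ℝ) := hN₀.trans_le (by exact_mod_cast hN)
  have hN0 : (0 : ℝ) < N := (by positivity : 0 < 1 / ε₁).trans hNpos
  have hε : (1 : ℝ) / N ∈ Set.Icc 0 ε₁ :=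
    ⟨by positivity, by rw [div_le_iff₀ hN0]; rw [div_lt_iff₀ hε₁] at hNpos; linarith⟩
  have hνε : (N : ℝ) * (1 / N) = 1 := mul_one_div_cancel hN0.ne'
  have hm : Set.MapsTo (fun y => ((1 : ℝ) / N, y)) (memberDomain (sca h R) (timeFun e T) (1 / N))
    (familyDomain (sca h R) (timeFun e T)) := fun y hy => hy
  have hDS := exists_memberDomain_eq (sca h R) (timeFun e T) (1 / N)
  have hDN : IsRegularDomain (memberDomain (sca h R) (timeFun e T) (1 / N)) := by
    obtain ⟨V, hV, h⟩ := hDS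
    rw [h]
    exact hS.inter hV
  have key := heatScalar_eq_heatForm (V := fun y => U y) hS.uniqueDiffOn hDS
    (hF.isMetric_member (hD := hD) hm hu hDN hνε) (thermostatMetric_eq hF hνε hm)
    (fun a b c f => by rw [hC.pair]) ⟨z, hX hε⟩ hU hU2 hE
  have key1 := heatForm_member hm hDN.uniqueDiffOn hD (familyInv h R (timeFun e T) u)
    (familyConn h Γ R (timeFun e T) hD u)
    (familyCurv (flowMetric hg he) h Γ R (timeFun e T) hD u) ⟨z, hX hε⟩ (1 / (2 * z 0)) (U z)
    (fun a b => pd (spacetimeRegion e T) 0 (fun y => U y a b) z)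
  -- the member with the parameter `0`
  have key0 := heatForm_member hm0 hS.uniqueDiffOn hD (familyInv h R (timeFun e T) u)
    (familyConn h Γ R (timeFun e T) hD u)
    (familyCurv (flowMetric hg he) h Γ R (timeFun e T) hD u) ⟨z, hz⟩ (1 / (2 * z 0)) (U z)
    (fun a b => pd (spacetimeRegion e T) 0 (fun y => U y a b) z)
  have hC0 := hC.map (member_coord hm0 hS.uniqueDiffOn hD)
    fun _ _ f => smoothAlg.deriv_comm hS _ _ f
  simp only [member_zero_familyInv, member_zero_familyConn hm0 hS.uniqueDiffOn] at key0 hC0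
  have lim := heatForm_zero_eq_reaction hF (member_zero_inv hm0 hu) hC0 ⟨z, hz⟩ (v := U z)
    (hU z hz) (fun a b => pd (spacetimeRegion e T) 0 (fun y => U y a b) z)
    (fun a b => (thermoConn (coord hS.uniqueDiffOn) h Γ R (timeFun e T) 0 (member hm0 u)
      a 0 b).1 ⟨z, hz⟩)
  have hsub := hC' (1 / N) hε (U z) (fun a b => pd (spacetimeRegion e T) 0 (fun y => U y a b) z)
    hUK hUK'
  rw [← key0, lim, ← key1, ← key, mul_one_div] at hsub
  exact hsub
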